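/- **Setting.** Let $\phi,\psi$ be real polynomials of degree at most two such that $\phi$ is concave on $[0,1]$, $\phi(0)=\phi(1)=0$, $-1<\phi'(1)<0$, and $\psi$ is convex on $[0,1]$, $\psi(1)=0$, $\psi'(1)<0$, $\psi''(1)-\phi''(1)>0$. Put $\kappa_0=\phi'(1)/\psi'(1)$. For a function $w$ on $[0,1)$ let $c=-w'$ (defined where $w$ is differentiable), $h(x)=\int_x^1 w(y)\,dy$, and let $\beta=c\,h/w^2$ be the *beta function* of $w$. In limits and suprema involving a beta function, $x$ runs over the points where it is defined (all of $[0,1)$ if $w$ is differentiable). Let $w_0:[0,1)\to(0,\infty)$ be non-increasing with $w_0(x)\to0$ as $x\to1$, of the form $w_0(x)=\int_x^1c_0(y)\,dy$ with $c_0=-w_0'$ a.e., and $\int_0^1w_0(x)\,dx=1$. A *solution* with initial data $w_0$ is a pair $(w,\kappa)$, with $\kappa:[0,\infty)\to(0,\infty)$ continuous and $w:[0,1)\times[0,\infty)\to\mathbb R$, such that $w(\cdot,0)=w_0$ and $$\frac{\partial w}{\partial t}+[\phi(x)-\kappa(t)\psi(x)]\frac{\partial w}{\partial x}=w,\qquad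 \int_0^1w(x,t)\,dx=1,\qquad 0\le x<1,\ t\ge0,$$ where the first equation means that $\frac{d}{ds}w(X(s),s)=w(X(s),s)$ along every curve $X:[0,T]\to[0,1)$ with $X'(s)=\phi(X(s))-\kappa(s)\psi(X(s))$. The *time independent solution* $w_\kappa$ with parameter $\kappa\ge\kappa_0$ is the positive differentiable function on $[0,1)$ with $(\phi-\kappa\psi)w_\kappa'=w_\kappa$ and $\int_0^1w_\kappa=1$; its beta function is $\beta_\kappa$. Let $\beta(\cdot,t)$ be the beta function of $w(\cdot,t)$, and assume $$\lim_{x\to1}\beta(x,0)=\beta_0>0 .$$ **Theorem 1.2.** 1. (Reduction to a two dimensional system.) For $(u,v)\in D=\{u>0,\ u+|\phi'(1)|v\ge1\}$ put $$a=\frac{\psi''(1)(u-1)+|\phi'(1)|\,[\psi''(1)-2\psi'(1)]\,v}{2|\psi'(1)|},\quad F_{u,v}(x)=1-\frac{1-x}{u+a(1-x)},\quad G(u,v)=\int_0^1w_0(F_{u,v}(x))\,dx .$$ Then $G$ is $C^1$ on $D$ and $G_u<0$ on $D$ (derivatives being taken within $D$). If $(w,\kappa)$ is a solution with initial data $w_0$,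 then the functions $u(t)=\exp\int_0^t[\phi'(1)-\psi'(1)\kappa(s)]\,ds$ and $v(t)=\int_0^tu(s)\,ds$ stay in $D$ and satisfy $$\frac{dv}{dt}=u,\qquad G(u,v)+G_u(u,v)\frac{du}{dt}+G_v(u,v)\,u=0,\qquad u(0)=1,\ v(0)=0,\qquad(*)$$ and $w(x,t)=e^tw_0(F_{u(t),v(t)}(x))$ for $0\le x<1$, $t\ge0$. Conversely, if $(u,v):[0,\infty)\to D$ solves $(*)$, then $w(x,t)=e^tw_0(F_{u(t),v(t)}(x))$ and $\kappa(t)=[\phi'(1)-u'(t)/u(t)]/\psi'(1)$ form a solution with initial data $w_0$. 2. If $\beta_0<1$, set $\kappa=[1/\beta_0-\phi'(1)-1]/|\psi'(1)|$. Then $w_\kappa$ exists, and every solution $(w,\kappa(\cdot))$ with initial data $w_0$ satisfies $$\lim_{t\to\infty}\kappa(t)=\kappa,\qquad\lim_{t\to\infty}\ \sup_{0\le x<1}|\beta(x,t)-\beta_\kappa(x)|=0 .$$ 3. If $\beta_0=1$, then $w_{\kappa_0}$ exists, and every solution $(w,\kappa(\cdot))$ with initial data $w_0$ satisfies, for every $0<\varepsilon<1$,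 $$\lim_{t\to\infty}\kappa(t)=\kappa_0,\qquad\lim_{t\to\infty}\ \sup_{0\le x\le1-\varepsilon}|\beta(x,t)-\beta_{\kappa_0}(x)|=0 .$$ -/

import Mathlib

open Set Filter Topology MeasureTheory

noncomputable section

namespace LSW

/-! ### Coefficients -/

/-- The value `p'(1)`. -/
def slope (p : Polynomial ℝ) : ℝ := p.derivative.eval 1

/-- The value `p''(1)`. -/
def curv (p : Polynomial ℝ) : ℝ := p.derivative.derivative.eval 1

/-- Structural conditions on the coefficients `φ`, `ψ` (polynomials are automatically smooth). -/
structure IsAdmissible (φ ψ : Polynomial ℝ) : Prop where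
  concave : ConcaveOn ℝ (Icc 0 1) (fun x => φ.eval x)
  phi_zero : φ.eval 0 = 0
  phi_one : φ.eval 1 = 0
  slope_phi_gt : -1 < slope φ
  slope_phi_neg : slope φ < 0
  convex : ConvexOn ℝ (Icc 0 1) (fun x => ψ.eval x)
  psi_one : ψ.eval 1 = 0
  slope_psi_neg : slope ψ < 0
  curv_pos : 0 < curv ψ - curv φ

/-! ### The functions `c`, `h`, `β` attached to a profile `w` on `[0,1)` -/

/-- `c = -w'` on `[0,1)` (one-sided derivative at `0`). -/
def density (w : ℝ → ℝ) (x : ℝ) : ℝ := -derivWithin w (Ico 0 1) x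

/-- `h(x) = ∫_x^1 w`. -/
def tail (w : ℝ → ℝ) (x : ℝ) : ℝ := ∫ y in x..1, w y

/-- The beta function `β = c h / w²`. -/
def betaFun (w : ℝ → ℝ) (x : ℝ) : ℝ := density w x * tail w x / w x ^ 2

/-- The points of `[0,1)` at which `c = -w'`, hence `β`, is defined.  It is all of `[0,1)` if `w` is
differentiable there, and it has full measure in `[0,1)` if `w` is monotone. -/
def betaDomain (w : ℝ → ℝ) : Set ℝ :=
  {x | x ∈ Ico (0 : ℝ) 1 ∧ DifferentiableWithinAt ℝ w (Ico 0 1) x}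

/-- Initial data: strictly positive and decreasing (in the wide sense) on `[0,1)`, tending to `0`
at `1`, of the form `w₀(x) = ∫_x^1 c₀` with `c₀ = -w₀'` (almost everywhere), and of mass one. -/
structure IsInitialDatum (w₀ : ℝ → ℝ) : Prop where
  antitone : AntitoneOn w₀ (Ico 0 1)
  pos : ∀ x ∈ Ico (0 : ℝ) 1, 0 < w₀ x
  tendsto_zero : Tendsto w₀ (𝓝[<] 1) (𝓝 0)
  eq_integral : ∀ x ∈ Ico (0 : ℝ) 1, w₀ x = ∫ y in x..1, density w₀ y
  mass : ∫ x in (0 : ℝ)..1, w₀ x = 1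

/-! ### The evolution -/

/-- `X : [0,T] → [0,1)` is a characteristic curve: `X' = φ(X) - κ ψ(X)`. -/
def IsCharacteristic (φ ψ : Polynomial ℝ) (κ : ℝ → ℝ) (T : ℝ) (X : ℝ → ℝ) : Prop :=
  ∀ s ∈ Icc 0 T, X s ∈ Ico (0 : ℝ) 1 ∧
    HasDerivWithinAt X (φ.eval (X s) - κ s * ψ.eval (X s)) (Icc 0 T) s

/-- `w` solves `∂w/∂t + (φ - κ ψ) ∂w/∂x = w` for `0 ≤ x < 1`, `t ≥ 0`: the derivative of `w` along
every characteristic curve is `w`.  This makes sense for `w` which is not differentiable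
everywhere; differentiable solutions are covered by `solvesTransport_of_differentiable`. -/
def SolvesTransport (φ ψ : Polynomial ℝ) (w : ℝ → ℝ → ℝ) (κ : ℝ → ℝ) : Prop :=
  ∀ T : ℝ, 0 ≤ T → ∀ X : ℝ → ℝ, IsCharacteristic φ ψ κ T X →
    ∀ s ∈ Icc 0 T, HasDerivWithinAt (fun r => w (X r) r) (w (X s) s) (Icc 0 T) s

/-- A classical solution of the partial differential equation is a solution. -/
theorem solvesTransport_of_differentiable (φ ψ : Polynomial ℝ) (w : ℝ → ℝ → ℝ) (κ : ℝ → ℝ)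
    (L : ℝ → ℝ → (ℝ × ℝ →L[ℝ] ℝ))
    (hL : ∀ x ∈ Ico (0 : ℝ) 1, ∀ t : ℝ, 0 ≤ t →
      HasFDerivWithinAt (fun p : ℝ × ℝ => w p.1 p.2) (L x t) (Ico 0 1 ×ˢ Ici 0) (x, t))
    (hpde : ∀ x ∈ Ico (0 : ℝ) 1, ∀ t : ℝ, 0 ≤ t →
      L x t (0, 1) + (φ.eval x - κ t * ψ.eval x) * L x t (1, 0) = w x t) :
    SolvesTransport φ ψ w κ := by
  intro T _ X hX s hs
  have hd : HasDerivWithinAt (fun r => (X r, r))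
      (φ.eval (X s) - κ s * ψ.eval (X s), 1) (Icc 0 T) s :=
    (hX s hs).2.prodMk (hasDerivWithinAt_id s _)
  have hmaps : MapsTo (fun r => (X r, r)) (Icc 0 T) (Ico (0 : ℝ) 1 ×ˢ Ici (0 : ℝ)) :=
    fun r hr => ⟨(hX r hr).1, hr.1⟩
  have h := HasFDerivWithinAt.comp_hasDerivWithinAt (f := fun r => (X r, r)) s
    (hL (X s) (hX s hs).1 s hs.1) hd hmaps
  have hv : L (X s) s (φ.eval (X s) - κ s * ψ.eval (X s), 1) = w (X s) s := by
    rw [← hpde (X s) (hX s hs).1 s hs.1]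
    have : ((φ.eval (X s) - κ s * ψ.eval (X s), 1) : ℝ × ℝ)
        = (0, 1) + (φ.eval (X s) - κ s * ψ.eval (X s)) • ((1, 0) : ℝ × ℝ) := by
      ext <;> simp
    rw [this, map_add, map_smul, smul_eq_mul]
  rw [hv] at h
  exact h

/-- `(w, κ)` is a solution, for all times `t ≥ 0`, of the transport equation with the conservation
law `∫_0^1 w(x,t) dx = 1` and initial data `w₀`. -/
structure IsSolution (φ ψ : Polynomial ℝ) (w₀ : ℝ → ℝ) (w : ℝ → ℝ → ℝ) (κ : ℝ → ℝ) : Prop where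
  continuousOn : ContinuousOn κ (Ici 0)
  kappa_pos : ∀ t : ℝ, 0 ≤ t → 0 < κ t
  initial : ∀ x ∈ Ico (0 : ℝ) 1, w x 0 = w₀ x
  transport : SolvesTransport φ ψ w κ
  mass : ∀ t : ℝ, 0 ≤ t → ∫ x in (0 : ℝ)..1, w x t = 1

/-- `W` is the time independent solution with parameter `κ`: positive on `[0,1)`, of mass one, and
`(φ - κ ψ) W' = W` on `[0,1)`. -/
structure IsSteadyState (φ ψ : Polynomial ℝ) (κ : ℝ) (W : ℝ → ℝ) : Prop where
  differentiableOn : DifferentiableOn ℝ W (Ico 0 1)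
  pos : ∀ x ∈ Ico (0 : ℝ) 1, 0 < W x
  ode : ∀ x ∈ Ico (0 : ℝ) 1,
    (φ.eval x - κ * ψ.eval x) * derivWithin W (Ico 0 1) x = W x
  mass : ∫ x in (0 : ℝ)..1, W x = 1

/-! ### The two dimensional system -/

/-- The coefficient `a` as a function of `(u, v)`. -/
def aCoef (φ ψ : Polynomial ℝ) (p : ℝ × ℝ) : ℝ :=
  (curv ψ * (p.1 - 1) + |slope φ| * (curv ψ - 2 * slope ψ) * p.2) / (2 * |slope ψ|)

/-- The map `x ↦ 1 - (1 - x) / (u + a (1 - x))`. -/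
def flowMap (φ ψ : Polynomial ℝ) (p : ℝ × ℝ) (x : ℝ) : ℝ :=
  1 - (1 - x) / (p.1 + aCoef φ ψ p * (1 - x))

/-- The phase space of the system: the points `(u, v)` with `u > 0` for which `flowMap` maps
`[0,1)` into itself. -/
def phaseSpace (φ : Polynomial ℝ) : Set (ℝ × ℝ) :=
  {p | 0 < p.1 ∧ 1 ≤ p.1 + |slope φ| * p.2}

/-- `G(u, v) = ∫_0^1 w₀(1 - (1 - x) / (u + a (1 - x))) dx`. -/
def G (φ ψ : Polynomial ℝ) (w₀ : ℝ → ℝ) (p : ℝ × ℝ) : ℝ :=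
  ∫ x in (0 : ℝ)..1, w₀ (flowMap φ ψ p x)

/-- The partial derivative `∂G/∂u` on the phase space (one-sided on its boundary). -/
def Gu (φ ψ : Polynomial ℝ) (w₀ : ℝ → ℝ) (p : ℝ × ℝ) : ℝ :=
  fderivWithin ℝ (G φ ψ w₀) (phaseSpace φ) p (1, 0)

/-- The partial derivative `∂G/∂v` on the phase space (one-sided on its boundary). -/
def Gv (φ ψ : Polynomial ℝ) (w₀ : ℝ → ℝ) (p : ℝ × ℝ) : ℝ :=
  fderivWithin ℝ (G φ ψ w₀) (phaseSpace φ) p (0, 1)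

/-- `(u, v)` solves `dv/dt = u`, `G + G_u du/dt + G_v u = 0` with `u(0) = 1`, `v(0) = 0`. -/
structure IsReducedSolution (φ ψ : Polynomial ℝ) (w₀ : ℝ → ℝ) (u v : ℝ → ℝ) : Prop where
  u_zero : u 0 = 1
  v_zero : v 0 = 0
  mem : ∀ t : ℝ, 0 ≤ t → (u t, v t) ∈ phaseSpace φ
  v_ode : ∀ t : ℝ, 0 ≤ t → HasDerivWithinAt v (u t) (Ici 0) t
  u_diff : DifferentiableOn ℝ u (Ici 0)
  u_ode : ∀ t : ℝ, 0 ≤ t →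
    G φ ψ w₀ (u t, v t) + Gu φ ψ w₀ (u t, v t) * derivWithin u (Ici 0) t
      + Gv φ ψ w₀ (u t, v t) * u t = 0

/-- `u(t) = exp ∫_0^t (φ'(1) - ψ'(1) κ(s)) ds`. -/
def uOf (φ ψ : Polynomial ℝ) (κ : ℝ → ℝ) (t : ℝ) : ℝ :=
  Real.exp (∫ s in (0 : ℝ)..t, (slope φ - slope ψ * κ s))

/-- `v(t) = ∫_0^t u(s) ds`. -/
def vOf (φ ψ : Polynomial ℝ) (κ : ℝ → ℝ) (t : ℝ) : ℝ :=
  ∫ s in (0 : ℝ)..t, uOf φ ψ κ s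

/-- The system is equivalent to the two dimensional system of ordinary differential equations
for `(u, v)`: the latter is a genuine one (`G` is `C¹` and `∂G/∂u < 0`), every solution of the
former gives one of the latter, and conversely. -/
structure ReducesToPlanarODE (φ ψ : Polynomial ℝ) (w₀ : ℝ → ℝ) : Prop where
  contDiffOn : ContDiffOn ℝ 1 (G φ ψ w₀) (phaseSpace φ)
  Gu_neg : ∀ p ∈ phaseSpace φ, Gu φ ψ w₀ p < 0
  to_ode : ∀ (w : ℝ → ℝ → ℝ) (κ : ℝ → ℝ), IsSolution φ ψ w₀ w κ →
    IsReducedSolution φ ψ w₀ (uOf φ ψ κ) (vOf φ ψ κ) ∧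
    ∀ x ∈ Ico (0 : ℝ) 1, ∀ t : ℝ, 0 ≤ t →
      w x t = Real.exp t * w₀ (flowMap φ ψ (uOf φ ψ κ t, vOf φ ψ κ t) x)
  of_ode : ∀ u v : ℝ → ℝ, IsReducedSolution φ ψ w₀ u v →
    IsSolution φ ψ w₀ (fun x t => Real.exp t * w₀ (flowMap φ ψ (u t, v t) x))
      (fun t => (slope φ - derivWithin u (Ici 0) t / u t) / slope ψ)

/-- The beta function of `w(·,t)` converges to that of `W` as `t → ∞`, uniformly on `S ⊆ [0,1)`. -/
def BetaTendstoUniformlyOn (w : ℝ → ℝ → ℝ) (W : ℝ → ℝ) (S : Set ℝ) : Prop :=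
  ∀ δ : ℝ, 0 < δ → ∀ᶠ t in atTop, ∀ x ∈ S ∩ betaDomain (fun y => w y t),
    |betaFun (fun y => w y t) x - betaFun W x| ≤ δ

end LSW

end

/-!
# Convergence of the beta function for a nonlocal transport equation

In the variable `z = 1 - x` the characteristics have speed `κ |ψ'(1)| - |φ'(1)|` times `z` plus a
multiple of `z ^ 2`, because `φ` and `ψ` are quadratic. Such a flow consists of Möbius maps, which
gives the explicit form `z / (u + a z)` of the backward flow (`IsPath.exists_characteristic`,
`IsPath.flowMap_characteristic`). With the profile `g s = w₀ (1 - s)` the conservation law becomes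
`e^t ∫₀¹ g (z / (u + a z)) dz = 1`. The substitution `s = z / (u + a z)` moves `u` and `a` from the
argument of `g` to a smooth kernel and to the limit of integration; hence the mass is `C¹` although
`g` is only absolutely continuous (`IsProfile.hasStrictFDerivAt_mass`), its derivatives are given by
the mass `m₀` and the first moment `m₁`, and differentiating the conservation law in time is the
planar system (`reducesToPlanarODE`).

For the asymptotics put `H = ∫₀ˢ g`, `k = H / (s g)`, `S = 1 / (u + a)` and `η = u' / u`. Since
`S → 0`, only the germ of `g` at `0` matters, where `(H / g)' = 1 - β` is close to `1 - β₀`. So `k` is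
close to `1 - β₀`, and its oscillation is small even relative to `1 - s / S`. From this follows the
identity `k(S) (g(S) - m₀) + (a / u) k(S) (g(S) - m₁) ≈ β₀ m₀`, with a relative error that does not
depend on `u` and `a` (`BetaNear.abs_moment_identity_le`); it is exact if `g` is a power. Inserted
into the planar system, it shows that the slow variable `(a / u) k(S)` relaxes to a constant on a
time scale whose total length is infinite (`IsMassFlow.tendsto_slowVar`), and the rate `η` tends to
`1 / β₀ - 1` (`IsMassFlow.tendsto_rate`), which determines the limit of `κ`.

The limit of the slow variable is `β₀ q`, where `p z + q z ^ 2` is the speed of the stationary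
characteristics, with `β₀ p = 1 - β₀`. Hence `k` along the flow, times `(u + a z) / u`, is close to
`β₀ (p + q z)`, the logarithmic derivatives of the transported and of the stationary profile have a
quotient close to `1`, and their beta functions are close to each other
(`IsNearSteady.abs_beta_sub_steadyBeta_le`). The estimates are relative to `p + q z`. For `β₀ < 1`
this is bounded below by `p > 0`, while for `β₀ = 1` one has `p = 0`, and the part of the tail near
`z = 0` is cut off; this is why the convergence is then only uniform away from `x = 1`.
-/

noncomputable section

namespace LSW

/-! ### Profiles and weighted primitives -/

section

/-- A profile read from the right end point: `g s` stands for `w₀ (1 - s)`, continued by `0` to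
`s ≤ 0` and by a positive bounded function to `s > 1`, so that it is a function on the whole line. -/
structure IsProfile (g : ℝ → ℝ) : Prop where
  continuous : Continuous g
  monotone : Monotone g
  eq_zero : ∀ s ≤ 0, g s = 0
  pos : ∀ s, 0 < s → 0 < g s
  bounded : ∃ C, ∀ s, g s ≤ C

theorem IsProfile.nonneg {g : ℝ → ℝ} (hg : IsProfile g) (s : ℝ) : 0 ≤ g s := by
  rcases le_or_gt s 0 with h | h
  · exact (hg.eq_zero s h).ge
  · exact (hg.pos s h).le

/-- A lower bound for the denominators `1 - a s`, uniform in `s ∈ [0, σ]` as long as `a σ ≤ b < 1`; no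
sign of `a` is assumed. -/
theorem min_one_le_one_sub_mul {b x θ : ℝ} (hb : x ≤ b) (h0 : 0 ≤ θ) (h1 : θ ≤ 1) :
    min 1 (1 - b) ≤ 1 - x * θ := by
  rcases le_or_gt 0 x with h | h
  · refine (min_le_right _ _).trans ?_
    nlinarith
  · refine (min_le_left _ _).trans ?_
    nlinarith

theorem one_sub_mul_pos {a σ s : ℝ} (h : a * σ < 1) (h0 : 0 ≤ s) (h1 : s ≤ σ) : 0 < 1 - a * s := by
  rcases le_or_gt 0 a with ha | ha
  · nlinarith
  · nlinarith

/-- The auxiliary integral through which the mass depends on the coefficients of the flow map. -/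
def weightedPrimitive (g : ℝ → ℝ) (a σ : ℝ) : ℝ := ∫ s in (0 : ℝ)..σ, g s / (1 - a * s) ^ 2

/-- The derivative of `weightedPrimitive` in its first argument. -/
def weightedPrimitiveDeriv (g : ℝ → ℝ) (a σ : ℝ) : ℝ :=
  ∫ s in (0 : ℝ)..σ, 2 * s * g s / (1 - a * s) ^ 3

variable {g : ℝ → ℝ}

theorem IsProfile.continuousOn_div_pow (hg : IsProfile g) {P : ℝ → ℝ} (hP : Continuous P)
    {a σ : ℝ} (hσ : 0 ≤ σ) (h : a * σ < 1) (n : ℕ) :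
    ContinuousOn (fun s => P s * g s / (1 - a * s) ^ n) (uIcc 0 σ) := by
  rw [uIcc_of_le hσ]
  refine ContinuousOn.div (hP.mul hg.continuous).continuousOn (by fun_prop) ?_
  intro s hs
  exact (pow_pos (one_sub_mul_pos h hs.1 hs.2) n).ne'

theorem IsProfile.hasDerivAt_weightedPrimitive_right (hg : IsProfile g) {a σ : ℝ} (hσ : 0 < σ)
    (h : a * σ < 1) :
    HasDerivAt (weightedPrimitive g a) (g σ / (1 - a * σ) ^ 2) σ := by
  have hc : ContinuousOn (fun s => g s / (1 - a * s) ^ 2) (uIcc 0 σ) := by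
    simpa using hg.continuousOn_div_pow (P := fun _ => 1) continuous_const hσ.le h 2
  refine intervalIntegral.integral_hasDerivAt_right hc.intervalIntegrable ?_ ?_
  · refine (Measurable.stronglyMeasurable ?_).stronglyMeasurableAtFilter
    have := hg.continuous.measurable
    fun_prop
  · refine ContinuousAt.div hg.continuous.continuousAt (by fun_prop) ?_
    exact (pow_pos (by linarith) 2).ne'

theorem IsProfile.hasDerivAt_weightedPrimitive_left (hg : IsProfile g) {a σ : ℝ} (hσ : 0 < σ)
    (h : a * σ < 1) :
    HasDerivAt (fun b => weightedPrimitive g b σ) (weightedPrimitiveDeriv g a σ) a := by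
  obtain ⟨C, hC⟩ := hg.bounded
  have hC0 : 0 ≤ C := (hg.nonneg 0).trans (hC 0)
  -- for parameters below `a₁` the denominators stay away from `0`
  obtain ⟨a₁, ha₁, ha₁'⟩ : ∃ a₁, a < a₁ ∧ a₁ < 1 / σ := exists_between (by rwa [lt_div_iff₀ hσ])
  have hb : a₁ * σ < 1 := by rwa [lt_div_iff₀ hσ] at ha₁'
  set c := min 1 (1 - a₁ * σ) with hc
  have hc0 : 0 < c := lt_min one_pos (by linarith)
  have hlow : ∀ b < a₁, ∀ s ∈ Icc 0 σ, c ≤ 1 - b * s := by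
    intro b hb s hs
    have := min_one_le_one_sub_mul (b := a₁ * σ) (x := b * σ) (θ := s / σ) (by nlinarith)
      (div_nonneg hs.1 hσ.le) ((div_le_one hσ).2 hs.2)
    rwa [mul_assoc, mul_div_cancel₀ _ hσ.ne'] at this
  refine (intervalIntegral.hasDerivAt_integral_of_dominated_loc_of_deriv_le
    (F := fun b s => g s / (1 - b * s) ^ 2) (F' := fun b s => 2 * s * g s / (1 - b * s) ^ 3)
    (bound := fun _ => 2 * σ * C / c ^ 3) (Iio_mem_nhds ha₁) ?_ ?_ ?_ ?_ ?_ ?_).2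
  · refine Eventually.of_forall fun b => (Measurable.aestronglyMeasurable ?_)
    have := hg.continuous.measurable
    fun_prop
  · have := hg.continuousOn_div_pow (P := fun _ => 1) continuous_const hσ.le h 2
    simpa using this.intervalIntegrable
  · refine Measurable.aestronglyMeasurable ?_
    have := hg.continuous.measurable
    fun_prop
  · refine Eventually.of_forall fun s hs b hb => ?_
    rw [uIoc_of_le hσ.le] at hs
    have h1 := hlow b hb s ⟨hs.1.le, hs.2⟩
    have h2 : 0 < 1 - b * s := hc0.trans_le h1
    rw [Real.norm_eq_abs, abs_of_nonneg (div_nonneg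
      (mul_nonneg (by linarith [hs.1]) (hg.nonneg s)) (pow_nonneg h2.le 3))]
    have := hg.nonneg s
    have := hC s
    have := hs.1
    have := hs.2
    have : 0 ≤ 2 * σ * C := by positivity
    gcongr
  · exact intervalIntegrable_const
  · refine Eventually.of_forall fun s hs b hb => ?_
    rw [uIoc_of_le hσ.le] at hs
    have h1 := hlow b hb s ⟨hs.1.le, hs.2⟩
    have h2 : 0 < 1 - b * s := hc0.trans_le h1
    have h3 : HasDerivAt (fun b => 1 - b * s) (-s) b := by
      simpa using ((hasDerivAt_id b).mul_const s).const_sub 1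
    have h4 := (hasDerivAt_const b (g s)).div (h3.pow 2) (pow_pos h2 2).ne'
    refine h4.congr_deriv ?_
    simp only [Pi.pow_apply]
    field_simp
    ring

theorem IsProfile.continuousAt_weightedPrimitiveDeriv (hg : IsProfile g) {a σ : ℝ} (hσ : 0 < σ)
    (h : a * σ < 1) :
    ContinuousAt (fun p : ℝ × ℝ => weightedPrimitiveDeriv g p.1 p.2) (a, σ) := by
  obtain ⟨C, hC⟩ := hg.bounded
  have hC0 : 0 ≤ C := (hg.nonneg 0).trans (hC 0)
  obtain ⟨b, hb, hb1⟩ := exists_between h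
  have hc0 : 0 < min 1 (1 - b) := lt_min one_pos (by linarith)
  set c := min 1 (1 - b) with hc
  -- rescaling makes the interval of integration independent of the parameters
  have key : (fun p : ℝ × ℝ => weightedPrimitiveDeriv g p.1 p.2) = fun p : ℝ × ℝ =>
      p.2 * ∫ θ in (0 : ℝ)..1, 2 * (p.2 * θ) * g (p.2 * θ) / (1 - p.1 * p.2 * θ) ^ 3 := by
    funext p
    have := intervalIntegral.smul_integral_comp_mul_left
      (fun s => 2 * s * g s / (1 - p.1 * s) ^ 3) p.2 (a := 0) (b := 1)
    simp only [mul_zero, mul_one, smul_eq_mul, ← mul_assoc] at this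
    simp only [weightedPrimitiveDeriv, ← this, ← mul_assoc]
  have hev : ∀ᶠ p : ℝ × ℝ in 𝓝 (a, σ), 0 < p.2 ∧ p.2 < σ + 1 ∧ p.1 * p.2 < b := by
    have h1 : ContinuousAt (fun p : ℝ × ℝ => p.2) (a, σ) := by fun_prop
    have h2 : ContinuousAt (fun p : ℝ × ℝ => p.1 * p.2) (a, σ) := by fun_prop
    filter_upwards [h1.eventually (lt_mem_nhds hσ), h1.eventually (gt_mem_nhds (lt_add_one σ)),
      h2.eventually (gt_mem_nhds hb)] with p h1 h2 h3 using ⟨h1, h2, h3⟩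
  rw [key]
  refine continuousAt_snd.mul ?_
  refine intervalIntegral.continuousAt_of_dominated_interval
    (bound := fun _ => 2 * ((σ + 1) * 1) * C / c ^ 3) ?_ ?_ ?_ ?_
  · refine Eventually.of_forall fun p => Measurable.aestronglyMeasurable ?_
    have := hg.continuous.measurable
    fun_prop
  · filter_upwards [hev] with p hp
    refine Eventually.of_forall fun θ hθ => ?_
    rw [uIoc_of_le zero_le_one] at hθ
    have h1 : c ≤ 1 - p.1 * p.2 * θ := min_one_le_one_sub_mul hp.2.2.le hθ.1.le hθ.2
    have h2 : 0 < 1 - p.1 * p.2 * θ := hc0.trans_le h1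
    have h3 := hp.1
    have h4 := hθ.1
    have h5 := hg.nonneg (p.2 * θ)
    have h6 := hC (p.2 * θ)
    have h7 := hp.2.1.le
    have h8 := hθ.2
    have h9 : 0 ≤ 2 * ((σ + 1) * 1) * C := by positivity
    rw [Real.norm_eq_abs, abs_of_nonneg (by positivity)]
    gcongr
  · exact intervalIntegrable_const
  · refine Eventually.of_forall fun θ hθ => ?_
    rw [uIoc_of_le zero_le_one] at hθ
    have h1 : c ≤ 1 - a * σ * θ := min_one_le_one_sub_mul hb.le hθ.1.le hθ.2
    refine ContinuousAt.div ?_ (by fun_prop) (pow_pos (hc0.trans_le h1) 3).ne'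
    have := hg.continuous
    fun_prop

theorem IsProfile.hasStrictFDerivAt_weightedPrimitive (hg : IsProfile g) {a σ : ℝ} (hσ : 0 < σ)
    (h : a * σ < 1) :
    HasStrictFDerivAt (fun p : ℝ × ℝ => weightedPrimitive g p.1 p.2)
      (weightedPrimitiveDeriv g a σ • ContinuousLinearMap.fst ℝ ℝ ℝ +
        (g σ / (1 - a * σ) ^ 2) • ContinuousLinearMap.snd ℝ ℝ ℝ) (a, σ) := by
  have hev : ∀ᶠ p : ℝ × ℝ in 𝓝 (a, σ), 0 < p.2 ∧ p.1 * p.2 < 1 := by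
    have h1 : ContinuousAt (fun p : ℝ × ℝ => p.2) (a, σ) := by fun_prop
    have h2 : ContinuousAt (fun p : ℝ × ℝ => p.1 * p.2) (a, σ) := by fun_prop
    filter_upwards [h1.eventually (lt_mem_nhds hσ), h2.eventually (gt_mem_nhds h)] with p h1 h2
      using ⟨h1, h2⟩
  have := hasStrictFDerivAt_uncurry_coprod (𝕜 := ℝ) (u := (a, σ)) (f := weightedPrimitive g)
    (f₁ := fun a σ => ContinuousLinearMap.toSpanSingleton ℝ (weightedPrimitiveDeriv g a σ))
    (f₂ := fun a σ => ContinuousLinearMap.toSpanSingleton ℝ (g σ / (1 - a * σ) ^ 2))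
    ?_ ?_ ?_ ?_
  · refine this.congr_fderiv ?_
    ext <;> simp [Function.HasUncurry.uncurry]
  · filter_upwards [hev] with p hp
    exact (hg.hasDerivAt_weightedPrimitive_left hp.1 hp.2).hasFDerivAt
  · filter_upwards [hev] with p hp
    exact (hg.hasDerivAt_weightedPrimitive_right hp.1 hp.2).hasFDerivAt
  · exact (ContinuousLinearMap.toSpanSingletonCLE (𝕜 := ℝ) (E := ℝ)).continuous.continuousAt.comp
      (hg.continuousAt_weightedPrimitiveDeriv hσ h)
  · refine (ContinuousLinearMap.toSpanSingletonCLE (𝕜 := ℝ) (E := ℝ)).continuous.continuousAt.comp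
      (f := fun p : ℝ × ℝ => g p.2 / (1 - p.1 * p.2) ^ 2) ?_
    have := hg.continuous
    exact ContinuousAt.div (by fun_prop) (by fun_prop) (pow_pos (by linarith : 0 < 1 - a * σ) 2).ne'

end

/-! ### Mass and moment of a transported profile -/

section

/-- The mass `∫₀¹ g (z / (u + a z)) dz` of the profile transported by the flow map. -/
def mass (g : ℝ → ℝ) (u a : ℝ) : ℝ := ∫ z in (0 : ℝ)..1, g (z / (u + a * z))

/-- The first moment `∫₀¹ 2 z g (z / (u + a z)) dz` of the transported profile. -/
def moment (g : ℝ → ℝ) (u a : ℝ) : ℝ := ∫ z in (0 : ℝ)..1, 2 * z * g (z / (u + a * z))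

variable {g : ℝ → ℝ}

theorem add_mul_pos {u a z : ℝ} (hu : 0 < u) (hua : 0 < u + a) (h0 : 0 ≤ z) (h1 : z ≤ 1) :
    0 < u + a * z := by
  rcases le_or_gt 0 a with h | h
  · positivity
  · nlinarith

theorem mul_one_div_add_lt_one {u a : ℝ} (hu : 0 < u) (hua : 0 < u + a) : a * (1 / (u + a)) < 1 := by
  rw [mul_one_div, div_lt_one hua]
  linarith

theorem IsProfile.continuousOn_comp_flow (hg : IsProfile g) {P : ℝ → ℝ} (hP : Continuous P)
    {u a : ℝ} (hu : 0 < u) (hua : 0 < u + a) :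
    ContinuousOn (fun z => P z * g (z / (u + a * z))) (Icc 0 1) := by
  refine hP.continuousOn.mul (hg.continuous.comp_continuousOn ?_)
  exact continuousOn_id.div (by fun_prop) fun z hz => (add_mul_pos hu hua hz.1 hz.2).ne'

theorem IsProfile.intervalIntegrable_comp_flow (hg : IsProfile g) {P : ℝ → ℝ} (hP : Continuous P)
    {u a z : ℝ} (hu : 0 < u) (hua : 0 < u + a) (h0 : 0 ≤ z) (h1 : z ≤ 1) :
    IntervalIntegrable (fun z => P z * g (z / (u + a * z))) volume 0 z := by
  refine ContinuousOn.intervalIntegrable ?_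
  rw [uIcc_of_le h0]
  exact (hg.continuousOn_comp_flow hP hu hua).mono (Icc_subset_Icc_right h1)

theorem hasDerivAt_mul_div_one_sub {u a s : ℝ} (h : 1 - a * s ≠ 0) :
    HasDerivAt (fun s => u * s / (1 - a * s)) (u / (1 - a * s) ^ 2) s := by
  have h1 : HasDerivAt (fun s => u * s) u s := by simpa using (hasDerivAt_id s).const_mul u
  have h2 : HasDerivAt (fun s => 1 - a * s) (-a) s := by
    simpa using ((hasDerivAt_id s).const_mul a).const_sub 1
  refine (h1.div h2 h).congr_deriv ?_
  field_simp
  ring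

/-- The substitution `z = u s / (1 - a s)`, inverse to `s = z / (u + a z)`. -/
theorem IsProfile.integral_comp_flow (hg : IsProfile g) {P : ℝ → ℝ} (hP : Continuous P)
    {u a : ℝ} (hu : 0 < u) (hua : 0 < u + a) :
    ∫ z in (0 : ℝ)..1, P z * g (z / (u + a * z)) =
      ∫ s in (0 : ℝ)..1 / (u + a), P (u * s / (1 - a * s)) * g s * (u / (1 - a * s) ^ 2) := by
  have hσ : 0 < 1 / (u + a) := by positivity
  have hlt := mul_one_div_add_lt_one hu hua
  have hpos : ∀ s ∈ Icc 0 (1 / (u + a)), 0 < 1 - a * s := fun s hs =>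
    one_sub_mul_pos hlt hs.1 hs.2
  have hinv : ∀ s ∈ Icc 0 (1 / (u + a)),
      u + a * (u * s / (1 - a * s)) = u / (1 - a * s) := fun s hs => by
    have := (hpos s hs).ne'
    field_simp
    ring
  have key := intervalIntegral.integral_comp_mul_deriv'' (a := 0) (b := 1 / (u + a))
    (f := fun s => u * s / (1 - a * s)) (f' := fun s => u / (1 - a * s) ^ 2)
    (g := fun z => P z * g (z / (u + a * z))) ?_ ?_ ?_ ?_
  · have e0 : u * 0 / (1 - a * 0) = 0 := by simp
    have e1 : u * (1 / (u + a)) / (1 - a * (1 / (u + a))) = 1 := by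
      have h1 := (hpos _ (right_mem_Icc.2 hσ.le)).ne'
      rw [div_eq_one_iff_eq h1]
      field_simp
      ring
    simp only [e0, e1] at key
    rw [← key]
    refine intervalIntegral.integral_congr fun s hs => ?_
    rw [uIcc_of_le hσ.le] at hs
    have h1 := (hpos s hs).ne'
    simp only [Function.comp_apply]
    rw [hinv s hs]
    rw [div_div_div_cancel_right₀ h1, mul_div_cancel_left₀ _ hu.ne']
  · rw [uIcc_of_le hσ.le]
    exact fun s hs => (hasDerivAt_mul_div_one_sub (hpos s hs).ne').continuousAt.continuousWithinAt
  · rw [min_eq_left hσ.le, max_eq_right hσ.le]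
    intro s hs
    exact (hasDerivAt_mul_div_one_sub (hpos s ⟨hs.1.le, hs.2.le⟩).ne').hasDerivWithinAt
  · rw [uIcc_of_le hσ.le]
    exact continuousOn_const.div (by fun_prop) fun s hs => (pow_pos (hpos s hs) 2).ne'
  · rw [uIcc_of_le hσ.le]
    rintro _ ⟨s, hs, rfl⟩
    refine ContinuousAt.continuousWithinAt ?_
    have h1 := hpos s hs
    refine hP.continuousAt.mul (hg.continuous.continuousAt.comp ?_)
    refine continuousAt_id.div (by fun_prop) ?_
    simp only [hinv s hs]
    positivity

theorem IsProfile.mass_eq (hg : IsProfile g) {u a : ℝ} (hu : 0 < u) (hua : 0 < u + a) :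
    mass g u a = u * weightedPrimitive g a (1 / (u + a)) := by
  have := hg.integral_comp_flow (P := fun _ => 1) continuous_const hu hua
  simp only [one_mul] at this
  rw [mass, this, weightedPrimitive, ← intervalIntegral.integral_const_mul]
  refine intervalIntegral.integral_congr fun s _ => ?_
  ring

theorem IsProfile.moment_eq (hg : IsProfile g) {u a : ℝ} (hu : 0 < u) (hua : 0 < u + a) :
    moment g u a = u ^ 2 * weightedPrimitiveDeriv g a (1 / (u + a)) := by
  have := hg.integral_comp_flow (P := fun z => 2 * z) (by fun_prop) hu hua
  rw [moment, this, weightedPrimitiveDeriv, ← intervalIntegral.integral_const_mul]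
  refine intervalIntegral.integral_congr fun s hs => ?_
  rw [uIcc_of_le (by positivity)] at hs
  have := (one_sub_mul_pos (mul_one_div_add_lt_one hu hua) hs.1 hs.2).ne'
  field_simp

/-- The mass is a strictly differentiable function of `(u, a)`.  No differentiability of the profile
is needed: the substitution `s = z / (u + a z)` moves the parameters away from the profile. -/
theorem IsProfile.hasStrictFDerivAt_mass (hg : IsProfile g) {p : ℝ × ℝ} (hu : 0 < p.1)
    (hua : 0 < p.1 + p.2) :
    HasStrictFDerivAt (fun q : ℝ × ℝ => mass g q.1 q.2)
      ((-(g (1 / (p.1 + p.2)) - mass g p.1 p.2) / p.1) • ContinuousLinearMap.fst ℝ ℝ ℝ +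
        (-(g (1 / (p.1 + p.2)) - moment g p.1 p.2) / p.1) • ContinuousLinearMap.snd ℝ ℝ ℝ) p := by
  obtain ⟨u, a⟩ := p
  simp only at hu hua ⊢
  have hσ : 0 < 1 / (u + a) := by positivity
  have hev : (fun q : ℝ × ℝ => mass g q.1 q.2) =ᶠ[𝓝 (u, a)]
      fun q : ℝ × ℝ => q.1 * weightedPrimitive g q.2 (1 / (q.1 + q.2)) := by
    have h1 : ContinuousAt (fun p : ℝ × ℝ => p.1) (u, a) := by fun_prop
    have h2 : ContinuousAt (fun p : ℝ × ℝ => p.1 + p.2) (u, a) := by fun_prop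
    filter_upwards [h1.eventually (lt_mem_nhds hu), h2.eventually (lt_mem_nhds hua)] with q h1 h2
    exact hg.mass_eq h1 h2
  refine HasStrictFDerivAt.congr_of_eventuallyEq ?_ hev.symm
  have hJ := hg.hasStrictFDerivAt_weightedPrimitive hσ (mul_one_div_add_lt_one hu hua)
  have hsum : HasStrictFDerivAt (fun q : ℝ × ℝ => q.1 + q.2)
      (ContinuousLinearMap.fst ℝ ℝ ℝ + ContinuousLinearMap.snd ℝ ℝ ℝ) (u, a) :=
    hasStrictFDerivAt_fst.add hasStrictFDerivAt_snd
  have hinv := (hasStrictDerivAt_inv hua.ne').comp_hasStrictFDerivAt (u, a) hsum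
  have hpair := (hasStrictFDerivAt_snd (𝕜 := ℝ) (p := (u, a))).prodMk hinv
  have hJ' : HasStrictFDerivAt (fun p : ℝ × ℝ => weightedPrimitive g p.1 p.2)
      (weightedPrimitiveDeriv g a (1 / (u + a)) • ContinuousLinearMap.fst ℝ ℝ ℝ +
        (g (1 / (u + a)) / (1 - a * (1 / (u + a))) ^ 2) • ContinuousLinearMap.snd ℝ ℝ ℝ)
      ((u, a).2, (Inv.inv ∘ fun q : ℝ × ℝ => q.1 + q.2) (u, a)) := by
    simpa using hJ
  have htot := (hasStrictFDerivAt_fst (𝕜 := ℝ) (p := (u, a))).mul (hJ'.comp (u, a) hpair)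
  have h1 : (fun q : ℝ × ℝ => q.1 * weightedPrimitive g q.2 (1 / (q.1 + q.2))) =
      fun q : ℝ × ℝ => q.1 * ((fun p : ℝ × ℝ => weightedPrimitive g p.1 p.2) ∘
        fun q : ℝ × ℝ => (q.2, (Inv.inv ∘ fun q : ℝ × ℝ => q.1 + q.2) q)) q := by
    funext q
    simp
  rw [h1]
  refine htot.congr_fderiv ?_
  have h2 : 1 - a * (1 / (u + a)) = u / (u + a) := by
    field_simp
    ring
  rw [hg.mass_eq hu hua, hg.moment_eq hu hua, h2]
  simp only [one_div]
  ext <;> simp <;> field_simp <;> ring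

theorem IsProfile.mass_pos (hg : IsProfile g) {u a : ℝ} (hu : 0 < u) (hua : 0 < u + a) :
    0 < mass g u a := by
  have h := hg.intervalIntegrable_comp_flow (P := fun _ => 1) continuous_const hu hua zero_le_one
    le_rfl
  simp only [one_mul] at h
  refine intervalIntegral.intervalIntegral_pos_of_pos_on h (fun z hz => ?_) one_pos
  exact hg.pos _ (div_pos hz.1 (add_mul_pos hu hua hz.1.le hz.2.le))

theorem IsProfile.moment_nonneg (hg : IsProfile g) (u a : ℝ) : 0 ≤ moment g u a :=
  intervalIntegral.integral_nonneg zero_le_one fun z hz =>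
    mul_nonneg (by linarith [hz.1]) (hg.nonneg _)

theorem IsProfile.moment_le (hg : IsProfile g) {u a : ℝ} (hu : 0 < u) (hua : 0 < u + a) :
    moment g u a ≤ 2 * mass g u a := by
  have h1 := hg.intervalIntegrable_comp_flow (P := fun z => 2 * z) (by fun_prop) hu hua
    zero_le_one le_rfl
  have h2 := hg.intervalIntegrable_comp_flow (P := fun _ => 2) (by fun_prop) hu hua
    zero_le_one le_rfl
  rw [mass, ← intervalIntegral.integral_const_mul]
  refine intervalIntegral.integral_mono_on zero_le_one h1 h2 fun z hz => ?_
  have := hg.nonneg (z / (u + a * z))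
  nlinarith [hz.1, hz.2]

theorem div_add_mul_le {u a y z : ℝ} (hu : 0 < u) (hua : 0 < u + a) (hy : 0 ≤ y) (hyz : y ≤ z)
    (hz : z ≤ 1) : y / (u + a * y) ≤ z / (u + a * z) := by
  rw [div_le_div_iff₀ (add_mul_pos hu hua hy (hyz.trans hz))
    (add_mul_pos hu hua (hy.trans hyz) hz)]
  nlinarith

/-- The defect of the mass: since the profile is increasing and vanishes at `0`, the mass is smaller
than the largest value. -/
theorem IsProfile.mass_lt (hg : IsProfile g) {u a : ℝ} (hu : 0 < u) (hua : 0 < u + a) :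
    mass g u a < g (1 / (u + a)) := by
  have hc := hg.continuousOn_comp_flow (P := fun _ => 1) continuous_const hu hua
  simp only [one_mul] at hc
  have := intervalIntegral.integral_lt_integral_of_continuousOn_of_le_of_exists_lt
    (a := 0) (b := 1) one_pos hc (continuousOn_const (c := g (1 / (u + a)))) ?_ ?_
  · simpa [mass] using this
  · intro z hz
    refine hg.monotone ?_
    simpa using div_add_mul_le hu hua hz.1.le hz.2 le_rfl
  · exact ⟨0, by simp, by simpa [hg.eq_zero 0 le_rfl] using hg.pos _ (by positivity)⟩

/-- The defect of the moment is `∫ 2 z (g(S) - g(z / (u + a z)))`, and `0 ≤ 2 z ≤ 2`. -/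
theorem IsProfile.moment_defect_bounds (hg : IsProfile g) {u a : ℝ} (hu : 0 < u) (hua : 0 < u + a) :
    0 ≤ g (1 / (u + a)) - moment g u a ∧
      g (1 / (u + a)) - moment g u a ≤ 2 * (g (1 / (u + a)) - mass g u a) := by
  have h1 := hg.intervalIntegrable_comp_flow (P := fun z => 2 * z) (by fun_prop) hu hua
    zero_le_one le_rfl
  have h2 := hg.intervalIntegrable_comp_flow (P := fun _ => 1) (by fun_prop) hu hua
    zero_le_one le_rfl
  have h3 : IntervalIntegrable (fun z => 2 * z * g (1 / (u + a))) volume 0 1 :=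
    (by fun_prop : Continuous fun z => 2 * z * g (1 / (u + a))).intervalIntegrable _ _
  have h5 : ∫ z in (0 : ℝ)..1, 2 * z * g (1 / (u + a)) = g (1 / (u + a)) := by
    rw [intervalIntegral.integral_mul_const, intervalIntegral.integral_const_mul, integral_id]
    ring
  have h6 : ∫ z in (0 : ℝ)..1, g (1 / (u + a)) = g (1 / (u + a)) := by simp
  have hle : ∀ z ∈ Icc (0 : ℝ) 1, g (z / (u + a * z)) ≤ g (1 / (u + a)) := fun z hz => by
    refine hg.monotone ?_
    simpa using div_add_mul_le hu hua hz.1 hz.2 le_rfl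
  have e1 : g (1 / (u + a)) - moment g u a =
      ∫ z in (0 : ℝ)..1, (2 * z * g (1 / (u + a)) - 2 * z * g (z / (u + a * z))) := by
    rw [intervalIntegral.integral_sub h3 h1, h5, moment]
  have e2 : g (1 / (u + a)) - mass g u a =
      ∫ z in (0 : ℝ)..1, (g (1 / (u + a)) - 1 * g (z / (u + a * z))) := by
    rw [intervalIntegral.integral_sub intervalIntegrable_const h2, h6, mass]
    simp
  constructor
  · rw [e1]
    refine intervalIntegral.integral_nonneg zero_le_one fun z hz => ?_
    nlinarith [hle z hz, hz.1]
  · rw [e1, e2, ← intervalIntegral.integral_const_mul]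
    refine intervalIntegral.integral_mono_on zero_le_one (h3.sub h1)
      ((intervalIntegrable_const.sub h2).const_mul 2) fun z hz => ?_
    nlinarith [hle z hz, hz.1, hz.2]

end

/-! ### The initial datum as a profile -/

section

/-- The initial datum as a function of the distance `s = 1 - x` to the right end point,
continued by the constant `w₀ 0` beyond `s = 1`. -/
def profile (w₀ : ℝ → ℝ) (s : ℝ) : ℝ := if s ≤ 0 then 0 else w₀ (1 - min s 1)

theorem profile_of_nonpos (w₀ : ℝ → ℝ) {s : ℝ} (h : s ≤ 0) : profile w₀ s = 0 := if_pos h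

theorem profile_of_mem (w₀ : ℝ → ℝ) {s : ℝ} (h : 0 < s) (h1 : s ≤ 1) :
    profile w₀ s = w₀ (1 - s) := by
  rw [profile, if_neg h.not_ge, min_eq_left h1]

theorem absolutelyContinuousOnInterval_congr {f g : ℝ → ℝ} {a b : ℝ}
    (hf : AbsolutelyContinuousOnInterval f a b) (h : EqOn f g (uIcc a b)) :
    AbsolutelyContinuousOnInterval g a b := by
  rw [absolutelyContinuousOnInterval_iff] at hf ⊢
  intro ε hε
  obtain ⟨δ, hδ, H⟩ := hf ε hε
  refine ⟨δ, hδ, fun E hE hs => ?_⟩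
  refine lt_of_eq_of_lt (Finset.sum_congr rfl fun i hi => ?_) (H E hE hs)
  rw [h (hE.1 i hi).1, h (hE.1 i hi).2]

section InitialDatum

variable {w₀ : ℝ → ℝ} (hw : IsInitialDatum w₀)
include hw

theorem IsInitialDatum.intervalIntegrable_density :
    IntervalIntegrable (fun r => density w₀ (1 - r)) volume 0 1 := by
  have h : IntervalIntegrable (density w₀) volume 0 1 := by
    -- otherwise the integral in `eq_integral` is `0` by convention, against `0 < w₀ 0`
    by_contra h
    have h0 := hw.eq_integral 0 (by simp)
    rw [intervalIntegral.integral_undef h] at h0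
    exact (hw.pos 0 (by simp)).ne' h0
  simpa using (h.comp_sub_left 1).symm

theorem IsInitialDatum.profile_eq_integral {s : ℝ} (h0 : 0 ≤ s) (h1 : s ≤ 1) :
    profile w₀ s = ∫ r in (0 : ℝ)..s, density w₀ (1 - r) := by
  rcases h0.eq_or_lt with rfl | h0
  · simp [profile]
  · rw [profile_of_mem w₀ h0 h1, hw.eq_integral (1 - s) ⟨by linarith, by linarith⟩,
      intervalIntegral.integral_comp_sub_left (fun r => density w₀ r) 1]
    simp

theorem IsInitialDatum.absolutelyContinuous_profile :
    AbsolutelyContinuousOnInterval (profile w₀) 0 1 := by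
  refine absolutelyContinuousOnInterval_congr
    (hw.intervalIntegrable_density.absolutelyContinuousOnInterval_intervalIntegral (c := 0)
      (by simp)) fun s hs => ?_
  rw [uIcc_of_le zero_le_one] at hs
  exact (hw.profile_eq_integral hs.1 hs.2).symm

theorem IsInitialDatum.isProfile : IsProfile (profile w₀) := by
  have hmem : ∀ s, 0 < s → 1 - min s 1 ∈ Ico (0 : ℝ) 1 := fun s hs =>
    ⟨by linarith [min_le_right s 1], by linarith [lt_min hs one_pos]⟩
  have hpos : ∀ s, 0 < s → 0 < profile w₀ s := fun s hs => by
    rw [profile, if_neg hs.not_ge]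
    exact hw.pos _ (hmem s hs)
  have hnn : ∀ s, 0 ≤ profile w₀ s := fun s => by
    rcases le_or_gt s 0 with h | h
    · rw [profile_of_nonpos w₀ h]
    · exact (hpos s h).le
  refine ⟨?_, ?_, fun s hs => profile_of_nonpos w₀ hs, hpos, w₀ 0, ?_⟩
  · have hc : ContinuousOn (profile w₀) (Icc 0 1) := by
      have := hw.absolutelyContinuous_profile.continuousOn
      rwa [uIcc_of_le zero_le_one] at this
    have he : profile w₀ = fun s => profile w₀ (max 0 (min s 1)) := by
      funext s
      rcases le_or_gt s 0 with h | h
      · rw [max_eq_left ((min_le_left _ _).trans h), profile_of_nonpos w₀ h,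
          profile_of_nonpos w₀ le_rfl]
      · have h1 : 0 < min s 1 := lt_min h one_pos
        rw [max_eq_right h1.le, profile, profile, if_neg h.not_ge, if_neg h1.not_ge]
        simp
    rw [he]
    exact hc.comp_continuous (by fun_prop) fun s =>
      ⟨le_max_left _ _, max_le zero_le_one (min_le_right _ _)⟩
  · intro s t hst
    rcases le_or_gt s 0 with h | h
    · rw [profile_of_nonpos w₀ h]
      exact hnn t
    · rw [profile, profile, if_neg h.not_ge, if_neg (h.trans_le hst).not_ge]
      exact hw.antitone (hmem t (h.trans_le hst)) (hmem s h)
        (sub_le_sub_left (min_le_min_right 1 hst) 1)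
  · intro s
    rcases le_or_gt s 0 with h | h
    · rw [profile_of_nonpos w₀ h]
      exact (hw.pos 0 (by simp)).le
    · rw [profile, if_neg h.not_ge]
      exact hw.antitone (by simp) (hmem s h) (hmem s h).1

end InitialDatum

theorem tail_one_sub {w₀ : ℝ → ℝ} {s : ℝ} (h0 : 0 ≤ s) (h1 : s ≤ 1) :
    tail w₀ (1 - s) = ∫ r in (0 : ℝ)..s, profile w₀ r := by
  have h := intervalIntegral.integral_comp_sub_left (fun y => w₀ y) 1 (a := 0) (b := s)
  rw [sub_zero] at h
  rw [tail, ← h]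
  refine intervalIntegral.integral_congr_ae (Eventually.of_forall fun r hr => ?_)
  rw [uIoc_of_le h0] at hr
  exact (profile_of_mem w₀ hr.1 (hr.2.trans h1)).symm

theorem betaFun_one_sub {w₀ : ℝ → ℝ} {s : ℝ} (h0 : 0 < s) (h1 : s < 1)
    (hd : DifferentiableAt ℝ (profile w₀) s) :
    1 - s ∈ betaDomain w₀ ∧ betaFun w₀ (1 - s) =
      deriv (profile w₀) s * (∫ r in (0 : ℝ)..s, profile w₀ r) / profile w₀ s ^ 2 := by
  have hs : HasDerivAt (profile w₀) (deriv (profile w₀) s) (1 - (1 - s)) := by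
    simpa using hd.hasDerivAt
  have h2 : HasDerivAt (fun x => profile w₀ (1 - x)) (deriv (profile w₀) s * (-1)) (1 - s) :=
    hs.comp (1 - s) ((hasDerivAt_id (1 - s)).const_sub 1)
  have h3 : HasDerivWithinAt w₀ (deriv (profile w₀) s * (-1)) (Ico 0 1) (1 - s) := by
    refine h2.hasDerivWithinAt.congr (fun x hx => ?_) ?_
    · rw [profile_of_mem w₀ (by linarith [hx.2]) (by linarith [hx.1]), sub_sub_cancel]
    · rw [profile_of_mem w₀ (by linarith) (by linarith), sub_sub_cancel]
  have hx : 1 - s ∈ Ico (0 : ℝ) 1 := ⟨by linarith, by linarith⟩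
  refine ⟨⟨hx, h3.differentiableWithinAt⟩, ?_⟩
  rw [betaFun, density, h3.derivWithin ((uniqueDiffOn_Ico 0 1) _ hx), tail_one_sub h0.le h1.le,
    profile_of_mem w₀ h0 h1.le]
  ring

/-- The beta function of the profile has the limit `β₀` at the origin. -/
def BetaLimit (g : ℝ → ℝ) (β₀ : ℝ) : Prop :=
  ∀ ε > 0, ∃ s₀ > 0, s₀ ≤ 1 ∧ ∀ s, 0 < s → s < s₀ → DifferentiableAt ℝ g s →
    |deriv g s * (∫ r in (0 : ℝ)..s, g r) / g s ^ 2 - β₀| ≤ ε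

theorem betaLimit_profile {w₀ : ℝ → ℝ} {β₀ : ℝ}
    (hβ : Tendsto (betaFun w₀) (𝓝[betaDomain w₀] 1) (𝓝 β₀)) : BetaLimit (profile w₀) β₀ := by
  intro ε hε
  have h := hβ.eventually (Metric.closedBall_mem_nhds β₀ hε)
  obtain ⟨δ, hδ, H⟩ := Metric.mem_nhdsWithin_iff.1 h
  refine ⟨min δ 1, lt_min hδ one_pos, min_le_right _ _, fun s h0 hs hd => ?_⟩
  obtain ⟨hm, he⟩ := betaFun_one_sub h0 (hs.trans_le (min_le_right _ _)) hd
  have := H ⟨?_, hm⟩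
  · rw [← he]
    simpa [Real.dist_eq] using this
  · rw [Metric.mem_ball, Real.dist_eq, sub_sub_cancel_left, abs_neg, abs_of_pos h0]
    exact hs.trans_le (min_le_left _ _)

/-! ### Quadratic coefficients in the variable `1 - x` -/

/-- The constant `K = 1 + ψ''(1) / (2 |ψ'(1)|) ≥ 1`, in terms of which the coefficient of the flow map
is `a = (K - 1) (u - 1) + |φ'(1)| K v`. -/
def stretch (ψ : Polynomial ℝ) : ℝ := 1 + curv ψ / (2 * |slope ψ|)

theorem eval_eq_of_natDegree_le_two {p : Polynomial ℝ} (hp : p.natDegree ≤ 2) (x : ℝ) :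
    p.eval x = p.eval 1 - slope p * (1 - x) + curv p / 2 * (1 - x) ^ 2 := by
  obtain ⟨a, b, c, rfl⟩ : ∃ a b c : ℝ, p = Polynomial.C a * Polynomial.X ^ 2 +
      Polynomial.C b * Polynomial.X + Polynomial.C c :=
    ⟨p.coeff 2, p.coeff 1, p.coeff 0,
      Polynomial.eq_quadratic_of_degree_le_two (Polynomial.natDegree_le_iff_degree_le.1 hp)⟩
  simp [slope, curv]
  ring

section Coefficients

variable {φ ψ : Polynomial ℝ} (h : IsAdmissible φ ψ)
include h

theorem IsAdmissible.abs_slope_phi : |slope φ| = -slope φ := abs_of_neg h.slope_phi_neg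
theorem IsAdmissible.abs_slope_psi : |slope ψ| = -slope ψ := abs_of_neg h.slope_psi_neg
theorem IsAdmissible.abs_slope_psi_pos : 0 < |slope ψ| := abs_pos.2 h.slope_psi_neg.ne
theorem IsAdmissible.abs_slope_phi_pos : 0 < |slope φ| := abs_pos.2 h.slope_phi_neg.ne
theorem IsAdmissible.abs_slope_phi_lt : |slope φ| < 1 := by
  rw [h.abs_slope_phi]
  linarith [h.slope_phi_gt]

theorem IsAdmissible.eval_phi (hφ : φ.natDegree ≤ 2) (x : ℝ) :
    φ.eval x = |slope φ| * ((1 - x) - (1 - x) ^ 2) := by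
  have h1 := eval_eq_of_natDegree_le_two hφ x
  have h0 := eval_eq_of_natDegree_le_two hφ 0
  rw [h.phi_one] at h0 h1
  rw [h.phi_zero] at h0
  rw [h1, h.abs_slope_phi]
  linear_combination -(1 - x) ^ 2 * h0

theorem IsAdmissible.eval_psi (hψ : ψ.natDegree ≤ 2) (x : ℝ) :
    ψ.eval x = |slope ψ| * (1 - x) + curv ψ / 2 * (1 - x) ^ 2 := by
  have h1 := eval_eq_of_natDegree_le_two hψ x
  rw [h.psi_one] at h1
  rw [h1, h.abs_slope_psi]
  ring

theorem IsAdmissible.curv_psi_nonneg (hψ : ψ.natDegree ≤ 2) : 0 ≤ curv ψ := by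
  have h1 := h.convex.2 (left_mem_Icc.2 zero_le_one) (right_mem_Icc.2 zero_le_one)
    (by norm_num : (0 : ℝ) ≤ 1 / 2) (by norm_num : (0 : ℝ) ≤ 1 / 2) (by norm_num)
  simp only [smul_eq_mul, h.eval_psi hψ] at h1
  nlinarith

theorem IsAdmissible.one_le_stretch (hψ : ψ.natDegree ≤ 2) : 1 ≤ stretch ψ := by
  have := h.curv_psi_nonneg hψ
  have := h.abs_slope_psi_pos
  rw [stretch, le_add_iff_nonneg_right]
  positivity

theorem IsAdmissible.aCoef_eq (p : ℝ × ℝ) :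
    aCoef φ ψ p = (stretch ψ - 1) * (p.1 - 1) + |slope φ| * stretch ψ * p.2 := by
  have h1 : slope ψ = -|slope ψ| := by rw [h.abs_slope_psi, neg_neg]
  have h2 := h.abs_slope_psi_pos
  rw [aCoef, stretch]
  rw [h1]
  rw [abs_neg, abs_abs]
  field_simp
  ring

theorem IsAdmissible.add_aCoef (p : ℝ × ℝ) :
    p.1 + aCoef φ ψ p = 1 + stretch ψ * (p.1 + |slope φ| * p.2 - 1) := by
  rw [h.aCoef_eq]
  ring

theorem IsAdmissible.one_le_add_aCoef (hψ : ψ.natDegree ≤ 2) {p : ℝ × ℝ} (hp : p ∈ phaseSpace φ) :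
    1 ≤ p.1 + aCoef φ ψ p := by
  rw [h.add_aCoef]
  nlinarith [h.one_le_stretch hψ, hp.2]

theorem IsAdmissible.aCoef_nonneg (hψ : ψ.natDegree ≤ 2) {p : ℝ × ℝ} (hp : p ∈ phaseSpace φ)
    (hv : 0 ≤ p.2) : 0 ≤ aCoef φ ψ p := by
  rcases le_or_gt p.1 1 with h1 | h1
  · linarith [h.one_le_add_aCoef hψ hp]
  · have h2 := h.one_le_stretch hψ
    rw [h.aCoef_eq]
    exact add_nonneg (mul_nonneg (by linarith) (by linarith))
      (mul_nonneg (mul_nonneg (abs_nonneg _) (by linarith)) hv)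

end Coefficients

end

/-! ### Smoothness of the mass on the phase space -/

section

theorem IsProfile.continuousAt_mass {g : ℝ → ℝ} (hg : IsProfile g) {p : ℝ × ℝ} (hu : 0 < p.1)
    (hua : 0 < p.1 + p.2) : ContinuousAt (fun q : ℝ × ℝ => mass g q.1 q.2) p :=
  (hg.hasStrictFDerivAt_mass hu hua).continuousAt

/-- The coefficients `(u, a)` for which `u + a z` is positive on `[0, 1]`. -/
theorem isOpen_flowDomain : IsOpen {p : ℝ × ℝ | 0 < p.1 ∧ 0 < p.1 + p.2} :=
  (isOpen_lt continuous_const continuous_fst).inter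
    (isOpen_lt continuous_const (continuous_fst.add continuous_snd))

theorem IsProfile.continuousAt_moment {g : ℝ → ℝ} (hg : IsProfile g) {p : ℝ × ℝ} (hu : 0 < p.1)
    (hua : 0 < p.1 + p.2) : ContinuousAt (fun q : ℝ × ℝ => moment g q.1 q.2) p := by
  have hev : (fun q : ℝ × ℝ => moment g q.1 q.2) =ᶠ[𝓝 p]
      fun q => q.1 ^ 2 * weightedPrimitiveDeriv g q.2 (1 / (q.1 + q.2)) := by
    filter_upwards [isOpen_flowDomain.mem_nhds ⟨hu, hua⟩] with q hq using hg.moment_eq hq.1 hq.2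
  refine ContinuousAt.congr ?_ hev.symm
  refine ContinuousAt.mul (by fun_prop) ?_
  have h1 := hg.continuousAt_weightedPrimitiveDeriv (σ := 1 / (p.1 + p.2)) (by positivity)
    (mul_one_div_add_lt_one hu hua)
  have h2 : ContinuousAt (fun q : ℝ × ℝ => (q.2, 1 / (q.1 + q.2))) p :=
    continuousAt_snd.prodMk (continuousAt_const.div (by fun_prop) hua.ne')
  exact ContinuousAt.comp (f := fun q : ℝ × ℝ => (q.2, 1 / (q.1 + q.2))) h1 h2

theorem IsProfile.contDiffAt_mass {g : ℝ → ℝ} (hg : IsProfile g) {p : ℝ × ℝ} (hu : 0 < p.1)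
    (hua : 0 < p.1 + p.2) : ContDiffAt ℝ 1 (fun q : ℝ × ℝ => mass g q.1 q.2) p := by
  rw [contDiffAt_one_iff]
  refine ⟨_, _, isOpen_flowDomain.mem_nhds ⟨hu, hua⟩, ?_,
    fun q hq => (hg.hasStrictFDerivAt_mass hq.1 hq.2).hasFDerivAt⟩
  intro q hq
  have h0 := hg.continuousAt_mass hq.1 hq.2
  have h1 := hg.continuousAt_moment hq.1 hq.2
  have h2 : ContinuousAt (fun q : ℝ × ℝ => g (1 / (q.1 + q.2))) q :=
    hg.continuous.continuousAt.comp (continuousAt_const.div (by fun_prop) hq.2.ne')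
  refine ContinuousAt.continuousWithinAt ?_
  exact (((h2.sub h0).neg.div continuousAt_fst hq.1.ne').smul continuousAt_const).add
    (((h2.sub h1).neg.div continuousAt_fst hq.1.ne').smul continuousAt_const)

theorem convex_phaseSpace (φ : Polynomial ℝ) : Convex ℝ (phaseSpace φ) := by
  intro p hp q hq a b ha hb hab
  obtain ⟨h1, h2⟩ := hp
  obtain ⟨h3, h4⟩ := hq
  constructor
  · simp only [Prod.fst_add, Prod.smul_fst, smul_eq_mul]
    rcases ha.eq_or_lt with rfl | ha
    · simp only [zero_add] at hab
      simp [hab, h3]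
    · have := mul_nonneg hb h3.le
      nlinarith
  · simp only [Prod.fst_add, Prod.smul_fst, smul_eq_mul, Prod.snd_add, Prod.smul_snd]
    have : a * (p.1 + |slope φ| * p.2) + b * (q.1 + |slope φ| * q.2) ≥ a * 1 + b * 1 := by gcongr
    nlinarith

theorem uniqueDiffOn_phaseSpace (φ : Polynomial ℝ) : UniqueDiffOn ℝ (phaseSpace φ) := by
  refine uniqueDiffOn_convex (convex_phaseSpace φ) ⟨(2, 0), ?_⟩
  refine mem_interior.2 ⟨{p | 0 < p.1 ∧ 1 < p.1 + |slope φ| * p.2}, fun p hp => ⟨hp.1, hp.2.le⟩,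
    ?_, by norm_num⟩
  have hc : Continuous fun p : ℝ × ℝ => p.1 + |slope φ| * p.2 := by fun_prop
  exact (isOpen_lt continuous_const continuous_fst).inter (isOpen_lt continuous_const hc)

section Reduction

variable {φ ψ : Polynomial ℝ} (h : IsAdmissible φ ψ) (hψ : ψ.natDegree ≤ 2)
  {w₀ : ℝ → ℝ} (hw : IsInitialDatum w₀)

include h hψ in
theorem IsAdmissible.flow_mem {p : ℝ × ℝ} (hp : p ∈ phaseSpace φ) {z : ℝ} (h0 : 0 < z)
    (h1 : z ≤ 1) : 0 < z / (p.1 + aCoef φ ψ p * z) ∧ z / (p.1 + aCoef φ ψ p * z) ≤ 1 := by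
  have h2 := h.one_le_add_aCoef hψ hp
  have h3 := add_mul_pos hp.1 (by linarith) h0.le h1
  refine ⟨div_pos h0 h3, ?_⟩
  have h4 := div_add_mul_le hp.1 (by linarith) h0.le h1 le_rfl
  refine h4.trans ?_
  rw [mul_one, div_le_one (by linarith)]
  exact h2

include h hψ in
theorem IsAdmissible.comp_flowMap {p : ℝ × ℝ} (hp : p ∈ phaseSpace φ) {x : ℝ}
    (hx : x ∈ Ico (0 : ℝ) 1) :
    w₀ (flowMap φ ψ p x) = profile w₀ ((1 - x) / (p.1 + aCoef φ ψ p * (1 - x))) := by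
  have h1 := h.flow_mem hψ hp (z := 1 - x) (by linarith [hx.2]) (by linarith [hx.1])
  rw [profile_of_mem w₀ h1.1 h1.2, flowMap]

include h hψ in
theorem IsAdmissible.G_eq {p : ℝ × ℝ} (hp : p ∈ phaseSpace φ) :
    G φ ψ w₀ p = mass (profile w₀) p.1 (aCoef φ ψ p) := by
  have h2 := intervalIntegral.integral_comp_sub_left
    (fun x => w₀ (flowMap φ ψ p x)) 1 (a := 0) (b := 1)
  rw [sub_zero, sub_self] at h2
  rw [G, ← h2, mass]
  refine intervalIntegral.integral_congr_ae (Eventually.of_forall fun z hz => ?_)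
  rw [uIoc_of_le zero_le_one] at hz
  rw [h.comp_flowMap (w₀ := w₀) hψ hp ⟨by linarith [hz.2], by linarith [hz.1]⟩, sub_sub_cancel]

/-- The derivative of `aCoef`. -/
def aCoefDeriv (φ ψ : Polynomial ℝ) : ℝ × ℝ →L[ℝ] ℝ :=
  (stretch ψ - 1) • ContinuousLinearMap.fst ℝ ℝ ℝ +
    (|slope φ| * stretch ψ) • ContinuousLinearMap.snd ℝ ℝ ℝ

include h in
theorem IsAdmissible.hasStrictFDerivAt_aCoef (p : ℝ × ℝ) :
    HasStrictFDerivAt (aCoef φ ψ) (aCoefDeriv φ ψ) p := by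
  have h1 : aCoef φ ψ = fun p => aCoefDeriv φ ψ p - (stretch ψ - 1) := by
    funext p
    rw [h.aCoef_eq]
    simp [aCoefDeriv]
    ring
  rw [h1]
  exact (aCoefDeriv φ ψ).hasStrictFDerivAt.sub_const _

theorem contDiff_aCoef (φ ψ : Polynomial ℝ) : ContDiff ℝ 1 (aCoef φ ψ) := by
  unfold aCoef
  fun_prop

include h hψ hw in
theorem IsAdmissible.contDiffOn_G : ContDiffOn ℝ 1 (G φ ψ w₀) (phaseSpace φ) := by
  refine ContDiffOn.congr (f := fun p => mass (profile w₀) p.1 (aCoef φ ψ p)) ?_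
    fun p hp => h.G_eq hψ hp
  intro p hp
  have h1 := h.one_le_add_aCoef hψ hp
  have h2 := hw.isProfile.contDiffAt_mass (p := (p.1, aCoef φ ψ p)) hp.1 (by simp only; linarith)
  exact (h2.comp p (contDiffAt_fst.prodMk (contDiff_aCoef φ ψ).contDiffAt)).contDiffWithinAt

include h hψ hw in
theorem IsAdmissible.hasFDerivWithinAt_G {p : ℝ × ℝ} (hp : p ∈ phaseSpace φ) :
    HasFDerivWithinAt (G φ ψ w₀)
      ((-(profile w₀ (1 / (p.1 + aCoef φ ψ p)) - mass (profile w₀) p.1 (aCoef φ ψ p)) / p.1) •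
          ContinuousLinearMap.fst ℝ ℝ ℝ +
        (-(profile w₀ (1 / (p.1 + aCoef φ ψ p)) - moment (profile w₀) p.1 (aCoef φ ψ p)) / p.1) •
          aCoefDeriv φ ψ) (phaseSpace φ) p := by
  have h1 := h.one_le_add_aCoef hψ hp
  have h2 := (hw.isProfile.hasStrictFDerivAt_mass (p := (p.1, aCoef φ ψ p)) hp.1
    (by simp only; linarith)).hasFDerivAt
  have h3 := (h2.comp p (hasFDerivAt_fst.prodMk (h.hasStrictFDerivAt_aCoef p).hasFDerivAt))
  refine HasFDerivWithinAt.congr (f := fun p => mass (profile w₀) p.1 (aCoef φ ψ p)) ?_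
    (fun q hq => h.G_eq hψ hq) (h.G_eq hψ hp)
  refine h3.hasFDerivWithinAt.congr_fderiv ?_
  ext <;> simp

include h hψ hw in
theorem IsAdmissible.Gu_eq {p : ℝ × ℝ} (hp : p ∈ phaseSpace φ) :
    Gu φ ψ w₀ p =
      -((profile w₀ (1 / (p.1 + aCoef φ ψ p)) - mass (profile w₀) p.1 (aCoef φ ψ p)) +
        (stretch ψ - 1) *
          (profile w₀ (1 / (p.1 + aCoef φ ψ p)) - moment (profile w₀) p.1 (aCoef φ ψ p))) / p.1 := by
  rw [Gu, (h.hasFDerivWithinAt_G hψ hw hp).fderivWithin (uniqueDiffOn_phaseSpace φ p hp)]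
  simp [aCoefDeriv]
  ring

include h hψ hw in
theorem IsAdmissible.Gv_eq {p : ℝ × ℝ} (hp : p ∈ phaseSpace φ) :
    Gv φ ψ w₀ p = -(|slope φ| * stretch ψ *
      (profile w₀ (1 / (p.1 + aCoef φ ψ p)) - moment (profile w₀) p.1 (aCoef φ ψ p))) / p.1 := by
  rw [Gv, (h.hasFDerivWithinAt_G hψ hw hp).fderivWithin (uniqueDiffOn_phaseSpace φ p hp)]
  simp [aCoefDeriv]
  ring

include h hψ hw in
theorem IsAdmissible.Gu_neg {p : ℝ × ℝ} (hp : p ∈ phaseSpace φ) : Gu φ ψ w₀ p < 0 := by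
  have h1 := h.one_le_add_aCoef hψ hp
  have h2 := hw.isProfile.mass_lt hp.1 (a := aCoef φ ψ p) (by linarith)
  have h3 := (hw.isProfile.moment_defect_bounds hp.1 (a := aCoef φ ψ p) (by linarith)).1
  have h4 := mul_nonneg (sub_nonneg.2 (h.one_le_stretch hψ)) h3
  rw [h.Gu_eq hψ hw hp]
  exact div_neg_of_neg_of_pos (by linarith) hp.1

end Reduction

end

/-! ### Paths in the phase space and characteristics -/

section

section

variable {φ ψ : Polynomial ℝ} (h : IsAdmissible φ ψ) (hφ : φ.natDegree ≤ 2) (hψ : ψ.natDegree ≤ 2)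
  {w₀ : ℝ → ℝ} (hw : IsInitialDatum w₀)

include h hψ hw in
/-- The second equation of the planar system, in terms of the logarithmic derivative `η = u' / u`. -/
theorem IsAdmissible.planar_eq {p : ℝ × ℝ} (hp : p ∈ phaseSpace φ) (η : ℝ) :
    G φ ψ w₀ p + Gu φ ψ w₀ p * (p.1 * η) + Gv φ ψ w₀ p * p.1 =
      mass (profile w₀) p.1 (aCoef φ ψ p) -
        η * ((profile w₀ (1 / (p.1 + aCoef φ ψ p)) - mass (profile w₀) p.1 (aCoef φ ψ p)) +
          (stretch ψ - 1) *
            (profile w₀ (1 / (p.1 + aCoef φ ψ p)) - moment (profile w₀) p.1 (aCoef φ ψ p))) -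
        |slope φ| * stretch ψ *
          (profile w₀ (1 / (p.1 + aCoef φ ψ p)) - moment (profile w₀) p.1 (aCoef φ ψ p)) := by
  have := hp.1.ne'
  rw [h.Gu_eq hψ hw hp, h.Gv_eq hψ hw hp, h.G_eq hψ hp]
  field_simp
  ring

include h in
theorem IsAdmissible.stretch_sub_one : curv ψ / 2 = (stretch ψ - 1) * |slope ψ| := by
  have := h.abs_slope_psi_pos
  rw [stretch]
  field_simp
  ring

include h hφ hψ in
/-- The characteristic speed in the variable `z = 1 - x`, with `κ |ψ'(1)| = η + |φ'(1)|`. -/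
theorem IsAdmissible.speed_eq {κ η : ℝ} (hκ : κ * |slope ψ| = η + |slope φ|) (x : ℝ) :
    φ.eval x - κ * ψ.eval x =
      -(η * (1 - x) + ((stretch ψ - 1) * η + |slope φ| * stretch ψ) * (1 - x) ^ 2) := by
  rw [h.eval_phi hφ, h.eval_psi hψ, h.stretch_sub_one]
  linear_combination -((1 - x) + (stretch ψ - 1) * (1 - x) ^ 2) * hκ

end

/-- A pair of functions that satisfies `v' = u > 0`, `u' = η u` with `η + |φ'(1)| > 0`. -/
structure IsPath (φ : Polynomial ℝ) (η u v : ℝ → ℝ) : Prop where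
  u_zero : u 0 = 1
  v_zero : v 0 = 0
  u_pos : ∀ t, 0 ≤ t → 0 < u t
  u_deriv : ∀ t, 0 ≤ t → HasDerivWithinAt u (u t * η t) (Ici 0) t
  v_deriv : ∀ t, 0 ≤ t → HasDerivWithinAt v (u t) (Ici 0) t
  rate_pos : ∀ t, 0 ≤ t → 0 < η t + |slope φ|
  rate_cont : ContinuousOn η (Ici 0)

theorem monotoneOn_Ici_of_hasDerivWithinAt {f f' : ℝ → ℝ}
    (hf : ∀ t, 0 ≤ t → HasDerivWithinAt f (f' t) (Ici 0) t) (h0 : ∀ t, 0 ≤ t → 0 ≤ f' t) :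
    MonotoneOn f (Ici 0) := by
  refine monotoneOn_of_hasDerivWithinAt_nonneg (f' := f') (convex_Ici 0)
    (fun t ht => (hf t ht).continuousWithinAt) ?_ ?_
  · intro t ht
    exact (hf t (interior_subset ht)).mono interior_subset
  · intro t ht
    exact h0 t (interior_subset ht)

namespace IsPath

variable {φ ψ : Polynomial ℝ} {η u v : ℝ → ℝ} (hP : IsPath φ η u v)
include hP

theorem v_nonneg {t : ℝ} (ht : 0 ≤ t) : 0 ≤ v t := by
  rw [← hP.v_zero]
  exact monotoneOn_Ici_of_hasDerivWithinAt hP.v_deriv (fun t ht => (hP.u_pos t ht).le)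
    self_mem_Ici ht ht

theorem monotoneOn_add : MonotoneOn (fun t => u t + |slope φ| * v t) (Ici 0) := by
  refine monotoneOn_Ici_of_hasDerivWithinAt
    (fun t ht => (hP.u_deriv t ht).add ((hP.v_deriv t ht).const_mul |slope φ|)) fun t ht => ?_
  have := mul_nonneg (hP.u_pos t ht).le (hP.rate_pos t ht).le
  linarith

theorem mem {t : ℝ} (ht : 0 ≤ t) : (u t, v t) ∈ phaseSpace φ := by
  refine ⟨hP.u_pos t ht, ?_⟩
  have := hP.monotoneOn_add self_mem_Ici ht ht
  simpa [hP.u_zero, hP.v_zero] using this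

variable (h : IsAdmissible φ ψ)
include h

theorem aCoef_zero : aCoef φ ψ (u 0, v 0) = 0 := by
  rw [h.aCoef_eq]
  simp [hP.u_zero, hP.v_zero]

theorem flowMap_zero (x : ℝ) : flowMap φ ψ (u 0, v 0) x = x := by
  rw [flowMap, hP.aCoef_zero h]
  simp [hP.u_zero]

theorem hasDerivWithinAt_aCoef {t : ℝ} (ht : 0 ≤ t) :
    HasDerivWithinAt (fun t => aCoef φ ψ (u t, v t))
      (u t * ((stretch ψ - 1) * η t + |slope φ| * stretch ψ)) (Ici 0) t := by
  have h1 := (h.hasStrictFDerivAt_aCoef (u t, v t)).hasFDerivAt.comp_hasDerivWithinAt t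
    ((hP.u_deriv t ht).prodMk (hP.v_deriv t ht))
  refine h1.congr_deriv ?_
  simp [aCoefDeriv]
  ring

variable (hψ : ψ.natDegree ≤ 2)
include hψ

theorem monotoneOn_add_aCoef : MonotoneOn (fun t => u t + aCoef φ ψ (u t, v t)) (Ici 0) := by
  intro s hs t ht hst
  have h1 := hP.monotoneOn_add hs ht hst
  have h2 := h.one_le_stretch hψ
  simp only at h1 ⊢
  rw [h.add_aCoef (u s, v s), h.add_aCoef (u t, v t)]
  nlinarith

variable (hφ : φ.natDegree ≤ 2) {κ : ℝ → ℝ} (hκ : ∀ t, 0 ≤ t → κ t * |slope ψ| = η t + |slope φ|)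
include hφ hκ

/-- A characteristic through `(x, t)`, traced back to time `0`: the curve on which the conserved
quantity `u / (1 - X) + a` has its value at `(x, t)`. -/
theorem exists_characteristic {t : ℝ} (ht : 0 ≤ t) {x : ℝ} (hx : x ∈ Ico (0 : ℝ) 1) :
    ∃ X, IsCharacteristic φ ψ κ t X ∧ X t = x ∧ X 0 = flowMap φ ψ (u t, v t) x := by
  set a : ℝ → ℝ := fun t => aCoef φ ψ (u t, v t) with ha
  set z := 1 - x with hz
  have hz0 : 0 < z := by linarith [hx.2]
  have hz1 : z ≤ 1 := by linarith [hx.1]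
  have hut := hP.u_pos t ht
  set y := u t / z + a t with hy
  have hyt : u t + a t ≤ y := by
    have : u t ≤ u t / z := by
      rw [le_div_iff₀ hz0]
      nlinarith
    linarith
  have hlow : ∀ s ∈ Icc 0 t, u s ≤ y - a s := fun s hs => by
    have := hP.monotoneOn_add_aCoef h hψ hs.1 ht hs.2
    simp only at this
    linarith
  refine ⟨fun s => 1 - u s / (y - a s), fun s hs => ⟨⟨?_, ?_⟩, ?_⟩, ?_, ?_⟩
  · have h1 := hP.u_pos s hs.1
    have h2 := hlow s hs
    rw [sub_nonneg, div_le_one (by linarith)]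
    exact h2
  · have h1 := hP.u_pos s hs.1
    have h2 := hlow s hs
    have : 0 < u s / (y - a s) := div_pos h1 (by linarith)
    linarith
  · have h1 := hP.u_pos s hs.1
    have h2 := hlow s hs
    have h3 : y - a s ≠ 0 := by linarith
    have h4 := ((hP.u_deriv s hs.1).div ((hP.hasDerivWithinAt_aCoef h hs.1).const_sub y) h3).const_sub 1
    refine (h4.mono Icc_subset_Ici_self).congr_deriv ?_
    rw [h.speed_eq hφ hψ (hκ s hs.1)]
    simp only [sub_sub_cancel]
    change -((u s * η s * (y - a s) -
      u s * -(u s * ((stretch ψ - 1) * η s + |slope φ| * stretch ψ))) / (y - a s) ^ 2) = _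
    field_simp
    ring
  · simp only
    rw [hy, add_sub_cancel_right, div_div_cancel₀ hut.ne']
    simp [hz]
  · have h0 : a 0 = 0 := hP.aCoef_zero h
    simp only
    rw [h0, hP.u_zero, flowMap, hy, sub_zero]
    congr 1
    change 1 / (u t / z + a t) = z / (u t + a t * z)
    field_simp

/-- Along a characteristic, `u / (1 - X) + a` is conserved. -/
theorem flowMap_characteristic {T : ℝ} {X : ℝ → ℝ} (hX : IsCharacteristic φ ψ κ T X) {s : ℝ}
    (hs : s ∈ Icc 0 T) : flowMap φ ψ (u s, v s) (X s) = X 0 := by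
  set a : ℝ → ℝ := fun t => aCoef φ ψ (u t, v t) with ha
  have hd : ∀ s ∈ Icc 0 T, HasDerivWithinAt (fun s => u s / (1 - X s) + a s) 0 (Icc 0 T) s := by
    intro s hs
    have h1 : 1 - X s ≠ 0 := by linarith [(hX s hs).1.2]
    have h4 := (((hP.u_deriv s hs.1).mono Icc_subset_Ici_self).div
      ((hX s hs).2.const_sub 1) h1).add
      ((hP.hasDerivWithinAt_aCoef h hs.1).mono Icc_subset_Ici_self)
    refine h4.congr_deriv ?_
    rw [h.speed_eq hφ hψ (hκ s hs.1)]
    field_simp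
    ring
  have hc := constant_of_has_deriv_right_zero (f := fun s => u s / (1 - X s) + a s)
    (fun s hs => (hd s hs).continuousWithinAt) (fun s hs =>
      (hd s ⟨hs.1, hs.2.le⟩).mono_of_mem_nhdsWithin (Icc_mem_nhdsGE_of_mem hs)) s hs
  have h0 : a 0 = 0 := hP.aCoef_zero h
  have hX0 := (hX 0 ⟨le_rfl, hs.1.trans hs.2⟩).1
  have hXs := (hX s hs).1
  have h1 : 1 - X 0 ≠ 0 := by linarith [hX0.2]
  have h2 : 1 - X s ≠ 0 := by linarith [hXs.2]
  simp only [h0, hP.u_zero, add_zero] at hc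
  rw [flowMap]
  have h3 : (1 - X s) / (u s + a s * (1 - X s)) = 1 / (u s / (1 - X s) + a s) := by
    field_simp
  change 1 - (1 - X s) / (u s + a s * (1 - X s)) = X 0
  rw [h3, hc]
  simp

end IsPath

end

/-! ### Equivalence with the planar system -/

section

/-- The fundamental theorem of calculus for functions continuous on `[0, ∞)`, one-sided at `0`. -/
theorem hasDerivWithinAt_integral_Ici {f : ℝ → ℝ} (hf : ContinuousOn f (Ici 0)) {t : ℝ}
    (ht : 0 ≤ t) : HasDerivWithinAt (fun t => ∫ s in (0 : ℝ)..t, f s) (f t) (Ici 0) t := by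
  have hc : Continuous fun s => f (max s 0) :=
    hf.comp_continuous (by fun_prop) fun s => le_max_right s 0
  have h1 := (hc.integral_hasStrictDerivAt 0 t).hasDerivAt.hasDerivWithinAt (s := Ici 0)
  rw [max_eq_left ht] at h1
  have he : ∀ s ∈ Ici (0 : ℝ), ∫ r in (0 : ℝ)..s, f r = ∫ r in (0 : ℝ)..s, f (max r 0) := by
    intro s hs
    refine intervalIntegral.integral_congr fun r hr => ?_
    rw [uIcc_of_le hs] at hr
    simp only [max_eq_left hr.1]
  exact h1.congr he (he t ht)

section

variable {φ ψ : Polynomial ℝ} (h : IsAdmissible φ ψ) {w₀ : ℝ → ℝ}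
include h

theorem IsSolution.isPath {w : ℝ → ℝ → ℝ} {κ : ℝ → ℝ} (hs : IsSolution φ ψ w₀ w κ) :
    IsPath φ (fun t => slope φ - slope ψ * κ t) (uOf φ ψ κ) (vOf φ ψ κ) := by
  have hc : ContinuousOn (fun t => slope φ - slope ψ * κ t) (Ici 0) :=
    continuousOn_const.sub (continuousOn_const.mul hs.continuousOn)
  have hu : ∀ t, 0 ≤ t → HasDerivWithinAt (uOf φ ψ κ)
      (uOf φ ψ κ t * (slope φ - slope ψ * κ t)) (Ici 0) t := fun t ht =>
    (hasDerivWithinAt_integral_Ici hc ht).exp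
  refine ⟨by simp [uOf], by simp [vOf], fun t _ => Real.exp_pos _, hu, fun t ht => ?_,
    fun t ht => ?_, hc⟩
  · exact hasDerivWithinAt_integral_Ici (fun t ht => (hu t ht).continuousWithinAt) ht
  · have := mul_pos h.abs_slope_psi_pos (hs.kappa_pos t ht)
    rw [h.abs_slope_psi] at this
    rw [h.abs_slope_phi]
    linarith

theorem IsAdmissible.kappa_mul (κ : ℝ) :
    κ * |slope ψ| = (slope φ - slope ψ * κ) + |slope φ| := by
  rw [h.abs_slope_psi, h.abs_slope_phi]
  ring

variable (hψ : ψ.natDegree ≤ 2) (hw : IsInitialDatum w₀) (hφ : φ.natDegree ≤ 2)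

include hψ hw in
/-- The planar equation says that the mass `e^t G(u, v)` is conserved. -/
theorem IsPath.hasDerivWithinAt_G {η u v : ℝ → ℝ} (hP : IsPath φ η u v) {t : ℝ} (ht : 0 ≤ t) :
    HasDerivWithinAt (fun t => Real.exp t * G φ ψ w₀ (u t, v t))
      (Real.exp t * (G φ ψ w₀ (u t, v t) + Gu φ ψ w₀ (u t, v t) * (u t * η t) +
        Gv φ ψ w₀ (u t, v t) * u t)) (Ici 0) t := by
  have hp := hP.mem ht
  have h1 := (h.hasFDerivWithinAt_G hψ hw hp).differentiableWithinAt.hasFDerivWithinAt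
  have h2 := h1.comp_hasDerivWithinAt t ((hP.u_deriv t ht).prodMk (hP.v_deriv t ht))
    fun s hs => hP.mem hs
  have h3 := (Real.hasDerivAt_exp t).hasDerivWithinAt (s := Ici 0) |>.mul h2
  refine h3.congr_deriv ?_
  have h4 : ((u t * η t, u t) : ℝ × ℝ) = (u t * η t) • ((1, 0) : ℝ × ℝ) + u t • ((0, 1) : ℝ × ℝ) := by
    ext <;> simp
  rw [h4, map_add, map_smul, map_smul, Gu, Gv]
  simp only [smul_eq_mul, Function.comp_apply]
  ring

include hψ hφ in
theorem IsSolution.eq_flow {w : ℝ → ℝ → ℝ} {κ : ℝ → ℝ} (hs : IsSolution φ ψ w₀ w κ) {x : ℝ}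
    (hx : x ∈ Ico (0 : ℝ) 1) {t : ℝ} (ht : 0 ≤ t) :
    w x t = Real.exp t * w₀ (flowMap φ ψ (uOf φ ψ κ t, vOf φ ψ κ t) x) := by
  obtain ⟨X, hX, hXt, hX0⟩ := (hs.isPath h).exists_characteristic h hψ hφ
    (fun t _ => h.kappa_mul (κ t)) ht hx
  have hd : ∀ s ∈ Icc 0 t, HasDerivWithinAt (fun r => Real.exp (-r) * w (X r) r) 0 (Icc 0 t) s := by
    intro s hst
    have h1 := (hasDerivAt_neg s).exp.hasDerivWithinAt (s := Icc 0 t)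
    refine (h1.mul (hs.transport t ht X hX s hst)).congr_deriv ?_
    ring
  have hc := constant_of_has_deriv_right_zero
    (fun s hst => (hd s hst).continuousWithinAt) (fun s hst =>
      (hd s ⟨hst.1, hst.2.le⟩).mono_of_mem_nhdsWithin (Icc_mem_nhdsGE_of_mem hst)) t ⟨ht, le_rfl⟩
  simp only [neg_zero, Real.exp_zero, one_mul] at hc
  rw [hs.initial _ (hX 0 ⟨le_rfl, ht⟩).1, hXt, hX0] at hc
  rw [← hc, ← mul_assoc, ← Real.exp_add]
  simp

include hψ hφ in
theorem IsSolution.exp_mul_G {w : ℝ → ℝ → ℝ} {κ : ℝ → ℝ} (hs : IsSolution φ ψ w₀ w κ) {t : ℝ}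
    (ht : 0 ≤ t) : Real.exp t * G φ ψ w₀ (uOf φ ψ κ t, vOf φ ψ κ t) = 1 := by
  rw [← hs.mass t ht, G, ← intervalIntegral.integral_const_mul]
  refine intervalIntegral.integral_congr_uIoo fun x hx => ?_
  rw [uIoo_of_le zero_le_one] at hx
  exact (hs.eq_flow h hψ hφ ⟨hx.1.le, hx.2⟩ ht).symm

include hψ hφ hw in
theorem IsSolution.planar_ode {w : ℝ → ℝ → ℝ} {κ : ℝ → ℝ} (hs : IsSolution φ ψ w₀ w κ) {t : ℝ}
    (ht : 0 ≤ t) :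
    G φ ψ w₀ (uOf φ ψ κ t, vOf φ ψ κ t) + Gu φ ψ w₀ (uOf φ ψ κ t, vOf φ ψ κ t) *
      (uOf φ ψ κ t * (slope φ - slope ψ * κ t)) +
        Gv φ ψ w₀ (uOf φ ψ κ t, vOf φ ψ κ t) * uOf φ ψ κ t = 0 := by
  have h1 := (hs.isPath h).hasDerivWithinAt_G h hψ hw ht
  have h2 := (hasDerivWithinAt_const t (Ici 0) (1 : ℝ)).congr
    (fun s hs' => hs.exp_mul_G h hψ hφ hs') (hs.exp_mul_G h hψ hφ ht)
  have h3 := (uniqueDiffOn_Ici (0 : ℝ) t ht).eq_deriv _ h1 h2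
  exact (mul_eq_zero.1 h3).resolve_left (Real.exp_pos t).ne'

include hψ hφ hw in
theorem IsSolution.isReducedSolution {w : ℝ → ℝ → ℝ} {κ : ℝ → ℝ} (hs : IsSolution φ ψ w₀ w κ) :
    IsReducedSolution φ ψ w₀ (uOf φ ψ κ) (vOf φ ψ κ) := by
  have hP := hs.isPath h
  refine ⟨hP.u_zero, hP.v_zero, fun t ht => hP.mem ht, hP.v_deriv,
    fun t ht => (hP.u_deriv t ht).differentiableWithinAt, fun t ht => ?_⟩
  rw [(hP.u_deriv t ht).derivWithin (uniqueDiffOn_Ici (0 : ℝ) t ht)]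
  exact hs.planar_ode h hψ hw hφ ht

include hψ hw in
/-- The planar equation determines the logarithmic derivative `η` of `u`, and `η > φ'(1)`, which makes
`κ` positive. The condition `|φ'(1)| < 1` is what gives this sign. -/
theorem IsAdmissible.eq_of_planar {p : ℝ × ℝ} (hp : p ∈ phaseSpace φ) {η : ℝ}
    (he : G φ ψ w₀ p + Gu φ ψ w₀ p * (p.1 * η) + Gv φ ψ w₀ p * p.1 = 0) :
    η = -(G φ ψ w₀ p + Gv φ ψ w₀ p * p.1) / (Gu φ ψ w₀ p * p.1) ∧ 0 < η + |slope φ| := by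
  have h1 := h.one_le_add_aCoef hψ hp
  have h2 := h.Gu_neg hψ hw hp
  have hu := hp.1
  constructor
  · rw [eq_div_iff (mul_neg_of_neg_of_pos h2 hu).ne]
    linarith
  · rw [h.planar_eq hψ hw hp] at he
    have hua : 0 < p.1 + aCoef φ ψ p := by linarith
    have hm := hw.isProfile.mass_pos hu hua
    have hm1 := hw.isProfile.moment_nonneg p.1 (aCoef φ ψ p)
    have hn := sub_pos.2 (hw.isProfile.mass_lt hu hua)
    have hn1 := (hw.isProfile.moment_defect_bounds hu hua).1
    have hK := h.one_le_stretch hψ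
    have hl := h.abs_slope_phi_lt
    have hl0 := h.abs_slope_phi_pos
    have hD : 0 < (profile w₀ (1 / (p.1 + aCoef φ ψ p)) - mass (profile w₀) p.1 (aCoef φ ψ p)) +
        (stretch ψ - 1) * (profile w₀ (1 / (p.1 + aCoef φ ψ p)) -
          moment (profile w₀) p.1 (aCoef φ ψ p)) :=
      add_pos_of_pos_of_nonneg hn (mul_nonneg (by linarith) hn1)
    refine pos_of_mul_pos_left (b := _) ?_ hD.le
    have h5 : 0 < (1 - |slope φ|) * mass (profile w₀) p.1 (aCoef φ ψ p) :=
      mul_pos (by linarith) hm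
    have h6 := mul_nonneg hl0.le hm1
    nlinarith

include hψ hφ hw in
theorem IsReducedSolution.isSolution {u v : ℝ → ℝ} (hr : IsReducedSolution φ ψ w₀ u v) :
    IsSolution φ ψ w₀ (fun x t => Real.exp t * w₀ (flowMap φ ψ (u t, v t) x))
      (fun t => (slope φ - derivWithin u (Ici 0) t / u t) / slope ψ) := by
  set η : ℝ → ℝ := fun t => derivWithin u (Ici 0) t / u t with hη
  have hu0 : ∀ t, 0 ≤ t → 0 < u t := fun t ht => (hr.mem t ht).1
  have hdu : ∀ t, 0 ≤ t → u t * η t = derivWithin u (Ici 0) t := fun t ht => by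
    rw [hη]
    have := (hu0 t ht).ne'
    field_simp
  have hplan : ∀ t, 0 ≤ t → G φ ψ w₀ (u t, v t) + Gu φ ψ w₀ (u t, v t) * (u t * η t) +
      Gv φ ψ w₀ (u t, v t) * u t = 0 := fun t ht => by
    rw [hdu t ht]
    exact hr.u_ode t ht
  have hsol := fun t ht => h.eq_of_planar hψ hw (hr.mem t ht) (hplan t ht)
  have hcu : ContinuousOn u (Ici 0) := hr.u_diff.continuousOn
  have hcv : ContinuousOn v (Ici 0) := fun t ht => (hr.v_ode t ht).continuousWithinAt
  have hcp : ContinuousOn (fun t => (u t, v t)) (Ici 0) := hcu.prodMk hcv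
  have hmaps : MapsTo (fun t => (u t, v t)) (Ici 0) (phaseSpace φ) := fun t ht => hr.mem t ht
  have hG := h.contDiffOn_G hψ hw
  have hF : ContinuousOn (fderivWithin ℝ (G φ ψ w₀) (phaseSpace φ)) (phaseSpace φ) :=
    hG.continuousOn_fderivWithin (uniqueDiffOn_phaseSpace φ) le_rfl
  have hGu : ContinuousOn (fun t => Gu φ ψ w₀ (u t, v t)) (Ici 0) :=
    (hF.comp hcp hmaps).clm_apply continuousOn_const
  have hGv : ContinuousOn (fun t => Gv φ ψ w₀ (u t, v t)) (Ici 0) :=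
    (hF.comp hcp hmaps).clm_apply continuousOn_const
  have hcη : ContinuousOn η (Ici 0) := by
    refine ContinuousOn.congr ?_ fun t ht => (hsol t ht).1
    refine ContinuousOn.div (((hG.continuousOn.comp hcp hmaps).add (hGv.mul hcu)).neg)
      (hGu.mul hcu) fun t ht => ?_
    exact (mul_neg_of_neg_of_pos (h.Gu_neg hψ hw (hr.mem t ht)) (hu0 t ht)).ne
  have hP : IsPath φ η u v := by
    refine ⟨hr.u_zero, hr.v_zero, hu0, fun t ht => ?_, hr.v_ode, fun t ht => (hsol t ht).2, hcη⟩
    rw [hdu t ht]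
    exact (hr.u_diff t ht).hasDerivWithinAt
  have hm := h.abs_slope_psi_pos
  have hκ : ∀ t, 0 ≤ t → (slope φ - η t) / slope ψ * |slope ψ| = η t + |slope φ| := fun t ht => by
    have := h.slope_psi_neg.ne
    rw [h.abs_slope_psi, h.abs_slope_phi]
    field_simp
    ring
  refine ⟨?_, fun t ht => ?_, fun x hx => ?_, ?_, fun t ht => ?_⟩
  · exact (continuousOn_const.sub hcη).div_const _
  · refine pos_of_mul_pos_left (b := |slope ψ|) ?_ hm.le
    rw [hκ t ht]
    exact hP.rate_pos t ht
  · simp only [hP.flowMap_zero h]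
    simp
  · intro T hT X hX s hs
    have hflow : ∀ r ∈ Icc 0 T, flowMap φ ψ (u r, v r) (X r) = X 0 := fun r hr =>
      hP.flowMap_characteristic h hψ hφ hκ hX hr
    simp only
    rw [hflow s hs]
    refine HasDerivWithinAt.congr (f := fun r => Real.exp r * w₀ (X 0)) ?_
      (fun r hr => by rw [hflow r hr]) (by rw [hflow s hs])
    exact ((Real.hasDerivAt_exp s).mul_const _).hasDerivWithinAt
  · rw [intervalIntegral.integral_const_mul]
    change Real.exp t * G φ ψ w₀ (u t, v t) = 1
    have hd : ∀ s ∈ Icc 0 t, HasDerivWithinAt (fun t => Real.exp t * G φ ψ w₀ (u t, v t)) 0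
        (Ici 0) s := fun s hs => by
      have := hP.hasDerivWithinAt_G h hψ hw hs.1
      rwa [hplan s hs.1, mul_zero] at this
    have hc := constant_of_has_deriv_right_zero
      (fun s hs => (hd s hs).continuousWithinAt.mono Icc_subset_Ici_self) (fun s hs =>
        (hd s ⟨hs.1, hs.2.le⟩).mono (Ici_subset_Ici.2 hs.1)) t ⟨ht, le_rfl⟩
    rw [hc, Real.exp_zero, one_mul]
    refine Eq.trans (intervalIntegral.integral_congr fun x _ => ?_) hw.mass
    simp only [hP.flowMap_zero h]

include hψ hφ hw in
theorem reducesToPlanarODE : ReducesToPlanarODE φ ψ w₀ where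
  contDiffOn := h.contDiffOn_G hψ hw
  Gu_neg _ hp := h.Gu_neg hψ hw hp
  to_ode _ _ hs := ⟨hs.isReducedSolution h hψ hw hφ, fun _ hx _ ht => hs.eq_flow h hψ hφ hx ht⟩
  of_ode _ _ hr := hr.isSolution h hψ hw hφ

end

end

/-! ### Absolutely continuous functions and profiles with nearly constant beta function -/

section

theorem absolutelyContinuousOnInterval_of_hasDerivAt {f f' : ℝ → ℝ} {a b : ℝ} (hab : a ≤ b)
    (hf : ∀ x ∈ Icc a b, HasDerivAt f (f' x) x) (hf' : ContinuousOn f' (Icc a b)) :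
    AbsolutelyContinuousOnInterval f a b := by
  obtain ⟨C, hC⟩ := isCompact_Icc.exists_bound_of_continuousOn hf'
  refine LipschitzOnWith.absolutelyContinuousOnInterval (K := C.toNNReal) ?_
  rw [uIcc_of_le hab]
  refine (convex_Icc a b).lipschitzOnWith_of_nnnorm_hasDerivWithin_le
    (fun x hx => (hf x hx).hasDerivWithinAt) fun x hx => ?_
  rw [← NNReal.coe_le_coe, coe_nnnorm]
  exact (hC x hx).trans (Real.le_coe_toNNReal C)

theorem absolutelyContinuousOnInterval_of_dist_le {f F : ℝ → ℝ} {a b C : ℝ}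
    (hf : AbsolutelyContinuousOnInterval f a b) (hC : 0 < C)
    (h : ∀ x ∈ uIcc a b, ∀ y ∈ uIcc a b, dist (F x) (F y) ≤ C * dist (f x) (f y)) :
    AbsolutelyContinuousOnInterval F a b := by
  rw [absolutelyContinuousOnInterval_iff] at hf ⊢
  intro ε hε
  obtain ⟨δ, hδ, H⟩ := hf (ε / C) (by positivity)
  refine ⟨δ, hδ, fun E hE hs => ?_⟩
  have h1 := H E hE hs
  rw [lt_div_iff₀ hC, mul_comm, Finset.mul_sum] at h1
  exact lt_of_le_of_lt
    (Finset.sum_le_sum fun i hi => h _ (hE.1 i hi).1 _ (hE.1 i hi).2) h1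

theorem absolutelyContinuousOnInterval_inv {f : ℝ → ℝ} {a b m : ℝ}
    (hf : AbsolutelyContinuousOnInterval f a b) (hm : 0 < m) (h : ∀ x ∈ uIcc a b, m ≤ f x) :
    AbsolutelyContinuousOnInterval (fun x => (f x)⁻¹) a b := by
  refine absolutelyContinuousOnInterval_of_dist_le hf (C := 1 / m ^ 2) (by positivity)
    fun x hx y hy => ?_
  have hx0 : 0 < f x := hm.trans_le (h x hx)
  have hy0 : 0 < f y := hm.trans_le (h y hy)
  rw [Real.dist_eq, Real.dist_eq, inv_sub_inv hx0.ne' hy0.ne', abs_div, abs_sub_comm,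
    abs_of_pos (mul_pos hx0 hy0), div_eq_mul_one_div, mul_comm]
  gcongr
  nlinarith [h x hx, h y hy]

/-- An absolutely continuous function is increasing if its derivative is nonnegative almost
everywhere; the exceptional set is given as the set where another absolutely continuous function
fails to be differentiable. -/
theorem le_of_ae_deriv_nonneg {F g : ℝ → ℝ} {a b : ℝ} (hab : a ≤ b)
    (hF : AbsolutelyContinuousOnInterval F a b) (hg : AbsolutelyContinuousOnInterval g a b)
    (h : ∀ s ∈ Ioo a b, DifferentiableAt ℝ g s → ∃ d, HasDerivAt F d s ∧ 0 ≤ d) : F a ≤ F b := by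
  rw [← sub_nonneg, ← hF.integral_deriv_eq_sub]
  refine intervalIntegral.integral_nonneg_of_ae_restrict hab ?_
  rw [Filter.EventuallyLE, ae_restrict_iff' measurableSet_Icc]
  filter_upwards [hg.ae_differentiableAt, (countable_singleton a).ae_notMem volume,
    (countable_singleton b).ae_notMem volume] with s hs ha hb hm
  rw [uIcc_of_le hab] at hs
  obtain ⟨d, hd, h0⟩ := h s ⟨lt_of_le_of_ne hm.1 (Ne.symm ha), lt_of_le_of_ne hm.2 hb⟩ (hs hm)
  rw [hd.deriv]
  exact h0

/-- The primitive `∫₀ˢ g` of a profile. -/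
def primitive (g : ℝ → ℝ) (s : ℝ) : ℝ := ∫ r in (0 : ℝ)..s, g r

/-- The mean value of a profile over `[0, s]` relative to its value at `s`. It is constant,
equal to `1 - β₀`, for a power of `s` with beta function `β₀`. -/
def meanRatio (g : ℝ → ℝ) (s : ℝ) : ℝ := primitive g s / (s * g s)

/-- On `(0, s₀)` the beta function of the profile `g` differs from `β₀` by at most `ε`. -/
structure BetaNear (g : ℝ → ℝ) (β₀ ε s₀ : ℝ) : Prop where
  isProfile : IsProfile g
  ac : AbsolutelyContinuousOnInterval g 0 1
  pos : 0 < s₀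
  le_one : s₀ ≤ 1
  eps_nonneg : 0 ≤ ε
  near : ∀ s, 0 < s → s < s₀ → DifferentiableAt ℝ g s →
    |deriv g s * primitive g s / g s ^ 2 - β₀| ≤ ε

theorem IsProfile.hasDerivAt_primitive {g : ℝ → ℝ} (hg : IsProfile g) (s : ℝ) :
    HasDerivAt (primitive g) (g s) s :=
  (hg.continuous.integral_hasStrictDerivAt 0 s).hasDerivAt

theorem IsProfile.primitive_pos {g : ℝ → ℝ} (hg : IsProfile g) {s : ℝ} (hs : 0 < s) :
    0 < primitive g s :=
  intervalIntegral.intervalIntegral_pos_of_pos_on (hg.continuous.intervalIntegrable _ _)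
    (fun r hr => hg.pos r hr.1) hs

theorem IsProfile.primitive_le {g : ℝ → ℝ} (hg : IsProfile g) {s : ℝ} (hs : 0 ≤ s) :
    primitive g s ≤ s * g s := by
  have := intervalIntegral.integral_mono_on (μ := volume) hs (hg.continuous.intervalIntegrable 0 s)
    ((continuous_const (y := g s)).intervalIntegrable 0 s) fun r hr => hg.monotone hr.2
  simpa [primitive] using this

namespace BetaNear

variable {g : ℝ → ℝ} {β₀ ε s₀ : ℝ} (hB : BetaNear g β₀ ε s₀)
include hB

theorem ac_mono {a b : ℝ} (ha : 0 ≤ a) (hab : a ≤ b) (hb : b < s₀) :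
    AbsolutelyContinuousOnInterval g a b := by
  refine hB.ac.mono ?_
  rw [uIcc_of_le hab, uIcc_of_le zero_le_one]
  exact Icc_subset_Icc ha (hb.le.trans hB.le_one)

theorem ac_primitive_div {a b : ℝ} (ha : 0 < a) (hab : a ≤ b) (hb : b < s₀) :
    AbsolutelyContinuousOnInterval (fun s => primitive g s / g s) a b := by
  have h1 := absolutelyContinuousOnInterval_of_hasDerivAt hab
    (fun x _ => hB.isProfile.hasDerivAt_primitive x) hB.isProfile.continuous.continuousOn
  have h2 := absolutelyContinuousOnInterval_inv (hB.ac_mono ha.le hab hb)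
    (hB.isProfile.pos a ha) fun x hx => by
      rw [uIcc_of_le hab] at hx
      exact hB.isProfile.monotone hx.1
  exact absolutelyContinuousOnInterval_congr (h1.mul h2) fun x _ => (div_eq_mul_inv _ _).symm

theorem hasDerivAt_primitive_div {s : ℝ} (hs : 0 < s) (hd : DifferentiableAt ℝ g s) :
    HasDerivAt (fun s => primitive g s / g s) (1 - deriv g s * primitive g s / g s ^ 2) s := by
  have h0 := (hB.isProfile.pos s hs).ne'
  refine ((hB.isProfile.hasDerivAt_primitive s).div hd.hasDerivAt h0).congr_deriv ?_
  field_simp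

/-- The quotient `∫₀ˢ g / g(s)` has slope `1 - β`, hence close to `1 - β₀`. -/
theorem abs_primitive_div_sub_le {a b : ℝ} (ha : 0 < a) (hab : a ≤ b) (hb : b < s₀) :
    |primitive g b / g b - primitive g a / g a - (1 - β₀) * (b - a)| ≤ ε * (b - a) := by
  have hlin : ∀ c : ℝ, AbsolutelyContinuousOnInterval (fun s => c * s) a b := fun c =>
    absolutelyContinuousOnInterval_of_hasDerivAt hab
      (fun x _ => by simpa using (hasDerivAt_id x).const_mul c) continuousOn_const
  have hf := hB.ac_primitive_div ha hab hb
  have hg := hB.ac_mono ha.le hab hb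
  have key : ∀ s ∈ Ioo a b, DifferentiableAt ℝ g s →
      |deriv g s * primitive g s / g s ^ 2 - β₀| ≤ ε := fun s hs hd =>
    hB.near s (ha.trans hs.1) (hs.2.trans hb) hd
  have h1 := le_of_ae_deriv_nonneg hab ((hlin (1 - β₀ + ε)).sub hf) hg fun s hs hd =>
    ⟨_, ((hasDerivAt_id s).const_mul (1 - β₀ + ε)).sub
      (hB.hasDerivAt_primitive_div (ha.trans hs.1) hd), by
        have := (abs_le.1 (key s hs hd)).1
        linarith⟩
  have h2 := le_of_ae_deriv_nonneg hab (hf.sub (hlin (1 - β₀ - ε))) hg fun s hs hd =>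
    ⟨_, (hB.hasDerivAt_primitive_div (ha.trans hs.1) hd).sub
      ((hasDerivAt_id s).const_mul (1 - β₀ - ε)), by
        have := (abs_le.1 (key s hs hd)).2
        linarith⟩
  simp only [Pi.sub_apply] at h1 h2
  rw [abs_le]
  constructor <;> linarith

omit hB in
theorem mul_meanRatio (hg : IsProfile g) {s : ℝ} (hs : 0 < s) :
    s * meanRatio g s = primitive g s / g s := by
  have := (hg.pos s hs).ne'
  rw [meanRatio]
  field_simp

omit hB in
theorem meanRatio_pos (hg : IsProfile g) {s : ℝ} (hs : 0 < s) : 0 < meanRatio g s :=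
  div_pos (hg.primitive_pos hs) (mul_pos hs (hg.pos s hs))

omit hB in
theorem meanRatio_le_one (hg : IsProfile g) {s : ℝ} (hs : 0 < s) : meanRatio g s ≤ 1 :=
  (div_le_one (mul_pos hs (hg.pos s hs))).2 (hg.primitive_le hs.le)

/-- The limit `a → 0` of `abs_primitive_div_sub_le`. -/
theorem abs_meanRatio_sub_le {s : ℝ} (hs : 0 < s) (hs₀ : s < s₀) :
    |meanRatio g s - (1 - β₀)| ≤ ε := by
  have hg := hB.isProfile
  have h1 : ∀ᶠ a in 𝓝[>] (0 : ℝ), |primitive g s / g s - a * meanRatio g a -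
      (1 - β₀) * (s - a)| ≤ ε * (s - a) := by
    filter_upwards [Ioo_mem_nhdsGT hs] with a ha
    rw [mul_meanRatio hg ha.1]
    exact hB.abs_primitive_div_sub_le ha.1 ha.2.le hs₀
  have h0 : Tendsto (fun a : ℝ => a) (𝓝[>] 0) (𝓝 0) := tendsto_id.mono_left nhdsWithin_le_nhds
  have h2 : Tendsto (fun a : ℝ => a * meanRatio g a) (𝓝[>] 0) (𝓝 0) := by
    refine tendsto_of_tendsto_of_tendsto_of_le_of_le' tendsto_const_nhds h0 ?_ ?_
    · filter_upwards [self_mem_nhdsWithin] with a ha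
      exact mul_nonneg (le_of_lt ha) (meanRatio_pos hg ha).le
    · filter_upwards [self_mem_nhdsWithin] with a ha
      exact mul_le_of_le_one_right (le_of_lt ha) (meanRatio_le_one hg ha)
  have h3 := le_of_tendsto_of_tendsto
    (((tendsto_const_nhds (x := primitive g s / g s)).sub h2).sub
      (((tendsto_const_nhds (x := s)).sub h0).const_mul (1 - β₀))).abs
    (((tendsto_const_nhds (x := s)).sub h0).const_mul ε) h1
  rw [← mul_meanRatio hg hs] at h3
  have h4 : s * meanRatio g s - 0 - (1 - β₀) * (s - 0) = s * (meanRatio g s - (1 - β₀)) := by ring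
  rw [h4, abs_mul, abs_of_pos hs, sub_zero, mul_comm ε] at h3
  exact le_of_mul_le_mul_left h3 hs

/-- The oscillation of `meanRatio`, with a factor that vanishes for `a = b`. This factor keeps the
later estimates uniform in the coefficients of the flow map. -/
theorem abs_meanRatio_sub_meanRatio_le {a b : ℝ} (ha : 0 < a) (hab : a ≤ b) (hb : b < s₀) :
    |meanRatio g b - meanRatio g a| ≤ 2 * ε * (1 - a / b) := by
  have hg := hB.isProfile
  have hb0 := ha.trans_le hab
  have h1 := hB.abs_primitive_div_sub_le ha hab hb
  have h2 := hB.abs_meanRatio_sub_le ha (hab.trans_lt hb)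
  rw [← mul_meanRatio hg ha, ← mul_meanRatio hg hb0] at h1
  have h3 : b * (meanRatio g b - meanRatio g a) =
      (b * meanRatio g b - a * meanRatio g a - (1 - β₀) * (b - a)) -
        (b - a) * (meanRatio g a - (1 - β₀)) := by ring
  have h4 : |b * (meanRatio g b - meanRatio g a)| ≤ 2 * ε * (b - a) := by
    rw [h3]
    refine (abs_sub _ _).trans ?_
    rw [abs_mul (b - a), abs_of_nonneg (sub_nonneg.2 hab)]
    have := mul_le_mul_of_nonneg_left h2 (sub_nonneg.2 hab)
    linarith
  rw [abs_mul, abs_of_pos hb0] at h4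
  have h5 : 2 * ε * (1 - a / b) = 2 * ε * (b - a) / b := by field_simp
  rw [h5, le_div_iff₀ hb0]
  linarith

end BetaNear

end

/-! ### The moment identity -/

section

variable {g : ℝ → ℝ} {β₀ ε s₀ : ℝ}

/-- The tail of the transported profile in the variable `s`, with upper limit `z = u s / (1 - a s)`. -/
theorem IsProfile.hasDerivAt_integral_comp_flow (hg : IsProfile g) {P : ℝ → ℝ} (hP : Continuous P)
    {u a s : ℝ} (hu : 0 < u) (hua : 0 < u + a) (h0 : 0 ≤ s) (h1 : s ≤ 1 / (u + a)) :
    HasDerivAt (fun s => ∫ z in (0 : ℝ)..u * s / (1 - a * s), P z * g (z / (u + a * z)))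
      (P (u * s / (1 - a * s)) * g s * (u / (1 - a * s) ^ 2)) s := by
  have hpos : 0 < 1 - a * s := one_sub_mul_pos (mul_one_div_add_lt_one hu hua) h0 h1
  have hz0 : 0 ≤ u * s / (1 - a * s) := by positivity
  have hz1 : u * s / (1 - a * s) ≤ 1 := by
    rw [div_le_one hpos]
    rw [le_div_iff₀ hua] at h1
    linarith
  have hinv : u + a * (u * s / (1 - a * s)) = u / (1 - a * s) := by
    field_simp
    ring
  have hs : u * s / (1 - a * s) / (u + a * (u * s / (1 - a * s))) = s := by
    rw [hinv, div_div_div_cancel_right₀ hpos.ne', mul_div_cancel_left₀ _ hu.ne']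
  have hc : ContinuousAt (fun z => P z * g (z / (u + a * z))) (u * s / (1 - a * s)) := by
    refine hP.continuousAt.mul (hg.continuous.continuousAt.comp ?_)
    refine continuousAt_id.div (by fun_prop) ?_
    rw [hinv]
    positivity
  have hF : HasDerivAt (fun x => ∫ z in (0 : ℝ)..x, P z * g (z / (u + a * z)))
      (P (u * s / (1 - a * s)) * g s) (u * s / (1 - a * s)) := by
    have := intervalIntegral.integral_hasDerivAt_right
      (hg.intervalIntegrable_comp_flow hP hu hua hz0 hz1) ?_ hc
    · rwa [hs] at this
    · refine (Measurable.stronglyMeasurable ?_).stronglyMeasurableAtFilter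
      have := hg.continuous.measurable
      have := hP.measurable
      fun_prop
  exact hF.comp s (hasDerivAt_mul_div_one_sub hpos.ne')

namespace BetaNear

variable (hB : BetaNear g β₀ ε s₀)
include hB

/-- The variation of `meanRatio` along the flow: the factor `1 - s / S` compensates the possibly
large quotient `a / u`. -/
theorem abs_meanRatio_flow_le {u a z : ℝ} (hu : 0 < u) (hua : 0 < u + a) (hS : 1 / (u + a) < s₀)
    (h0 : 0 < z) (h1 : z ≤ 1) :
    |(meanRatio g (1 / (u + a)) - meanRatio g (z / (u + a * z))) * ((u + a * z) / u)| ≤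
      2 * ε * (1 - z) := by
  have hz := add_mul_pos hu hua h0.le h1
  have h2 : z / (u + a * z) ≤ 1 / (u + a) := by
    simpa using div_add_mul_le hu hua h0.le h1 le_rfl
  have h3 := hB.abs_meanRatio_sub_meanRatio_le (div_pos h0 hz) h2 hS
  have h4 : 0 < (u + a * z) / u := div_pos hz hu
  rw [abs_mul, abs_of_pos h4]
  refine (mul_le_mul_of_nonneg_right h3 h4.le).trans (le_of_eq ?_)
  obtain ⟨y, hy⟩ : ∃ y, y = u + a * z := ⟨_, rfl⟩
  rw [← hy] at hz ⊢
  field_simp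
  linear_combination ε * hy

/-- The identity `k n₀ + ρ k n₁ = β₀ m₀`, with `n₀`, `n₁` the defects of the mass and of the moment,
`k` the `meanRatio` and `ρ = a / u`, which holds for exact powers, up to an error of order `ε`. -/
theorem abs_moment_identity_le {u a : ℝ} (hu : 0 < u) (hua : 0 < u + a) (hS : 1 / (u + a) < s₀) :
    |meanRatio g (1 / (u + a)) * (g (1 / (u + a)) - mass g u a) +
        a / u * meanRatio g (1 / (u + a)) * (g (1 / (u + a)) - moment g u a) - β₀ * mass g u a| ≤
      3 * ε * mass g u a := by
  have hg := hB.isProfile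
  set S := 1 / (u + a) with hSdef
  have hS0 : 0 < S := by positivity
  set k := meanRatio g S with hk
  have hlt := mul_one_div_add_lt_one hu hua
  have hpos : ∀ s ∈ Icc 0 S, 0 < 1 - a * s := fun s hs => one_sub_mul_pos hlt hs.1 hs.2
  set ζ : ℝ → ℝ := fun s => u * s / (1 - a * s) with hζ
  have hζ0 : ζ 0 = 0 := by simp [hζ]
  have hζS : ζ S = 1 := by
    have h1 := (hpos S (right_mem_Icc.2 hS0.le)).ne'
    simp only [hζ]
    rw [div_eq_one_iff_eq h1, hSdef]
    field_simp
    ring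
  have hζd : ∀ s ∈ Icc 0 S, HasDerivAt ζ (u / (1 - a * s) ^ 2) s := fun s hs =>
    hasDerivAt_mul_div_one_sub (hpos s hs).ne'
  have hζ'c : ContinuousOn (fun s => u / (1 - a * s) ^ 2) (Icc 0 S) :=
    continuousOn_const.div (by fun_prop) fun s hs => (pow_pos (hpos s hs) 2).ne'
  have hζc : ContinuousOn ζ (Icc 0 S) := fun s hs => (hζd s hs).continuousAt.continuousWithinAt
  have hε := hB.eps_nonneg
  -- Both inequalities come from one monotone function, for the two choices of the sign `τ`.
  have main : ∀ τ : ℝ, (τ = 1 ∨ τ = -1) →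
      0 ≤ τ * (k * (g S - mass g u a) + a / u * k * (g S - moment g u a) - β₀ * mass g u a) +
        (2 * ε * moment g u a - ε * mass g u a) := by
    intro τ hτ
    -- With `ℓ = (u + a z) / u`, the term `z k ℓ` of `q` is `z k(s) ℓ`, which turns `g'` into `β g`,
    -- plus a term that `2 ε z (1 - z)` dominates; `P` makes up for the derivative of `q`.
    set q : ℝ → ℝ := fun z => z * (2 * ε * (1 - z) + τ * (k * ((u + a * z) / u))) with hq
    set q' : ℝ → ℝ := fun z => 2 * ε * (1 - 2 * z) + τ * (k + 2 * (a / u * k) * z) with hq'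
    have hqd : ∀ z, HasDerivAt q (q' z) z := fun z => by
      have h1 : q = fun z => (2 * ε + τ * k) * z + (τ * (a / u * k) - 2 * ε) * z ^ 2 := by
        funext z
        simp only [hq]
        field_simp
        ring
      rw [h1]
      refine (((hasDerivAt_id z).const_mul _).add ((hasDerivAt_pow 2 z).const_mul _)).congr_deriv ?_
      simp only [hq']
      push_cast
      ring
    set P : ℝ → ℝ := fun z => ε - τ * β₀ - q' z with hP
    have hPc : Continuous P := by
      simp only [hP, hq']
      fun_prop
    set Φ : ℝ → ℝ := fun s => g s * q (ζ s) + ∫ z in (0 : ℝ)..ζ s, P z * g (z / (u + a * z)) with hΦ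
    have hq'c : Continuous q' := by
      simp only [hq']
      fun_prop
    have hqζ : ∀ s ∈ Icc 0 S, HasDerivAt (fun s => q (ζ s)) (q' (ζ s) * (u / (1 - a * s) ^ 2)) s :=
      fun s hs => (hqd (ζ s)).comp s (hζd s hs)
    have hI : ∀ s ∈ Icc 0 S, HasDerivAt (fun s => ∫ z in (0 : ℝ)..ζ s, P z * g (z / (u + a * z)))
        (P (ζ s) * g s * (u / (1 - a * s) ^ 2)) s := fun s hs =>
      hg.hasDerivAt_integral_comp_flow hPc hu hua hs.1 hs.2
    have hgac := hB.ac_mono le_rfl hS0.le hS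
    have hac : AbsolutelyContinuousOnInterval Φ 0 S := by
      refine (hgac.mul (absolutelyContinuousOnInterval_of_hasDerivAt hS0.le hqζ ?_)).add
        (absolutelyContinuousOnInterval_of_hasDerivAt hS0.le hI ?_)
      · exact (hq'c.comp_continuousOn hζc).mul hζ'c
      · exact ((hPc.comp_continuousOn hζc).mul hg.continuous.continuousOn).mul hζ'c
    have hmono := le_of_ae_deriv_nonneg hS0.le hac hgac fun s hs hd => by
      have hs' : s ∈ Icc 0 S := ⟨hs.1.le, hs.2.le⟩
      refine ⟨_, (hd.hasDerivAt.mul (hqζ s hs')).add (hI s hs'), ?_⟩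
      have hp := hpos s hs'
      have hgs := hg.pos s hs.1
      have hg' : 0 ≤ deriv g s := hg.monotone.deriv_nonneg
      have hz0 : 0 < ζ s := div_pos (mul_pos hu hs.1) hp
      have hz1 : ζ s ≤ 1 := by
        simp only [hζ]
        rw [div_le_one hp]
        have := hs.2.le
        rw [hSdef, le_div_iff₀ hua] at this
        linarith
      have hinv : u + a * ζ s = u / (1 - a * s) := by
        simp only [hζ]
        field_simp
        ring
      have hsz : ζ s / (u + a * ζ s) = s := by
        rw [hinv]
        simp only [hζ]
        rw [div_div_div_cancel_right₀ hp.ne', mul_div_cancel_left₀ _ hu.ne']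
      have h1 := hB.abs_meanRatio_flow_le hu hua hS hz0 hz1
      have h2 := hB.near s hs.1 (hs.2.trans hS) hd
      rw [hsz, ← hSdef, ← hk] at h1
      set ℓ := (u + a * ζ s) / u with hℓ
      have hℓ1 : ℓ = 1 / (1 - a * s) := by
        rw [hℓ, hinv]
        field_simp
      -- `g' k z ℓ = β g z'`
      have h3 : deriv g s * (ζ s * (meanRatio g s * ℓ)) =
          deriv g s * primitive g s / g s ^ 2 * (g s * (u / (1 - a * s) ^ 2)) := by
        rw [hℓ1, meanRatio]
        simp only [hζ]
        have := hs.1.ne'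
        field_simp
      have h4 : 0 < g s * (u / (1 - a * s) ^ 2) := by positivity
      have h5 : 0 ≤ τ * (deriv g s * primitive g s / g s ^ 2 - β₀) + ε := by
        rcases hτ with rfl | rfl
        · linarith [(abs_le.1 h2).1]
        · linarith [(abs_le.1 h2).2]
      have h6 : 0 ≤ 2 * ε * (1 - ζ s) + τ * ((k - meanRatio g s) * ℓ) := by
        rcases hτ with rfl | rfl
        · linarith [(abs_le.1 h1).1]
        · linarith [(abs_le.1 h1).2]
      have h7 : 0 ≤ deriv g s * ζ s * (2 * ε * (1 - ζ s) + τ * ((k - meanRatio g s) * ℓ)) :=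
        mul_nonneg (mul_nonneg hg' hz0.le) h6
      have h8 := mul_nonneg h5 h4.le
      have h9 : deriv g s * q (ζ s) =
          deriv g s * ζ s * (2 * ε * (1 - ζ s) + τ * ((k - meanRatio g s) * ℓ)) +
            τ * (deriv g s * (ζ s * (meanRatio g s * ℓ))) := by
        simp only [hq, ← hℓ]
        ring
      rw [h9, h3]
      simp only [hP]
      linarith
    have hΦ0 : Φ 0 = 0 := by simp [hΦ, hζ0, hg.eq_zero 0 le_rfl]
    have hPint : ∫ z in (0 : ℝ)..1, P z * g (z / (u + a * z)) =
        (ε - τ * β₀ - 2 * ε - τ * k) * mass g u a + (2 * ε - τ * (a / u * k)) * moment g u a := by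
      have i1 := hg.intervalIntegrable_comp_flow (P := fun _ => 1) continuous_const hu hua
        zero_le_one le_rfl
      have i2 := hg.intervalIntegrable_comp_flow (P := fun z => 2 * z) (by fun_prop) hu hua
        zero_le_one le_rfl
      simp only [one_mul] at i1
      rw [mass, moment, ← intervalIntegral.integral_const_mul, ← intervalIntegral.integral_const_mul,
        ← intervalIntegral.integral_add (i1.const_mul _) (i2.const_mul _)]
      refine intervalIntegral.integral_congr fun z _ => ?_
      simp only [hP, hq']
      ring
    have hq1 : q 1 = τ * (k + a / u * k) := by
      simp only [hq]
      field_simp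
      ring
    rw [hΦ0] at hmono
    simp only [hΦ, hζS, hPint, hq1] at hmono
    linarith
  have hm := hg.mass_pos hu hua
  have hm1 := mul_le_mul_of_nonneg_left (hg.moment_le hu hua) hε
  have hm2 := mul_nonneg hε hm.le
  have h1 := main 1 (Or.inl rfl)
  have h2 := main (-1) (Or.inr rfl)
  rw [abs_le]
  constructor <;> linarith

end BetaNear

end

/-! ### The planar system in the slow variable and its clock -/

section

/-- The asymptotic part of the problem: the planar system in the variables `(u, a)` for the profile
`g`, with `η = u' / u`, the constants `K = stretch ψ`, `l = |φ'(1)|`, and normalised mass. The defects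
`n₀ = g(S) - m₀` and `n₁ = g(S) - m₁` of the mass and of the moment, at `S = 1 / (u + a)`, are the
coefficients of the second equation. -/
structure IsMassFlow (g : ℝ → ℝ) (K l : ℝ) (u a η : ℝ → ℝ) : Prop where
  isProfile : IsProfile g
  one_le : 1 ≤ K
  pos : 0 < l
  lt_one : l < 1
  u_pos : ∀ t, 0 ≤ t → 0 < u t
  a_nonneg : ∀ t, 0 ≤ t → 0 ≤ a t
  u_deriv : ∀ t, 0 ≤ t → HasDerivWithinAt u (u t * η t) (Ici 0) t
  a_deriv : ∀ t, 0 ≤ t → HasDerivWithinAt a (u t * ((K - 1) * η t + l * K)) (Ici 0) t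
  rate_pos : ∀ t, 0 ≤ t → 0 < η t + l
  rate_cont : ContinuousOn η (Ici 0)
  mass_eq : ∀ t, 0 ≤ t → Real.exp t * mass g (u t) (a t) = 1
  planar : ∀ t, 0 ≤ t → mass g (u t) (a t) -
    η t * ((g (1 / (u t + a t)) - mass g (u t) (a t)) +
      (K - 1) * (g (1 / (u t + a t)) - moment g (u t) (a t))) -
    l * K * (g (1 / (u t + a t)) - moment g (u t) (a t)) = 0

/-- The natural speed `m₀ / (n₀ + (K - 1) n₁)` of the evolution: it controls `η`, and the slow variable
relaxes at this rate. -/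
def clock (g : ℝ → ℝ) (K u a : ℝ) : ℝ :=
  mass g u a / ((g (1 / (u + a)) - mass g u a) + (K - 1) * (g (1 / (u + a)) - moment g u a))

/-- The slow variable `(a / u) k(S)`, where `S = 1 / (u + a)`. -/
def slowVar (g : ℝ → ℝ) (u a : ℝ) : ℝ := a / u * meanRatio g (1 / (u + a))

namespace IsMassFlow

variable {g : ℝ → ℝ} {K l : ℝ} {u a η : ℝ → ℝ} (hF : IsMassFlow g K l u a η)
include hF

theorem denom_pos {t : ℝ} (ht : 0 ≤ t) : 0 < u t + a t :=
  add_pos_of_pos_of_nonneg (hF.u_pos t ht) (hF.a_nonneg t ht)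

theorem defect_pos {t : ℝ} (ht : 0 ≤ t) :
    0 < (g (1 / (u t + a t)) - mass g (u t) (a t)) +
      (K - 1) * (g (1 / (u t + a t)) - moment g (u t) (a t)) :=
  add_pos_of_pos_of_nonneg
    (sub_pos.2 (hF.isProfile.mass_lt (hF.u_pos t ht) (hF.denom_pos ht)))
    (mul_nonneg (sub_nonneg.2 hF.one_le)
      (hF.isProfile.moment_defect_bounds (hF.u_pos t ht) (hF.denom_pos ht)).1)

/-- The rate is controlled by the clock, since `m₁ ≤ 2 m₀` and `l < 1`. -/
theorem rate_le {t : ℝ} (ht : 0 ≤ t) : η t + l ≤ 2 * clock g K (u t) (a t) := by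
  have hD := hF.defect_pos ht
  have hu := hF.u_pos t ht
  have hua := hF.denom_pos ht
  have h1 := hF.isProfile.moment_le hu hua
  have h2 := hF.isProfile.mass_pos hu hua
  have h3 := hF.planar t ht
  have h4 := hF.lt_one
  have h5 := hF.pos
  rw [clock, mul_div_assoc', le_div_iff₀ hD]
  nlinarith

theorem continuousOn_clock : ContinuousOn (fun t => clock g K (u t) (a t)) (Ici 0) := by
  intro t ht
  have hu := hF.u_pos t ht
  have hua := hF.denom_pos ht
  have hc : ContinuousWithinAt (fun t => (u t, a t)) (Ici 0) t :=
    (hF.u_deriv t ht).continuousWithinAt.prodMk (hF.a_deriv t ht).continuousWithinAt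
  have h0 : ContinuousWithinAt (fun t => mass g (u t) (a t)) (Ici 0) t :=
    (hF.isProfile.continuousAt_mass (p := (u t, a t)) hu hua).comp_continuousWithinAt
      (f := fun t => (u t, a t)) hc
  have h1 : ContinuousWithinAt (fun t => moment g (u t) (a t)) (Ici 0) t :=
    (hF.isProfile.continuousAt_moment (p := (u t, a t)) hu hua).comp_continuousWithinAt
      (f := fun t => (u t, a t)) hc
  have h2 : ContinuousWithinAt (fun t => g (1 / (u t + a t))) (Ici 0) t :=
    hF.isProfile.continuous.continuousAt.comp_continuousWithinAt
      (continuousWithinAt_const.div ((hF.u_deriv t ht).continuousWithinAt.add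
        (hF.a_deriv t ht).continuousWithinAt) hua.ne')
  exact h0.div ((h2.sub h0).add (continuousWithinAt_const.mul (h2.sub h1))) (hF.defect_pos ht).ne'

theorem hasDerivWithinAt_log {t : ℝ} (ht : 0 ≤ t) :
    HasDerivWithinAt (fun t => Real.log (u t + a t)) (K * u t * (η t + l) / (u t + a t)) (Ici 0) t := by
  refine (((hF.u_deriv t ht).add (hF.a_deriv t ht)).log (hF.denom_pos ht).ne').congr_deriv ?_
  simp only [Pi.add_apply]
  congr 1
  ring

theorem hasDerivWithinAt_ratio {t : ℝ} (ht : 0 ≤ t) :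
    HasDerivWithinAt (fun t => a t / u t) (l * K + (K - 1) * η t - a t / u t * η t) (Ici 0) t := by
  have hu := (hF.u_pos t ht).ne'
  refine ((hF.a_deriv t ht).div (hF.u_deriv t ht) hu).congr_deriv ?_
  field_simp
  ring

theorem monotoneOn_add : MonotoneOn (fun t => u t + a t) (Ici 0) := by
  refine monotoneOn_Ici_of_hasDerivWithinAt (fun t ht => (hF.u_deriv t ht).add (hF.a_deriv t ht))
    fun t ht => ?_
  have := mul_nonneg (mul_nonneg (by linarith [hF.one_le] : 0 ≤ K) (hF.u_pos t ht).le)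
    (hF.rate_pos t ht).le
  linarith

/-- The region of the profile that is still visible shrinks to the origin: a lower bound for `S`
would be a lower bound for the mass, which is `exp (-t)`. -/
theorem tendsto_inv_add : Tendsto (fun t => 1 / (u t + a t)) atTop (𝓝 0) := by
  have hg := hF.isProfile
  rw [Metric.tendsto_atTop']
  intro σ hσ
  have hc : Continuous fun z => g (z * σ) := hg.continuous.comp (by fun_prop)
  have hpos : 0 < ∫ z in (0 : ℝ)..1, g (z * σ) :=
    intervalIntegral.intervalIntegral_pos_of_pos_on (hc.intervalIntegrable _ _)
      (fun z hz => hg.pos _ (mul_pos hz.1 hσ)) one_pos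
  have hev : ∀ᶠ t in atTop, Real.exp (-t) < ∫ z in (0 : ℝ)..1, g (z * σ) :=
    Real.tendsto_exp_neg_atTop_nhds_zero.eventually (gt_mem_nhds hpos)
  obtain ⟨N, hN⟩ := (hev.and (eventually_ge_atTop 0)).exists_forall_of_atTop
  refine ⟨N, fun t ht => ?_⟩
  obtain ⟨h1, h0⟩ := hN t ht.le
  have hua := hF.denom_pos h0
  rw [Real.dist_eq, sub_zero, abs_of_pos (by positivity)]
  by_contra hcon
  push Not at hcon
  refine absurd h1 (not_lt.2 ?_)
  have hm : mass g (u t) (a t) = Real.exp (-t) := by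
    rw [Real.exp_neg]
    exact eq_inv_of_mul_eq_one_right (hF.mass_eq t h0)
  have hi := hg.intervalIntegrable_comp_flow (P := fun _ => 1) continuous_const (hF.u_pos t h0) hua
    zero_le_one le_rfl
  simp only [one_mul] at hi
  rw [← hm, mass]
  refine intervalIntegral.integral_mono_on zero_le_one (hc.intervalIntegrable _ _) hi fun z hz => ?_
  refine hg.monotone ?_
  have ha := hF.a_nonneg t h0
  have h3 : u t + a t * z ≤ u t + a t := by nlinarith [hz.2]
  have h4 := add_mul_pos (hF.u_pos t h0) hua hz.1 hz.2
  calc z * σ ≤ z * (1 / (u t + a t)) := mul_le_mul_of_nonneg_left hcon hz.1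
    _ = z / (u t + a t) := by ring
    _ ≤ z / (u t + a t * z) := div_le_div_of_nonneg_left hz.1 h4 h3

/-- The total time of the clock is infinite, because `log (u + a)` tends to infinity and grows at most
`2 K` times as fast as the clock. -/
theorem tendsto_integral_clock :
    Tendsto (fun t => ∫ s in (0 : ℝ)..t, clock g K (u s) (a s)) atTop atTop := by
  have hK : 0 < K := by linarith [hF.one_le]
  have hmono := monotoneOn_Ici_of_hasDerivWithinAt
    (f := fun t => 2 * K * (∫ s in (0 : ℝ)..t, clock g K (u s) (a s)) - Real.log (u t + a t))
    (fun t ht => ((hasDerivWithinAt_integral_Ici hF.continuousOn_clock ht).const_mul (2 * K)).sub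
      (hF.hasDerivWithinAt_log ht)) fun t ht => by
      have h1 := hF.rate_le ht
      have h2 := hF.denom_pos ht
      have h3 := hF.a_nonneg t ht
      have h4 := hF.u_pos t ht
      have h5 : K * u t * (η t + l) / (u t + a t) ≤ K * (η t + l) := by
        rw [div_le_iff₀ h2]
        have := mul_nonneg (mul_nonneg hK.le (hF.rate_pos t ht).le) h3
        linarith
      have h6 := mul_le_mul_of_nonneg_left h1 hK.le
      linarith
  have hlog : Tendsto (fun t => Real.log (u t + a t)) atTop atTop := by
    refine Real.tendsto_log_atTop.comp ?_
    have h1 : Tendsto (fun t => 1 / (u t + a t)) atTop (𝓝[>] 0) := by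
      refine tendsto_nhdsWithin_iff.2 ⟨hF.tendsto_inv_add, ?_⟩
      filter_upwards [eventually_ge_atTop 0] with t ht
      have := hF.denom_pos ht
      exact one_div_pos.2 this
    simpa [Function.comp_def] using tendsto_inv_nhdsGT_zero.comp h1
  have h2 : Tendsto (fun t => (2 * K)⁻¹ * (Real.log (u t + a t) - Real.log (u 0 + a 0)))
      atTop atTop :=
    (tendsto_atTop_add_const_right _ _ hlog).const_mul_atTop (by positivity)
  refine tendsto_atTop_mono' _ ?_ h2
  filter_upwards [eventually_ge_atTop 0] with t ht
  have h3 := hmono self_mem_Ici ht ht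
  simp only [intervalIntegral.integral_same, mul_zero, zero_sub] at h3
  rw [inv_mul_le_iff₀ (by positivity)]
  linarith

/-- With `ρ = a / u`, `k = meanRatio g S` and the clock speed `A`, the equation of the slow variable is
`ρ' k = A (Y - ρ k)`, where `Y = l K β₀ + (K - 1) (1 - β₀)`, up to an error of order `ε A`. -/
theorem abs_ratio_deriv_le {β₀ ε s₀ : ℝ} (hB : BetaNear g β₀ ε s₀) {t : ℝ} (ht : 0 ≤ t)
    (hS : 1 / (u t + a t) < s₀) :
    |(l * K + (K - 1) * η t - a t / u t * η t) * meanRatio g (1 / (u t + a t)) -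
      clock g K (u t) (a t) * (l * K * β₀ + (K - 1) * (1 - β₀) - slowVar g (u t) (a t))| ≤
      4 * K * ε * clock g K (u t) (a t) := by
  have hD := hF.defect_pos ht
  have hu := hF.u_pos t ht
  have hua := hF.denom_pos ht
  have h1 := hB.abs_moment_identity_le hu hua hS
  have h2 := hB.abs_meanRatio_sub_le (one_div_pos.2 hua) hS
  have h3 := hF.planar t ht
  have hm := hF.isProfile.mass_pos hu hua
  have hl := hF.pos
  have hl1 := hF.lt_one
  have hK := hF.one_le
  have hε := hB.eps_nonneg
  unfold slowVar clock
  set k := meanRatio g (1 / (u t + a t))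
  set m := mass g (u t) (a t)
  set n := g (1 / (u t + a t)) - m
  set n₁ := g (1 / (u t + a t)) - moment g (u t) (a t)
  set ρ := a t / u t
  have h4 : (l * K + (K - 1) * η t - ρ * η t) * k -
      m / (n + (K - 1) * n₁) * (l * K * β₀ + (K - 1) * (1 - β₀) - ρ * k) =
      (l * K * (k * n + ρ * k * n₁ - β₀ * m) + (K - 1) * (k - (1 - β₀)) * m) /
        (n + (K - 1) * n₁) := by
    rw [eq_div_iff hD.ne', sub_mul, mul_right_comm (m / _), div_mul_cancel₀ _ hD.ne']
    linear_combination (-(K - 1) * k + ρ * k) * h3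
  rw [h4, abs_div, abs_of_pos hD, mul_div_assoc']
  gcongr
  refine (abs_add_le _ _).trans ?_
  rw [abs_mul, abs_of_pos (by positivity : 0 < l * K), abs_mul, abs_mul, abs_of_pos hm,
    abs_of_nonneg (sub_nonneg.2 hK)]
  have h5 : l * K * |k * n + ρ * k * n₁ - β₀ * m| ≤ 1 * K * (3 * ε * m) := by gcongr
  have h6 : (K - 1) * |k - (1 - β₀)| * m ≤ K * ε * m := by
    gcongr
    linarith
  linarith

end IsMassFlow

end

/-! ### Convergence of the slow variable and of the rate -/

section

theorem abs_deriv_le_of_dominated {F L : ℝ → ℝ} {a b t d d' C : ℝ} (ht : t ∈ Ioo a b)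
    (hF : HasDerivAt F d t) (hL : HasDerivAt L d' t)
    (h : ∀ x ∈ Icc a b, ∀ y ∈ Icc a b, x ≤ y → |F y - F x| ≤ C * (L y - L x)) :
    |d| ≤ C * d' := by
  have hu := (uniqueDiffOn_Icc (ht.1.trans ht.2)) t ⟨ht.1.le, ht.2.le⟩
  have h1 : MonotoneOn (fun x => C * L x - F x) (Icc a b) := fun x hx y hy hxy => by
    have := (abs_le.1 (h x hx y hy hxy)).2
    simp only
    linarith
  have h2 : MonotoneOn (fun x => C * L x + F x) (Icc a b) := fun x hx y hy hxy => by
    have := (abs_le.1 (h x hx y hy hxy)).1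
    simp only
    linarith
  have h3 := h1.derivWithin_nonneg (x := t)
  have h4 := h2.derivWithin_nonneg (x := t)
  rw [((hL.const_mul C).fun_sub hF).hasDerivWithinAt.derivWithin hu] at h3
  rw [((hL.const_mul C).fun_add hF).hasDerivWithinAt.derivWithin hu] at h4
  rw [abs_le]
  constructor <;> linarith

theorem BetaLimit.exists_betaNear {g : ℝ → ℝ} {β₀ : ℝ} (hβ : BetaLimit g β₀) (hg : IsProfile g)
    (hac : AbsolutelyContinuousOnInterval g 0 1) {ε : ℝ} (hε : 0 < ε) :
    ∃ s₀, BetaNear g β₀ ε s₀ := by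
  obtain ⟨s₀, h0, h1, h⟩ := hβ ε hε
  exact ⟨s₀, hg, hac, h0, h1, hε.le, h⟩

namespace IsMassFlow

variable {g : ℝ → ℝ} {K l : ℝ} {u a η : ℝ → ℝ} (hF : IsMassFlow g K l u a η)
include hF

/-- In time, `meanRatio g S` varies by at most `2 ε` times the variation of `log (u + a)`. -/
theorem abs_meanRatio_le_log {β₀ ε s₀ : ℝ} (hB : BetaNear g β₀ ε s₀) {x y : ℝ} (hx : 0 ≤ x)
    (hxy : x ≤ y) (hS : 1 / (u x + a x) < s₀) :
    |meanRatio g (1 / (u y + a y)) - meanRatio g (1 / (u x + a x))| ≤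
      2 * ε * (Real.log (u y + a y) - Real.log (u x + a x)) := by
  have h1 := hF.denom_pos hx
  have h2 := hF.denom_pos (hx.trans hxy)
  have h3 : u x + a x ≤ u y + a y := hF.monotoneOn_add hx (hx.trans hxy) hxy
  have h4 := hB.abs_meanRatio_sub_meanRatio_le (one_div_pos.2 h2) (one_div_le_one_div_of_le h1 h3) hS
  rw [abs_sub_comm]
  refine h4.trans (mul_le_mul_of_nonneg_left ?_ (by linarith [hB.eps_nonneg]))
  rw [← Real.log_div h2.ne' h1.ne']
  refine le_trans (le_of_eq ?_) (Real.one_sub_inv_le_log_of_pos (div_pos h2 h1))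
  rw [inv_div, div_div_eq_mul_div, one_div_mul_eq_div, div_one]

/-- The slow variable relaxes to its limit on the scale of the clock, up to an error of order `ε`. -/
theorem exp_mul_slowVar_le {β₀ ε s₀ : ℝ} (hB : BetaNear g β₀ ε s₀) {t₁ t₂ : ℝ} (h0 : 0 < t₁)
    (h12 : t₁ ≤ t₂) (hS : 1 / (u t₁ + a t₁) < s₀) {τ : ℝ} (hτ : |τ| = 1) :
    Real.exp (∫ s in (0 : ℝ)..t₂, clock g K (u s) (a s)) *
        (τ * (slowVar g (u t₂) (a t₂) - (l * K * β₀ + (K - 1) * (1 - β₀))) - 8 * K * ε) ≤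
      Real.exp (∫ s in (0 : ℝ)..t₁, clock g K (u s) (a s)) *
        (τ * (slowVar g (u t₁) (a t₁) - (l * K * β₀ + (K - 1) * (1 - β₀))) - 8 * K * ε) := by
  set Y := l * K * β₀ + (K - 1) * (1 - β₀) with hY
  set T : ℝ → ℝ := fun t => ∫ s in (0 : ℝ)..t, clock g K (u s) (a s) with hT
  set k : ℝ → ℝ := fun t => meanRatio g (1 / (u t + a t)) with hk
  set L : ℝ → ℝ := fun t => Real.log (u t + a t) with hL
  have hpos : ∀ t ∈ Icc t₁ t₂, 0 < t := fun t ht => h0.trans_le ht.1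
  have hsub : Icc t₁ t₂ ⊆ Ici 0 := fun t ht => (hpos t ht).le
  have hSt : ∀ t ∈ Icc t₁ t₂, 1 / (u t + a t) < s₀ := fun t ht =>
    (one_div_le_one_div_of_le (hF.denom_pos h0.le)
      (hF.monotoneOn_add h0.le (hpos t ht).le ht.1)).trans_lt hS
  have hTd : ∀ t ∈ Icc t₁ t₂, HasDerivAt (fun t => Real.exp (T t))
      (Real.exp (T t) * clock g K (u t) (a t)) t := fun t ht =>
    ((hasDerivWithinAt_integral_Ici hF.continuousOn_clock (hpos t ht).le).hasDerivAt
      (Ici_mem_nhds (hpos t ht))).exp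
  have hρd : ∀ t ∈ Icc t₁ t₂, HasDerivAt (fun t => a t / u t)
      (l * K + (K - 1) * η t - a t / u t * η t) t := fun t ht =>
    (hF.hasDerivWithinAt_ratio (hpos t ht).le).hasDerivAt (Ici_mem_nhds (hpos t ht))
  have hLd : ∀ t ∈ Icc t₁ t₂, HasDerivAt L (K * u t * (η t + l) / (u t + a t)) t := fun t ht =>
    (hF.hasDerivWithinAt_log (hpos t ht).le).hasDerivAt (Ici_mem_nhds (hpos t ht))
  have hcu : ContinuousOn u (Icc t₁ t₂) := fun t ht =>
    (hF.u_deriv t (hsub ht)).continuousWithinAt.mono hsub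
  have hca : ContinuousOn a (Icc t₁ t₂) := fun t ht =>
    (hF.a_deriv t (hsub ht)).continuousWithinAt.mono hsub
  have hcη : ContinuousOn η (Icc t₁ t₂) := hF.rate_cont.mono hsub
  have hcT : ContinuousOn (fun t => Real.exp (T t)) (Icc t₁ t₂) := fun t ht =>
    (hTd t ht).continuousAt.continuousWithinAt
  have hcρ : ContinuousOn (fun t => a t / u t) (Icc t₁ t₂) := fun t ht =>
    (hρd t ht).continuousAt.continuousWithinAt
  have acT := absolutelyContinuousOnInterval_of_hasDerivAt h12 hTd
    (hcT.mul (hF.continuousOn_clock.mono hsub))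
  have acρ := absolutelyContinuousOnInterval_of_hasDerivAt h12 hρd
    ((continuousOn_const.add (continuousOn_const.mul hcη)).sub (hcρ.mul hcη))
  have acL := absolutelyContinuousOnInterval_of_hasDerivAt h12 hLd
    (((continuousOn_const.mul hcu).mul (hcη.add continuousOn_const)).div (hcu.add hca)
      fun t ht => (hF.denom_pos (hsub ht)).ne')
  have hdom : ∀ x ∈ Icc t₁ t₂, ∀ y ∈ Icc t₁ t₂, x ≤ y → |k y - k x| ≤ 2 * ε * (L y - L x) :=
    fun x hx y hy hxy => hF.abs_meanRatio_le_log hB (hsub hx) hxy (hSt x hx)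
  have hε := hB.eps_nonneg
  have ack : AbsolutelyContinuousOnInterval k t₁ t₂ := by
    refine absolutelyContinuousOnInterval_of_dist_le acL (C := 2 * ε + 1) (by linarith)
      fun x hx y hy => ?_
    rw [uIcc_of_le h12] at hx hy
    have hlt : ∀ x ∈ Icc t₁ t₂, ∀ y ∈ Icc t₁ t₂, x ≤ y →
        |k y - k x| ≤ (2 * ε + 1) * |L y - L x| := fun x hx y hy hxy => by
      have h1 := hdom x hx y hy hxy
      have h2 := le_abs_self (L y - L x)
      have h3 := abs_nonneg (L y - L x)
      have h4 := mul_le_mul_of_nonneg_left h2 (by linarith : 0 ≤ 2 * ε)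
      linarith
    rw [Real.dist_eq, Real.dist_eq]
    rcases le_total x y with hxy | hxy
    · rw [abs_sub_comm (k x), abs_sub_comm (L x)]
      exact hlt x hx y hy hxy
    · exact hlt y hy x hx hxy
  set Φ : ℝ → ℝ := fun t => Real.exp (T t) * (8 * K * ε - τ * (a t / u t * k t - Y)) with hΦ
  have hconst : ∀ c : ℝ, AbsolutelyContinuousOnInterval (fun _ => c) t₁ t₂ := fun c =>
    absolutelyContinuousOnInterval_of_hasDerivAt h12 (fun x _ => hasDerivAt_const x c)
      continuousOn_const
  have acΦ : AbsolutelyContinuousOnInterval Φ t₁ t₂ :=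
    acT.mul ((hconst (8 * K * ε)).sub (((acρ.mul ack).sub (hconst Y)).const_mul τ))
  have hmono : Φ t₁ ≤ Φ t₂ := by
    refine le_of_ae_deriv_nonneg h12 acΦ ack fun t ht hd => ?_
    have ht' : t ∈ Icc t₁ t₂ := ⟨ht.1.le, ht.2.le⟩
    have hkd := hd.hasDerivAt
    refine ⟨_, (hTd t ht').mul (((((hρd t ht').mul hkd).sub_const Y).const_mul τ).const_sub
      (8 * K * ε)), ?_⟩
    have h1 := abs_deriv_le_of_dominated ht hkd (hLd t ht') hdom
    have h2 := hF.abs_ratio_deriv_le hB (hsub ht') (hSt t ht')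
    have hu := hF.u_pos t (hsub ht')
    have hua := hF.denom_pos (hsub ht')
    have ha := hF.a_nonneg t (hsub ht')
    have hK := hF.one_le
    have hρ : 0 ≤ a t / u t := div_nonneg ha hu.le
    have h3 : |a t / u t * deriv k t| ≤ 4 * K * ε * clock g K (u t) (a t) := by
      rw [abs_mul, abs_of_nonneg hρ]
      calc a t / u t * |deriv k t|
          ≤ a t / u t * (2 * ε * (K * u t * (η t + l) / (u t + a t))) := by gcongr
        _ = 2 * ε * K * (η t + l) * (a t / (u t + a t)) := by field_simp
        _ ≤ 2 * ε * K * (η t + l) * 1 := by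
            have := (hF.rate_pos t (hsub ht')).le
            gcongr
            rw [div_le_one hua]
            linarith
        _ ≤ 2 * ε * K * (2 * clock g K (u t) (a t)) * 1 := by
            gcongr
            exact hF.rate_le (hsub ht')
        _ = _ := by ring
    have hexp := Real.exp_pos (T t)
    have hsv : slowVar g (u t) (a t) = a t / u t * k t := rfl
    rw [hsv] at h2
    set A := clock g K (u t) (a t)
    set e₁ := (l * K + (K - 1) * η t - a t / u t * η t) * meanRatio g (1 / (u t + a t)) -
      A * (Y - a t / u t * k t) with he₁
    have h4 : (l * K + (K - 1) * η t - a t / u t * η t) * k t =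
      A * (Y - a t / u t * k t) + e₁ := by rw [he₁]; ring
    rw [h4]
    have h5 : τ * (e₁ + a t / u t * deriv k t) ≤ 8 * K * ε * A := by
      refine (le_abs_self _).trans ?_
      rw [abs_mul, hτ, one_mul]
      refine (abs_add_le _ _).trans ?_
      linarith
    have h6 := mul_nonneg hexp.le (sub_nonneg.2 h5)
    linarith
  simp only [hΦ] at hmono
  have e1 : slowVar g (u t₁) (a t₁) = a t₁ / u t₁ * k t₁ := rfl
  have e2 : slowVar g (u t₂) (a t₂) = a t₂ / u t₂ * k t₂ := rfl
  rw [e1, e2]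
  linarith

theorem eventually_inv_add_lt {s₀ : ℝ} (hs : 0 < s₀) :
    ∀ᶠ t in atTop, 0 < t ∧ 1 / (u t + a t) < s₀ :=
  (eventually_gt_atTop 0).and (hF.tendsto_inv_add.eventually (gt_mem_nhds hs))

theorem tendsto_slowVar {β₀ : ℝ} (hac : AbsolutelyContinuousOnInterval g 0 1)
    (hβ : BetaLimit g β₀) :
    Tendsto (fun t => slowVar g (u t) (a t)) atTop (𝓝 (l * K * β₀ + (K - 1) * (1 - β₀))) := by
  rw [Metric.tendsto_nhds]
  intro δ hδ
  have hK : 0 < K := by linarith [hF.one_le]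
  set ε := δ / (16 * K) with hε
  obtain ⟨s₀, hB⟩ := hβ.exists_betaNear hF.isProfile hac (ε := ε) (by positivity)
  obtain ⟨t₀, ht₀, hS⟩ := (hF.eventually_inv_add_lt hB.pos).exists
  set Y := l * K * β₀ + (K - 1) * (1 - β₀) with hY
  have hdecay : ∀ c : ℝ, Tendsto (fun t =>
      Real.exp (-∫ s in (0 : ℝ)..t, clock g K (u s) (a s)) * c) atTop (𝓝 0) := fun c => by
    have := (Real.tendsto_exp_neg_atTop_nhds_zero.comp hF.tendsto_integral_clock).mul_const c
    simpa [Function.comp_def] using this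
  have hτ : ∀ τ : ℝ, |τ| = 1 → ∀ᶠ t in atTop, τ * (slowVar g (u t) (a t) - Y) < δ := by
    intro τ hτ
    filter_upwards [eventually_ge_atTop t₀, (hdecay _).eventually (gt_mem_nhds (half_pos hδ))]
      with t ht h1
    have h2 := hF.exp_mul_slowVar_le hB ht₀ ht hS hτ
    have h3 := mul_le_mul_of_nonneg_left h2
      (Real.exp_pos (-∫ s in (0 : ℝ)..t, clock g K (u s) (a s))).le
    rw [← mul_assoc, ← Real.exp_add, neg_add_cancel, Real.exp_zero, one_mul] at h3
    have h4 : 8 * K * ε = δ / 2 := by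
      rw [hε]
      field_simp
      ring
    linarith [h3.trans_lt h1]
  filter_upwards [hτ 1 (by simp), hτ (-1) (by simp)] with t h1 h2
  rw [Real.dist_eq, abs_lt]
  constructor <;> linarith

/-- The planar equation and the moment identity together make `β₀ η - (1 - β₀)`, times the defect
`n₀ + (K - 1) n₁`, equal to a combination of small terms. -/
theorem abs_rate_le {β₀ ε s₀ : ℝ} (hB : BetaNear g β₀ ε s₀) (hβ₀ : 0 < β₀) (hε : 6 * ε ≤ β₀)
    {t : ℝ} (ht : 0 ≤ t) (hS : 1 / (u t + a t) < s₀) :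
    |β₀ * η t - (1 - β₀)| ≤
      ε + 2 * |slowVar g (u t) (a t) - (l * K * β₀ + (K - 1) * (1 - β₀))| +
        6 * ε / β₀ * (1 + 2 * |slowVar g (u t) (a t)|) := by
  have hu := hF.u_pos t ht
  have hua := hF.denom_pos ht
  have hD := hF.defect_pos ht
  have hE := hB.abs_moment_identity_le hu hua hS
  have hk := hB.abs_meanRatio_sub_le (one_div_pos.2 hua) hS
  have hk1 := BetaNear.meanRatio_le_one hF.isProfile (one_div_pos.2 hua)
  have hp := hF.planar t ht
  have hm := hF.isProfile.mass_pos hu hua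
  have hn := sub_pos.2 (hF.isProfile.mass_lt hu hua)
  obtain ⟨hn1, hn2⟩ := hF.isProfile.moment_defect_bounds hu hua
  have hK := hF.one_le
  have hε0 := hB.eps_nonneg
  change |_ * _ + slowVar g (u t) (a t) * _ - _| ≤ _ at hE
  set k := meanRatio g (1 / (u t + a t))
  set m := mass g (u t) (a t)
  set n := g (1 / (u t + a t)) - m
  set n₁ := g (1 / (u t + a t)) - moment g (u t) (a t)
  set Y := slowVar g (u t) (a t)
  have h1 : (β₀ * η t - (1 - β₀)) * (n + (K - 1) * n₁) =
      (k - (1 - β₀)) * n + (Y - (l * K * β₀ + (K - 1) * (1 - β₀))) * n₁ -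
        (k * n + Y * n₁ - β₀ * m) := by
    linear_combination -β₀ * hp
  set E := k * n + Y * n₁ - β₀ * m with hEdef
  set d := Y - (l * K * β₀ + (K - 1) * (1 - β₀))
  have h2 : |β₀ * η t - (1 - β₀)| * n ≤ ε * n + |d| * (2 * n) + 3 * ε * m := by
    calc |β₀ * η t - (1 - β₀)| * n ≤ |β₀ * η t - (1 - β₀)| * (n + (K - 1) * n₁) := by
          gcongr
          have := mul_nonneg (sub_nonneg.2 hK) hn1
          linarith
      _ = |(k - (1 - β₀)) * n + d * n₁ - E| := by
          rw [← h1, abs_mul, abs_of_pos hD]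
      _ ≤ |(k - (1 - β₀)) * n| + |d * n₁| + |E| :=
          (abs_sub _ _).trans (add_le_add_left (abs_add_le _ _) _)
      _ ≤ ε * n + |d| * (2 * n) + 3 * ε * m := by
          rw [abs_mul, abs_mul, abs_of_pos hn, abs_of_nonneg hn1]
          gcongr
  have h3 : β₀ * m ≤ 2 * (1 + 2 * |Y|) * n := by
    have h4 : k * n ≤ 1 * n := by gcongr
    have h5 : Y * n₁ ≤ |Y| * (2 * n) :=
      (mul_le_mul_of_nonneg_right (le_abs_self Y) hn1).trans (by gcongr)
    have h6 := (abs_le.1 hE).1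
    have h7 : 6 * ε * m ≤ β₀ * m := by gcongr
    linarith
  have h8 : 3 * ε * m ≤ 6 * ε / β₀ * (1 + 2 * |Y|) * n := by
    rw [div_mul_eq_mul_div, div_mul_eq_mul_div, le_div_iff₀ hβ₀]
    have := mul_le_mul_of_nonneg_left h3 hε0
    linarith
  refine le_of_mul_le_mul_right ?_ hn
  linarith

theorem tendsto_rate {β₀ : ℝ} (hac : AbsolutelyContinuousOnInterval g 0 1)
    (hβ : BetaLimit g β₀) (hβ₀ : 0 < β₀) : Tendsto η atTop (𝓝 ((1 - β₀) / β₀)) := by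
  set Y := l * K * β₀ + (K - 1) * (1 - β₀) with hY
  have hslow := hF.tendsto_slowVar hac hβ
  suffices Tendsto (fun t => β₀ * η t) atTop (𝓝 (1 - β₀)) by
    have h := this.const_mul β₀⁻¹
    simp only [inv_mul_cancel_left₀ hβ₀.ne'] at h
    rwa [div_eq_inv_mul]
  rw [Metric.tendsto_nhds]
  intro δ hδ
  set C := 3 + 6 / β₀ * (3 + 2 * |Y|) with hC
  have hC0 : 0 < C := by positivity
  set ε := min 1 (min (β₀ / 6) (δ / (2 * C))) with hε
  have hε0 : 0 < ε := by positivity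
  obtain ⟨s₀, hB⟩ := hβ.exists_betaNear hF.isProfile hac hε0
  filter_upwards [hF.eventually_inv_add_lt hB.pos, hslow.eventually (Metric.ball_mem_nhds _ hε0)]
    with t ht h1
  have h6 : 6 * ε ≤ β₀ := by
    have : ε ≤ β₀ / 6 := (min_le_right _ _).trans (min_le_left _ _)
    linarith
  have h2 := hF.abs_rate_le hB hβ₀ h6 ht.1.le ht.2
  rw [← hY] at h2
  rw [Real.dist_eq, ← hY] at h1
  have h3 : |slowVar g (u t) (a t)| ≤ |Y| + 1 := by
    have h4 := abs_sub_abs_le_abs_sub (slowVar g (u t) (a t)) Y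
    have h5 : ε ≤ 1 := min_le_left _ _
    linarith
  have h7 : ε ≤ δ / (2 * C) := (min_le_right _ _).trans (min_le_right _ _)
  rw [le_div_iff₀ (by positivity)] at h7
  rw [Real.dist_eq]
  have h8 : 6 * ε / β₀ * (1 + 2 * |slowVar g (u t) (a t)|) ≤ 6 * ε / β₀ * (3 + 2 * |Y|) :=
    mul_le_mul_of_nonneg_left (by linarith) (by positivity)
  have h9 : ε * C = 3 * ε + 6 * ε / β₀ * (3 + 2 * |Y|) := by
    rw [hC]
    ring
  linarith

end IsMassFlow

end

/-! ### Stationary solutions -/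

section

/-- The logarithm of the stationary profile in `z = 1 - x`, up to a constant: `∫₁ᶻ dy / (p y + q y²)`,
where `p y + q y²` is the speed of the stationary characteristics. -/
def potential (p q z : ℝ) : ℝ := ∫ y in (1 : ℝ)..z, 1 / (p * y + q * y ^ 2)

section Potential

variable {p q : ℝ} (hp : 0 ≤ p) (hq : 0 < q)
include hp hq

theorem quad_pos {z : ℝ} (hz : 0 < z) : 0 < p * z + q * z ^ 2 := by positivity

theorem hasDerivAt_potential {z : ℝ} (hz : 0 < z) :
    HasDerivAt (potential p q) (1 / (p * z + q * z ^ 2)) z := by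
  have hc : ContinuousOn (fun y => 1 / (p * y + q * y ^ 2)) (Ioi 0) :=
    continuousOn_const.div (by fun_prop) fun y hy => (quad_pos hp hq hy).ne'
  refine intervalIntegral.integral_hasDerivAt_right ?_ ?_ (hc.continuousAt (Ioi_mem_nhds hz))
  · exact (hc.mono fun y hy => (lt_min one_pos hz).trans_le hy.1).intervalIntegrable
  · refine (Measurable.stronglyMeasurable ?_).stronglyMeasurableAtFilter
    fun_prop

theorem monotoneOn_potential : MonotoneOn (potential p q) (Ioi 0) :=
  monotoneOn_of_deriv_nonneg (convex_Ioi 0)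
    (fun z hz => (hasDerivAt_potential hp hq hz).continuousAt.continuousWithinAt)
    (fun z hz => (hasDerivAt_potential hp hq
      (interior_subset hz)).differentiableAt.differentiableWithinAt)
    fun z hz => by
      have hz' : 0 < z := interior_subset hz
      rw [(hasDerivAt_potential hp hq hz').deriv]
      exact (one_div_pos.2 (quad_pos hp hq hz')).le

theorem intervalIntegrable_exp_potential {y z : ℝ} (hy : 0 ≤ y) (hyz : y ≤ z) :
    IntervalIntegrable (fun y => Real.exp (potential p q y)) volume y z := by
  have hc : ContinuousOn (fun y => Real.exp (potential p q y)) (Ioc y z) := fun x hx =>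
    (hasDerivAt_potential hp hq (hy.trans_lt hx.1)).continuousAt.rexp.continuousWithinAt
  rw [intervalIntegrable_iff_integrableOn_Ioc_of_le hyz]
  refine IntegrableOn.of_bound measure_Ioc_lt_top (hc.aestronglyMeasurable measurableSet_Ioc)
    (Real.exp (potential p q z)) ?_
  · filter_upwards [ae_restrict_mem measurableSet_Ioc] with x hx
    rw [Real.norm_eq_abs, abs_of_pos (Real.exp_pos _), Real.exp_le_exp]
    have hx0 : 0 < x := hy.trans_lt hx.1
    exact monotoneOn_potential hp hq hx0 (hx0.trans_le hx.2) hx.2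

end Potential

/-- The stationary beta function in the variable `z = 1 - x`. -/
def steadyBeta (p q z : ℝ) : ℝ :=
  (∫ y in (0 : ℝ)..z, Real.exp (potential p q y)) / Real.exp (potential p q z) /
    (p * z + q * z ^ 2)

section Steady

variable {φ ψ : Polynomial ℝ} (h : IsAdmissible φ ψ) (hφ : φ.natDegree ≤ 2) (hψ : ψ.natDegree ≤ 2)
  {κ p q : ℝ} (hp : 0 ≤ p) (hκ : κ * |slope ψ| = p + |slope φ|)
  (hq : q = (stretch ψ - 1) * p + |slope φ| * stretch ψ)
include h hφ hψ hp hκ hq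

omit hφ hκ in
theorem IsAdmissible.quad_coeff_pos : 0 < q := by
  have h1 := h.one_le_stretch hψ
  have h2 := h.abs_slope_phi_pos
  rw [hq]
  exact add_pos_of_nonneg_of_pos (mul_nonneg (by linarith) hp) (mul_pos h2 (by linarith))

theorem IsSteadyState.derivWithin_eq {W : ℝ → ℝ} (hW : IsSteadyState φ ψ κ W) {x : ℝ}
    (hx : x ∈ Ico (0 : ℝ) 1) :
    derivWithin W (Ico 0 1) x = -(W x / (p * (1 - x) + q * (1 - x) ^ 2)) := by
  have h1 := hW.ode x hx
  have h2 := quad_pos hp (h.quad_coeff_pos hψ hp hq) (z := 1 - x) (by linarith [hx.2])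
  rw [h.speed_eq hφ hψ hκ, ← hq] at h1
  rw [← h1, neg_mul, neg_div, neg_neg, mul_div_cancel_left₀ _ h2.ne']

theorem IsSteadyState.eq_exp {W : ℝ → ℝ} (hW : IsSteadyState φ ψ κ W) {x : ℝ}
    (hx : x ∈ Ico (0 : ℝ) 1) : W x = W 0 * Real.exp (potential p q (1 - x)) := by
  have hq0 := h.quad_coeff_pos hψ hp hq
  have hd : ∀ y ∈ Ico (0 : ℝ) 1,
      HasDerivWithinAt (fun y => W y * Real.exp (-potential p q (1 - y))) 0 (Ico 0 1) y := by
    intro y hy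
    have hz : 0 < 1 - y := by linarith [hy.2]
    have h1 := (hW.differentiableOn y hy).hasDerivWithinAt
    rw [hW.derivWithin_eq h hφ hψ hp hκ hq hy] at h1
    have h2 := ((hasDerivAt_potential hp hq0 hz).comp y
      ((hasDerivAt_id y).const_sub 1)).neg.exp.hasDerivWithinAt (s := Ico 0 1)
    refine (h1.mul h2).congr_deriv ?_
    simp only [Function.comp_apply, Pi.neg_apply]
    have := (quad_pos hp hq0 hz).ne'
    field_simp
    ring
  have hc := constant_of_has_deriv_right_zero (a := 0) (b := x)
    (fun y hy => (hd y ⟨hy.1, hy.2.trans_lt hx.2⟩).continuousWithinAt.mono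
      fun y hy => ⟨hy.1, hy.2.trans_lt hx.2⟩)
    (fun y hy => (hd y ⟨hy.1, hy.2.trans hx.2⟩).mono_of_mem_nhdsWithin
      (Filter.mem_of_superset (Ico_mem_nhdsGE (hy.2.trans hx.2))
        (Ico_subset_Ico_left hy.1))) x ⟨hx.1, le_rfl⟩
  simp only [sub_zero] at hc
  have h0 : potential p q 1 = 0 := by simp [potential]
  rw [h0, neg_zero, Real.exp_zero, mul_one] at hc
  rw [← hc, mul_assoc, ← Real.exp_add]
  simp

theorem IsSteadyState.betaFun_eq {W : ℝ → ℝ} (hW : IsSteadyState φ ψ κ W) {x : ℝ}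
    (hx : x ∈ Ico (0 : ℝ) 1) : betaFun W x = steadyBeta p q (1 - x) := by
  have hq0 := h.quad_coeff_pos hψ hp hq
  have hz : 0 < 1 - x := by linarith [hx.2]
  have ht : tail W x = W 0 * ∫ y in (0 : ℝ)..1 - x, Real.exp (potential p q y) := by
    have h1 := intervalIntegral.integral_comp_sub_left (fun y => W y) 1 (a := 0) (b := 1 - x)
    rw [sub_zero, sub_sub_cancel] at h1
    rw [tail, ← h1, ← intervalIntegral.integral_const_mul]
    refine intervalIntegral.integral_congr_uIoo fun y hy => ?_
    rw [uIoo_of_le hz.le] at hy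
    have := hW.eq_exp h hφ hψ hp hκ hq (x := 1 - y)
      ⟨by linarith [hy.2, hx.1], by linarith [hy.1]⟩
    simpa using this
  have h0 := (hW.pos 0 (by simp)).ne'
  rw [betaFun, density, hW.derivWithin_eq h hφ hψ hp hκ hq hx, ht, neg_neg,
    hW.eq_exp h hφ hψ hp hκ hq hx, steadyBeta]
  have := (quad_pos hp hq0 hz).ne'
  have := (Real.exp_pos (potential p q (1 - x))).ne'
  field_simp

theorem exists_isSteadyState : ∃ W, IsSteadyState φ ψ κ W := by
  have hq0 := h.quad_coeff_pos hψ hp hq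
  set Z := ∫ y in (0 : ℝ)..1, Real.exp (potential p q y) with hZ
  have hZ0 : 0 < Z := intervalIntegral.intervalIntegral_pos_of_pos_on
    (intervalIntegrable_exp_potential hp hq0 le_rfl zero_le_one) (fun y _ => Real.exp_pos _) one_pos
  have hd : ∀ x ∈ Ico (0 : ℝ) 1, HasDerivWithinAt (fun x => Real.exp (potential p q (1 - x)) / Z)
      (-(Real.exp (potential p q (1 - x)) / Z / (p * (1 - x) + q * (1 - x) ^ 2))) (Ico 0 1) x := by
    intro x hx
    have hz : 0 < 1 - x := by linarith [hx.2]
    have h2 := ((hasDerivAt_potential hp hq0 hz).comp x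
      ((hasDerivAt_id x).const_sub 1)).exp.div_const Z
    refine h2.hasDerivWithinAt.congr_deriv ?_
    simp only [Function.comp_apply]
    ring
  refine ⟨fun x => Real.exp (potential p q (1 - x)) / Z,
    fun x hx => (hd x hx).differentiableWithinAt, fun x _ => div_pos (Real.exp_pos _) hZ0,
    fun x hx => ?_, ?_⟩
  · have hz := quad_pos hp hq0 (z := 1 - x) (by linarith [hx.2])
    rw [(hd x hx).derivWithin ((uniqueDiffOn_Ico 0 1) x hx), h.speed_eq hφ hψ hκ, ← hq]
    rw [neg_mul_neg, mul_div_cancel₀ _ hz.ne']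
  · rw [intervalIntegral.integral_div,
      intervalIntegral.integral_comp_sub_left (fun y => Real.exp (potential p q y)) 1]
    simp only [sub_self, sub_zero]
    exact div_self hZ0.ne'

end Steady

/-- A relative error `ε` in the exponent is an absolute error `2 ε`, uniformly in `B`, because
`B exp (-B / 2) ≤ 2`. -/
theorem abs_sub_exp_le {r B ε : ℝ} (hB : 0 ≤ B) (hε : 0 ≤ ε) (hε2 : ε ≤ 1 / 2)
    (h1 : r ≤ Real.exp (-((1 - ε) * B))) (h2 : Real.exp (-((1 + ε) * B)) ≤ r) :
    |r - Real.exp (-B)| ≤ 2 * ε := by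
  have hεB := mul_nonneg hε hB
  have h3 : B * Real.exp (-(B / 2)) ≤ 2 := by
    have h4 := Real.add_one_le_exp (B / 2)
    rw [Real.exp_neg, ← div_eq_mul_inv, div_le_iff₀ (Real.exp_pos _)]
    linarith
  have h5 : 1 - Real.exp (-(ε * B)) ≤ ε * B := by
    have := Real.add_one_le_exp (-(ε * B))
    linarith
  have h6 : Real.exp (-((1 - ε) * B)) ≤ Real.exp (-(B / 2)) := by
    rw [Real.exp_le_exp]
    nlinarith
  have h7 : Real.exp (-B) ≤ Real.exp (-(B / 2)) := by
    rw [Real.exp_le_exp]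
    linarith
  have e1 : Real.exp (-B) = Real.exp (-((1 - ε) * B)) * Real.exp (-(ε * B)) := by
    rw [← Real.exp_add]
    ring_nf
  have e2 : Real.exp (-((1 + ε) * B)) = Real.exp (-B) * Real.exp (-(ε * B)) := by
    rw [← Real.exp_add]
    ring_nf
  have h8 : ∀ x, 0 ≤ x → x ≤ Real.exp (-(B / 2)) → x - x * Real.exp (-(ε * B)) ≤ 2 * ε := by
    intro x hx0 hx
    calc x - x * Real.exp (-(ε * B)) = x * (1 - Real.exp (-(ε * B))) := by ring
      _ ≤ Real.exp (-(B / 2)) * (ε * B) := by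
          refine mul_le_mul hx h5 ?_ (Real.exp_pos _).le
          rw [sub_nonneg, Real.exp_le_one_iff]
          linarith
      _ = ε * (B * Real.exp (-(B / 2))) := by ring
      _ ≤ ε * 2 := by gcongr
      _ = 2 * ε := by ring
  have h9 := h8 _ (Real.exp_pos _).le h6
  have h10 := h8 _ (Real.exp_pos _).le h7
  rw [abs_le]
  constructor
  · linarith
  · linarith

namespace BetaNear

variable {g : ℝ → ℝ} {β₀ ε s₀ : ℝ} (hB : BetaNear g β₀ ε s₀)
include hB

/-- The monotonicity of `g (∫ g)^(-b)` for `b` slightly different from `β₀`. -/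
theorem mul_exp_log_primitive {b τ : ℝ} (hτ : τ = 1 ∨ τ = -1) (hb : b = β₀ + τ * ε) {x y : ℝ}
    (hx : 0 < x) (hxy : x ≤ y) (hy : y < s₀) :
    τ * (g y * Real.exp (-b * Real.log (primitive g y))) ≤
      τ * (g x * Real.exp (-b * Real.log (primitive g x))) := by
  have hg := hB.isProfile
  have hE : ∀ s ∈ Icc x y, HasDerivAt (fun s => Real.exp (-b * Real.log (primitive g s)))
      (Real.exp (-b * Real.log (primitive g s)) * (-b * (g s / primitive g s))) s := fun s hs =>
    (((hg.hasDerivAt_primitive s).log (hg.primitive_pos (hx.trans_le hs.1)).ne').const_mul _).exp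
  have hcH : ContinuousOn (primitive g) (Icc x y) := fun s _ =>
    (hg.hasDerivAt_primitive s).continuousAt.continuousWithinAt
  have hgac := hB.ac_mono hx.le hxy hy
  have hac := hgac.mul (absolutelyContinuousOnInterval_of_hasDerivAt hxy hE
    (ContinuousOn.mul (fun s hs => (hE s hs).continuousAt.continuousWithinAt)
      (continuousOn_const.mul (hg.continuous.continuousOn.div hcH fun s hs =>
        (hg.primitive_pos (hx.trans_le hs.1)).ne'))))
  have := le_of_ae_deriv_nonneg hxy (hac.const_mul (-τ)) hgac fun s hs hd => by
    have hs0 := hx.trans hs.1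
    refine ⟨_, (hd.hasDerivAt.mul (hE s ⟨hs.1.le, hs.2.le⟩)).const_mul (-τ), ?_⟩
    have h1 := hB.near s hs0 (hs.2.trans hy) hd
    have h2 := hg.pos s hs0
    have h3 := hg.primitive_pos hs0
    have h4 : -τ * (deriv g s * Real.exp (-b * Real.log (primitive g s)) +
        g s * (Real.exp (-b * Real.log (primitive g s)) * (-b * (g s / primitive g s)))) =
        (Real.exp (-b * Real.log (primitive g s)) * (g s ^ 2 / primitive g s)) *
          (τ * (b - deriv g s * primitive g s / g s ^ 2)) := by
      field_simp
      ring
    rw [h4]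
    refine mul_nonneg (by positivity) ?_
    rw [hb]
    rcases hτ with rfl | rfl
    · linarith [(abs_le.1 h1).2]
    · linarith [(abs_le.1 h1).1]
  simp only [Pi.mul_apply] at this
  linarith

end BetaNear

end

/-! ### Comparison of the transported profile with the stationary one -/

section

/-- The data at a fixed time: the visible part of the profile lies in `(0, s₀)`, and the slow
variable is close to its limit `β₀ q`. -/
structure IsNearSteady (g : ℝ → ℝ) (β₀ ε s₀ p q u a : ℝ) : Prop where
  near : BetaNear g β₀ ε s₀
  beta_pos : 0 < β₀
  p_nonneg : 0 ≤ p
  q_pos : 0 < q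
  p_eq : β₀ * p = 1 - β₀
  u_pos : 0 < u
  add_pos : 0 < u + a
  visible : 1 / (u + a) < s₀
  slow : |slowVar g u a - β₀ * q| ≤ ε

namespace IsNearSteady

variable {g : ℝ → ℝ} {β₀ ε s₀ p q u a : ℝ} (hN : IsNearSteady g β₀ ε s₀ p q u a)
include hN

theorem flow_pos {z : ℝ} (h0 : 0 < z) (h1 : z ≤ 1) : 0 < z / (u + a * z) :=
  div_pos h0 (add_mul_pos hN.u_pos hN.add_pos h0.le h1)

theorem flow_lt {z : ℝ} (h0 : 0 < z) (h1 : z ≤ 1) : z / (u + a * z) < s₀ :=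
  lt_of_le_of_lt (by simpa using div_add_mul_le hN.u_pos hN.add_pos h0.le h1 le_rfl) hN.visible

/-- The identity behind the convergence of the beta function: along the flow, `meanRatio` is an
affine function of `z` up to an error of order `ε`. -/
theorem abs_meanRatio_mul_sub_le {z : ℝ} (h0 : 0 < z) (h1 : z ≤ 1) :
    |meanRatio g (z / (u + a * z)) * ((u + a * z) / u) - β₀ * (p + q * z)| ≤ 4 * ε := by
  have h2 := hN.near.abs_meanRatio_flow_le hN.u_pos hN.add_pos hN.visible h0 h1
  have h3 := hN.near.abs_meanRatio_sub_le (one_div_pos.2 hN.add_pos) hN.visible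
  have h4 := hN.slow
  have hε := hN.near.eps_nonneg
  have hu := hN.u_pos.ne'
  rw [slowVar] at h4
  set k := meanRatio g (1 / (u + a))
  set k' := meanRatio g (z / (u + a * z))
  have e : k' * ((u + a * z) / u) - β₀ * (p + q * z) =
      (k - (1 - β₀)) + (a / u * k - β₀ * q) * z - (k - k') * ((u + a * z) / u) := by
    rw [mul_add, hN.p_eq]
    field_simp
    ring
  have h5 : |(a / u * k - β₀ * q) * z| ≤ ε * 1 := by
    rw [abs_mul, abs_of_pos h0]
    gcongr
  have h6 : 2 * ε * (1 - z) ≤ 2 * ε * 1 := by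
    gcongr
    linarith
  rw [e]
  refine (abs_sub _ _).trans ((add_le_add_left (abs_add_le _ _) _).trans ?_)
  linarith

/-- If `b` is within `ε` of `β₀`, then `b / (k ℓ)` is close to `1 / (p + q z)`, relatively. -/
theorem abs_rate_quotient_le {μ b z : ℝ} (hμ : 0 < μ) (hεμ : 8 * ε ≤ β₀ * μ) (hb : |b - β₀| ≤ ε)
    (h0 : 0 < z) (h1 : z ≤ 1) (hz : μ ≤ p + q * z) :
    0 < meanRatio g (z / (u + a * z)) * ((u + a * z) / u) ∧
    |b * (p + q * z) / (meanRatio g (z / (u + a * z)) * ((u + a * z) / u)) - 1| ≤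
      2 * ε / β₀ + 8 * ε / (β₀ * μ) := by
  have h2 := hN.abs_meanRatio_mul_sub_le h0 h1
  set r := meanRatio g (z / (u + a * z)) * ((u + a * z) / u)
  set P := p + q * z
  have hβ := hN.beta_pos
  have hε := hN.near.eps_nonneg
  have hP : 0 < P := hμ.trans_le hz
  have hPμ : β₀ * μ ≤ β₀ * P := by gcongr
  have hr : β₀ * P / 2 ≤ r := by linarith [(abs_le.1 h2).1]
  have hr0 : 0 < r := lt_of_lt_of_le (by positivity) hr
  refine ⟨hr0, ?_⟩
  rw [div_sub_one hr0.ne', abs_div, abs_of_pos hr0]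
  have h3 : |b * P - r| ≤ ε * P + 4 * ε := by
    have e : b * P - r = (b - β₀) * P - (r - β₀ * P) := by ring
    rw [e]
    refine (abs_sub _ _).trans ?_
    rw [abs_mul, abs_of_pos hP]
    gcongr
  calc |b * P - r| / r ≤ (ε * P + 4 * ε) / (β₀ * P / 2) := by gcongr
    _ = 2 * ε / β₀ + 8 * ε / (β₀ * P) := by
        field_simp
        ring
    _ ≤ 2 * ε / β₀ + 8 * ε / (β₀ * μ) := by gcongr

/-- The transported profile is close to the stationary one, relatively to the value at `z`. -/
theorem abs_profile_quotient_le {μ ζ₀ ε' y z : ℝ} (hμ : 0 < μ) (hεμ : 8 * ε ≤ β₀ * μ)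
    (hε' : 2 * ε / β₀ + 8 * ε / (β₀ * μ) ≤ ε') (hε2 : ε' ≤ 1 / 2) (hζ : 0 ≤ ζ₀)
    (hμζ : μ ≤ p + q * ζ₀) (hy : ζ₀ < y) (hyz : y ≤ z) (hz : z ≤ 1) :
    |g (y / (u + a * y)) / g (z / (u + a * z)) -
      Real.exp (potential p q y) / Real.exp (potential p q z)| ≤ 2 * ε' := by
  have hB := hN.near
  have hg := hB.isProfile
  have hu := hN.u_pos
  have hua := hN.add_pos
  have hy0 : 0 < y := hζ.trans_lt hy
  have hz0 := hy0.trans_le hyz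
  have hp := hN.p_nonneg
  have hq := hN.q_pos
  have hβ := hN.beta_pos
  have hε := hB.eps_nonneg
  have hε'0 : 0 ≤ ε' := le_trans (by positivity) hε'
  set s₁ := y / (u + a * y) with hs₁
  set s₂ := z / (u + a * z) with hs₂
  have hs1 : 0 < s₁ := hN.flow_pos hy0 (hyz.trans hz)
  have hs12 : s₁ ≤ s₂ := div_add_mul_le hu hua hy0.le hyz hz
  have hs2 : s₂ < s₀ := hN.flow_lt hz0 hz
  have hs2S : s₂ ≤ 1 / (u + a) := by simpa using div_add_mul_le hu hua hz0.le hz le_rfl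
  have hlt := mul_one_div_add_lt_one hu hua
  have hpos : ∀ s ∈ Icc s₁ s₂, 0 < 1 - a * s := fun s hs =>
    one_sub_mul_pos hlt (hs1.le.trans hs.1) (hs.2.trans hs2S)
  set ζ : ℝ → ℝ := fun s => u * s / (1 - a * s) with hζdef
  have hζflow : ∀ x, 0 < x → x ≤ 1 → ζ (x / (u + a * x)) = x := fun x hx0 hx1 => by
    have h1 := (add_mul_pos hu hua hx0.le hx1).ne'
    have h2 : 1 - a * (x / (u + a * x)) = u / (u + a * x) := by
      rw [eq_div_iff h1, sub_mul, mul_assoc, div_mul_cancel₀ _ h1]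
      ring
    simp only [hζdef]
    rw [h2, ← mul_div_assoc, div_div_div_cancel_right₀ h1, mul_div_cancel_left₀ _ hu.ne']
  have hflowζ : ∀ s ∈ Icc s₁ s₂, ζ s / (u + a * ζ s) = s ∧ (u + a * ζ s) / u = 1 / (1 - a * s) :=
    fun s hs => by
      have h1 := (hpos s hs).ne'
      have h2 : u + a * ζ s = u / (1 - a * s) := by
        simp only [hζdef]
        field_simp
        ring
      constructor
      · rw [h2]
        simp only [hζdef]
        rw [div_div_div_cancel_right₀ h1, mul_div_cancel_left₀ _ hu.ne']
      · rw [h2]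
        field_simp
  have hζpos : ∀ s ∈ Icc s₁ s₂, 0 < ζ s := fun s hs =>
    div_pos (mul_pos hu (hs1.trans_le hs.1)) (hpos s hs)
  have hζd : ∀ s ∈ Icc s₁ s₂, HasDerivAt ζ (u / (1 - a * s) ^ 2) s := fun s hs =>
    hasDerivAt_mul_div_one_sub (hpos s hs).ne'
  have hζmono : MonotoneOn ζ (Icc s₁ s₂) := fun s hs t ht hst => by
    simp only [hζdef]
    rw [div_le_div_iff₀ (hpos s hs) (hpos t ht)]
    nlinarith
  have hζ1 : ζ s₁ = y := hζflow y hy0 (hyz.trans hz)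
  have hζ2 : ζ s₂ = z := hζflow z hz0 hz
  set L : ℝ → ℝ := fun s => potential p q (ζ s) with hL
  have hLd : ∀ s ∈ Icc s₁ s₂, HasDerivAt L
      (1 / (p * ζ s + q * ζ s ^ 2) * (u / (1 - a * s) ^ 2)) s := fun s hs =>
    (hasDerivAt_potential hp hq (hζpos s hs)).comp s (hζd s hs)
  have hζc : ContinuousOn ζ (Icc s₁ s₂) := fun s hs => (hζd s hs).continuousAt.continuousWithinAt
  have hLc : ContinuousOn L (Icc s₁ s₂) := fun s hs => (hLd s hs).continuousAt.continuousWithinAt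
  have hL'c : ContinuousOn (fun s => 1 / (p * ζ s + q * ζ s ^ 2) * (u / (1 - a * s) ^ 2))
      (Icc s₁ s₂) :=
    (continuousOn_const.div ((continuousOn_const.mul hζc).add (continuousOn_const.mul (hζc.pow 2)))
      fun s hs => (quad_pos hp hq (hζpos s hs)).ne').mul
      (continuousOn_const.div (by fun_prop) fun s hs => (pow_pos (hpos s hs) 2).ne')
  have hgac := hB.ac_mono hs1.le hs12 hs2
  -- `(log g)' = θ (log exp L)'` with `|θ - 1| ≤ ε'`, so `g exp (-(1 ± ε') L)` is monotone
  have main : ∀ τ : ℝ, (τ = 1 ∨ τ = -1) → τ * (g s₂ * Real.exp (-(1 + τ * ε') * L s₂)) ≤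
      τ * (g s₁ * Real.exp (-(1 + τ * ε') * L s₁)) := by
    intro τ hτ
    have hE : ∀ s ∈ Icc s₁ s₂, HasDerivAt (fun s => Real.exp (-(1 + τ * ε') * L s))
        (Real.exp (-(1 + τ * ε') * L s) *
          (-(1 + τ * ε') * (1 / (p * ζ s + q * ζ s ^ 2) * (u / (1 - a * s) ^ 2)))) s :=
      fun s hs => ((hLd s hs).const_mul _).exp
    have hac := hgac.mul (absolutelyContinuousOnInterval_of_hasDerivAt hs12 hE
      (ContinuousOn.mul (fun s hs => (hE s hs).continuousAt.continuousWithinAt)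
        (continuousOn_const.mul hL'c)))
    have := le_of_ae_deriv_nonneg hs12 (hac.const_mul (-τ)) hgac fun s hs hd => by
      have hs' : s ∈ Icc s₁ s₂ := ⟨hs.1.le, hs.2.le⟩
      refine ⟨_, (hd.hasDerivAt.mul (hE s hs')).const_mul (-τ), ?_⟩
      have hs0 := hs1.trans hs.1
      have hζs := hζpos s hs'
      have hζz : ζ s ≤ 1 := (hζmono hs' (right_mem_Icc.2 hs12) hs'.2).trans (hζ2.le.trans hz)
      have hζy : ζ₀ < ζ s :=
        hy.trans_le (hζ1.ge.trans (hζmono (left_mem_Icc.2 hs12) hs' hs'.1))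
      have hP : μ ≤ p + q * ζ s := hμζ.trans (by gcongr)
      have hP0 : 0 < p + q * ζ s := hμ.trans_le hP
      have h1 := hB.near s hs0 (hs.2.trans hs2) hd
      obtain ⟨hr, h2⟩ := hN.abs_rate_quotient_le hμ hεμ h1 hζs hζz hP
      rw [(hflowζ s hs').1, (hflowζ s hs').2] at hr h2
      set θ := deriv g s * primitive g s / g s ^ 2 * (p + q * ζ s) /
        (meanRatio g s * (1 / (1 - a * s))) with hθ
      have hgs := hg.pos s hs0
      have hH := hg.primitive_pos hs0
      have h1s := hpos s hs'
      have h3 : deriv g s = θ * (g s * (1 / (p * ζ s + q * ζ s ^ 2) * (u / (1 - a * s) ^ 2))) := by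
        have e1 : p * ζ s + q * ζ s ^ 2 = (p + q * ζ s) * (u * s / (1 - a * s)) := by
          simp only [hζdef]
          ring
        rw [hθ, e1, meanRatio]
        obtain ⟨P, hPdef⟩ : ∃ P, P = p + q * ζ s := ⟨_, rfl⟩
        obtain ⟨R, hR⟩ : ∃ R, R = 1 - a * s := ⟨_, rfl⟩
        rw [← hPdef] at hP0 ⊢
        rw [← hR] at h1s ⊢
        field_simp
      have h4 : 0 < g s * (1 / (p * ζ s + q * ζ s ^ 2) * (u / (1 - a * s) ^ 2)) := by
        have := quad_pos hp hq hζs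
        positivity
      have h5 : -τ * (deriv g s * Real.exp (-(1 + τ * ε') * L s) +
          g s * (Real.exp (-(1 + τ * ε') * L s) *
            (-(1 + τ * ε') * (1 / (p * ζ s + q * ζ s ^ 2) * (u / (1 - a * s) ^ 2))))) =
          Real.exp (-(1 + τ * ε') * L s) *
            (g s * (1 / (p * ζ s + q * ζ s ^ 2) * (u / (1 - a * s) ^ 2))) *
            (τ * (1 + τ * ε' - θ)) := by
        linear_combination (-τ * Real.exp (-(1 + τ * ε') * L s)) * h3
      rw [h5]
      refine mul_nonneg (mul_nonneg (Real.exp_pos _).le h4.le) ?_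
      have h6 := abs_le.1 (h2.trans hε')
      rcases hτ with rfl | rfl
      · linarith [h6.2]
      · linarith [h6.1]
    simp only [Pi.mul_apply] at this
    linarith
  have hL1 : L s₁ = potential p q y := by simp only [hL, hζ1]
  have hL2 : L s₂ = potential p q z := by simp only [hL, hζ2]
  have hB0 : 0 ≤ potential p q z - potential p q y :=
    sub_nonneg.2 (monotoneOn_potential hp hq hy0 hz0 hyz)
  have hg2 := hg.pos s₂ (hs1.trans_le hs12)
  have m1 := main 1 (Or.inl rfl)
  have m2 := main (-1) (Or.inr rfl)
  rw [hL1, hL2] at m1 m2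
  rw [← Real.exp_sub, ← neg_sub (potential p q z)]
  have hmul : ∀ c A B : ℝ, Real.exp (-c * A) = Real.exp (-(c * (A - B))) * Real.exp (-c * B) :=
    fun c A B => by
      rw [← Real.exp_add]
      ring_nf
  refine abs_sub_exp_le hB0 hε'0 hε2 ?_ ?_
  · rw [div_le_iff₀ hg2]
    rw [hmul _ (potential p q z) (potential p q y)] at m2
    have := Real.exp_pos (-(1 + -1 * ε') * potential p q y)
    have h7 : g s₁ * Real.exp (-(1 + -1 * ε') * potential p q y) ≤
        (Real.exp (-((1 + -1 * ε') * (potential p q z - potential p q y))) * g s₂) *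
          Real.exp (-(1 + -1 * ε') * potential p q y) := by linarith
    have h8 := le_of_mul_le_mul_right h7 this
    have e : 1 + -1 * ε' = 1 - ε' := by ring
    rwa [e] at h8
  · rw [le_div_iff₀ hg2]
    rw [hmul _ (potential p q z) (potential p q y)] at m1
    have := Real.exp_pos (-(1 + 1 * ε') * potential p q y)
    have h7 : (Real.exp (-((1 + 1 * ε') * (potential p q z - potential p q y))) * g s₂) *
          Real.exp (-(1 + 1 * ε') * potential p q y) ≤
        g s₁ * Real.exp (-(1 + 1 * ε') * potential p q y) := by linarith
    have h8 := le_of_mul_le_mul_right h7 this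
    rwa [one_mul] at h8

/-- Integration of `abs_profile_quotient_le`; below `ζ₀`, where the speed `p + q z` may be too small, the
two quotients are only known to lie in `[0, 1]`. -/
theorem abs_tail_quotient_le {μ ζ₀ ε' z : ℝ} (hμ : 0 < μ) (hεμ : 8 * ε ≤ β₀ * μ)
    (hε' : 2 * ε / β₀ + 8 * ε / (β₀ * μ) ≤ ε') (hε2 : ε' ≤ 1 / 2) (hζ : 0 ≤ ζ₀)
    (hμζ : μ ≤ p + q * ζ₀) (hzζ : ζ₀ < z) (hz : z ≤ 1) :
    |(∫ y in (0 : ℝ)..z, g (y / (u + a * y))) / g (z / (u + a * z)) -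
      (∫ y in (0 : ℝ)..z, Real.exp (potential p q y)) / Real.exp (potential p q z)| ≤
      ζ₀ + 2 * ε' * z := by
  have hg := hN.near.isProfile
  have hu := hN.u_pos
  have hua := hN.add_pos
  have hp := hN.p_nonneg
  have hq := hN.q_pos
  have hβ := hN.beta_pos
  have hε := hN.near.eps_nonneg
  have hε'0 : 0 ≤ ε' := le_trans (by positivity) hε'
  have hz0 : 0 < z := hζ.trans_lt hzζ
  have i1 : IntervalIntegrable (fun y => g (y / (u + a * y))) volume 0 z := by
    simpa using hg.intervalIntegrable_comp_flow (P := fun _ => 1) continuous_const hu hua hz0.le hz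
  have i2 := intervalIntegrable_exp_potential hp hq le_rfl hz0.le
  have i3 := (i1.div_const (g (z / (u + a * z)))).sub (i2.div_const (Real.exp (potential p q z)))
  rw [← intervalIntegral.integral_div, ← intervalIntegral.integral_div,
    ← intervalIntegral.integral_sub (i1.div_const _) (i2.div_const _)]
  have hsub1 : uIcc 0 ζ₀ ⊆ uIcc 0 z := by
    rw [uIcc_of_le hζ, uIcc_of_le hz0.le]
    exact Icc_subset_Icc_right hzζ.le
  have hsub2 : uIcc ζ₀ z ⊆ uIcc 0 z := by
    rw [uIcc_of_le hzζ.le, uIcc_of_le hz0.le]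
    exact Icc_subset_Icc_left hζ
  rw [← intervalIntegral.integral_add_adjacent_intervals (i3.mono_set hsub1) (i3.mono_set hsub2)]
  have hgz := hg.pos _ (hN.flow_pos hz0 hz)
  have b1 : ‖∫ y in (0 : ℝ)..ζ₀, (g (y / (u + a * y)) / g (z / (u + a * z)) -
      Real.exp (potential p q y) / Real.exp (potential p q z))‖ ≤ 1 * |ζ₀ - 0| := by
    refine intervalIntegral.norm_integral_le_of_norm_le_const fun y hy => ?_
    rw [uIoc_of_le hζ] at hy
    have hyz : y ≤ z := hy.2.trans hzζ.le
    have h1 : g (y / (u + a * y)) / g (z / (u + a * z)) ≤ 1 :=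
      (div_le_one hgz).2 (hg.monotone (div_add_mul_le hu hua hy.1.le hyz hz))
    have h2 : Real.exp (potential p q y) / Real.exp (potential p q z) ≤ 1 :=
      (div_le_one (Real.exp_pos _)).2
        (Real.exp_le_exp.2 (monotoneOn_potential hp hq hy.1 hz0 hyz))
    have h3 := div_nonneg (hg.nonneg (y / (u + a * y))) hgz.le
    have h4 := (div_pos (Real.exp_pos (potential p q y)) (Real.exp_pos (potential p q z))).le
    rw [Real.norm_eq_abs, abs_le]
    constructor <;> linarith
  have b2 : ‖∫ y in ζ₀..z, (g (y / (u + a * y)) / g (z / (u + a * z)) -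
      Real.exp (potential p q y) / Real.exp (potential p q z))‖ ≤ 2 * ε' * |z - ζ₀| := by
    refine intervalIntegral.norm_integral_le_of_norm_le_const fun y hy => ?_
    rw [uIoc_of_le hzζ.le] at hy
    exact hN.abs_profile_quotient_le hμ hεμ hε' hε2 hζ hμζ hy.1 hy.2 hz
  rw [Real.norm_eq_abs] at b1 b2
  rw [sub_zero, abs_of_nonneg hζ, one_mul] at b1
  rw [abs_of_pos (sub_pos.2 hzζ)] at b2
  refine (abs_add_le _ _).trans ((add_le_add b1 b2).trans ?_)
  have := mul_nonneg hε'0 hζ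
  linarith

/-- A function of the form `b f / (z k ℓ)`, with `b` near `β₀` and `f` the tail quotient of the
transported profile, is close to the stationary beta function. -/
theorem abs_beta_sub_steadyBeta_le {μ ζ₀ ε' z b : ℝ} (hμ : 0 < μ) (hεμ : 8 * ε ≤ β₀ * μ)
    (hε' : 2 * ε / β₀ + 8 * ε / (β₀ * μ) ≤ ε') (hε2 : ε' ≤ 1 / 2) (hζ : 0 ≤ ζ₀)
    (hμζ : μ ≤ p + q * ζ₀) (hzζ : ζ₀ < z) (hz : z ≤ 1) (hb : |b - β₀| ≤ ε) :
    |b / (meanRatio g (z / (u + a * z)) * ((u + a * z) / u)) *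
        ((∫ y in (0 : ℝ)..z, g (y / (u + a * y))) / g (z / (u + a * z)) / z) -
      steadyBeta p q z| ≤ 3 * ε' / μ + ζ₀ / (z * (p + q * z)) := by
  have hg := hN.near.isProfile
  have hu := hN.u_pos
  have hua := hN.add_pos
  have hz0 : 0 < z := hζ.trans_lt hzζ
  have hq := hN.q_pos
  have hβ := hN.beta_pos
  have hε := hN.near.eps_nonneg
  have hε'0 : 0 ≤ ε' := le_trans (by positivity) hε'
  have hP : μ ≤ p + q * z := hμζ.trans (by gcongr)
  have hP0 : 0 < p + q * z := hμ.trans_le hP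
  have h1 := hN.abs_tail_quotient_le hμ hεμ hε' hε2 hζ hμζ hzζ hz
  obtain ⟨hr, h2⟩ := hN.abs_rate_quotient_le hμ hεμ hb hz0 hz hP
  have h2 := h2.trans hε'
  have hgz := hg.pos _ (hN.flow_pos hz0 hz)
  have i1 : IntervalIntegrable (fun y => g (y / (u + a * y))) volume 0 z := by
    simpa using hg.intervalIntegrable_comp_flow (P := fun _ => 1) continuous_const hu hua hz0.le hz
  have hf0 : 0 ≤ (∫ y in (0 : ℝ)..z, g (y / (u + a * y))) / g (z / (u + a * z)) :=
    div_nonneg (intervalIntegral.integral_nonneg hz0.le fun y _ => hg.nonneg _) hgz.le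
  have hf1 : (∫ y in (0 : ℝ)..z, g (y / (u + a * y))) / g (z / (u + a * z)) ≤ z := by
    rw [div_le_iff₀ hgz]
    have := intervalIntegral.integral_mono_on hz0.le i1
      ((continuous_const (y := g (z / (u + a * z)))).intervalIntegrable 0 z) fun y hy =>
        hg.monotone (div_add_mul_le hu hua hy.1 hy.2 hz)
    simpa using this
  rw [steadyBeta]
  set f := (∫ y in (0 : ℝ)..z, g (y / (u + a * y))) / g (z / (u + a * z))
  set f₀ := (∫ y in (0 : ℝ)..z, Real.exp (potential p q y)) / Real.exp (potential p q z)
  set r := meanRatio g (z / (u + a * z)) * ((u + a * z) / u)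
  set P := p + q * z with hPdef
  have e0 : p * z + q * z ^ 2 = z * P := by rw [hPdef]; ring
  have e : b / r * (f / z) - f₀ / (p * z + q * z ^ 2) =
      (b * P / r - 1) / P * (f / z) + (f - f₀) / (z * P) := by
    rw [e0]
    field_simp
    ring
  rw [e]
  refine (abs_add_le _ _).trans ?_
  have h3 : |(b * P / r - 1) / P * (f / z)| ≤ ε' / μ * 1 := by
    rw [abs_mul, abs_div, abs_of_pos hP0, abs_of_nonneg (div_nonneg hf0 hz0.le)]
    gcongr
    exact (div_le_one hz0).2 hf1
  have h4 : |(f - f₀) / (z * P)| ≤ 2 * ε' / μ + ζ₀ / (z * P) := by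
    rw [abs_div, abs_of_pos (mul_pos hz0 hP0)]
    calc |f - f₀| / (z * P) ≤ (ζ₀ + 2 * ε' * z) / (z * P) := by gcongr
      _ = 2 * ε' / P + ζ₀ / (z * P) := by
          field_simp
          ring
      _ ≤ 2 * ε' / μ + ζ₀ / (z * P) := by gcongr
  have h5 : ε' / μ * 1 + (2 * ε' / μ) = 3 * ε' / μ := by ring
  linarith

end IsNearSteady

end

/-! ### Convergence of the beta functions -/

section

namespace IsNearSteady

variable {g : ℝ → ℝ} {β₀ ε s₀ p q u a : ℝ} (hN : IsNearSteady g β₀ ε s₀ p q u a)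
  {f : ℝ → ℝ} {c : ℝ} (hc : 0 < c)
  (hf : ∀ x ∈ Ico (0 : ℝ) 1, f x = c * g ((1 - x) / (u + a * (1 - x))))
include hN hc hf

/-- Wherever the beta function of the transported profile is defined, including one-sidedly at the
end point `0`, its factor `b` coming from the profile `g` is within `ε` of `β₀`: the monotonicity of
`g (∫ g)^(-b')` for `b' = β₀ ± ε` bounds the derivative on either side. -/
theorem exists_betaFun_eq {x : ℝ} (hx : x ∈ betaDomain f) :
    ∃ b, |b - β₀| ≤ ε ∧ betaFun f x =
      b / (meanRatio g ((1 - x) / (u + a * (1 - x))) * ((u + a * (1 - x)) / u)) *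
        ((∫ y in (0 : ℝ)..1 - x, g (y / (u + a * y))) / g ((1 - x) / (u + a * (1 - x))) /
          (1 - x)) := by
  obtain ⟨hx1, hd⟩ := hx
  have hg := hN.near.isProfile
  have hu := hN.u_pos
  have hua := hN.add_pos
  have hz0 : 0 < 1 - x := by linarith [hx1.2]
  have hz1 : 1 - x ≤ 1 := by linarith [hx1.1]
  have hL := add_mul_pos hu hua hz0.le hz1
  set S : ℝ → ℝ := fun y => (1 - y) / (u + a * (1 - y)) with hS
  have hσ0 : 0 < S x := hN.flow_pos hz0 hz1
  have hgσ := hg.pos _ hσ0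
  have hH := hg.primitive_pos hσ0
  have hSd : HasDerivAt S (-(u / (u + a * (1 - x)) ^ 2)) x := by
    have h1 := (hasDerivAt_id x).const_sub 1
    refine (h1.div ((h1.const_mul a).const_add u) hL.ne').congr_deriv ?_
    simp only [id]
    field_simp
    ring
  have hHd : HasDerivAt (fun y => Real.log (primitive g (S y)))
      (g (S x) * -(u / (u + a * (1 - x)) ^ 2) / primitive g (S x)) x :=
    ((hg.hasDerivAt_primitive (S x)).comp x hSd).log hH.ne'
  set D := derivWithin f (Ico 0 1) x with hD
  obtain ⟨b, hb⟩ : ∃ b, D = -(b * f x * (g (S x) * (u / (u + a * (1 - x)) ^ 2) /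
      primitive g (S x))) := by
    have hfx : f x ≠ 0 := by
      rw [hf x hx1]
      exact (mul_pos hc hgσ).ne'
    refine ⟨-D / (f x * (g (S x) * (u / (u + a * (1 - x)) ^ 2) / primitive g (S x))), ?_⟩
    field_simp
  have key : ∀ τ : ℝ, (τ = 1 ∨ τ = -1) → 0 ≤ τ * (β₀ + τ * ε - b) := by
    intro τ hτ
    set b' := β₀ + τ * ε with hb'
    have hmono : MonotoneOn (fun y => τ * (f y * Real.exp (-b' * Real.log (primitive g (S y)))))
        (Ico 0 1) := by
      intro y₁ h1 y₂ h2 h12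
      have e1 : 0 < 1 - y₂ := by linarith [h2.2]
      have e2 : 1 - y₁ ≤ 1 := by linarith [h1.1]
      have e3 : 1 - y₂ ≤ 1 - y₁ := by linarith
      have := hN.near.mul_exp_log_primitive hτ hb' (hN.flow_pos e1 (e3.trans e2))
        (div_add_mul_le hu hua e1.le e3 e2) (hN.flow_lt (e1.trans_le e3) e2)
      have := mul_le_mul_of_nonneg_left this hc.le
      simp only [hS]
      rw [hf y₁ h1, hf y₂ h2]
      linarith
    have h1 := hmono.derivWithin_nonneg (x := x)
    have h2 := (hd.hasDerivWithinAt.mul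
      (hHd.const_mul (-b')).exp.hasDerivWithinAt).const_mul τ
    have h3 := h2.derivWithin ((uniqueDiffOn_Ico 0 1) x hx1)
    rw [show derivWithin (fun y => τ * (f y * Real.exp (-b' * Real.log (primitive g (S y)))))
      (Ico 0 1) x = _ from h3, ← hD, hb] at h1
    set R := f x * (g (S x) * (u / (u + a * (1 - x)) ^ 2) / primitive g (S x)) with hR
    set E := Real.exp (-b' * Real.log (primitive g (S x))) with hE
    have hR0 : 0 < R := by
      rw [hR, hf x hx1]
      positivity
    have e : τ * (-(b * f x * (g (S x) * (u / (u + a * (1 - x)) ^ 2) / primitive g (S x))) * E +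
        f x * (E * (-b' * (g (S x) * -(u / (u + a * (1 - x)) ^ 2) / primitive g (S x))))) =
        (R * E) * (τ * (b' - b)) := by
      rw [hR]
      ring
    rw [e] at h1
    exact nonneg_of_mul_nonneg_right h1 (mul_pos hR0 (Real.exp_pos _))
  refine ⟨b, abs_le.2 ⟨?_, ?_⟩, ?_⟩
  · linarith [key (-1) (Or.inr rfl)]
  · linarith [key 1 (Or.inl rfl)]
  · have ht : tail f x = c * ∫ y in (0 : ℝ)..1 - x, g (y / (u + a * y)) := by
      have h1 := intervalIntegral.integral_comp_sub_left (fun y => f y) 1 (a := 0) (b := 1 - x)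
      rw [sub_zero, sub_sub_cancel] at h1
      rw [tail, ← h1, ← intervalIntegral.integral_const_mul]
      refine intervalIntegral.integral_congr_uIoo fun y hy => ?_
      rw [uIoo_of_le hz0.le] at hy
      have := hf (1 - y) ⟨by linarith [hy.2, hx1.1], by linarith [hy.1]⟩
      simpa using this
    rw [betaFun, density, ← hD, hb, ht, hf x hx1, meanRatio]
    simp only [hS] at hgσ hH ⊢
    set I := ∫ y in (0 : ℝ)..1 - x, g (y / (u + a * y))
    obtain ⟨z, hz⟩ : ∃ z, z = 1 - x := ⟨_, rfl⟩
    rw [← hz] at hgσ hH hz0 hL ⊢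
    obtain ⟨L, hL'⟩ : ∃ L, L = u + a * z := ⟨_, rfl⟩
    rw [← hL'] at hgσ hH hL ⊢
    field_simp

theorem abs_betaFun_sub_le {μ ζ₀ ε' x : ℝ} (hμ : 0 < μ) (hεμ : 8 * ε ≤ β₀ * μ)
    (hε' : 2 * ε / β₀ + 8 * ε / (β₀ * μ) ≤ ε') (hε2 : ε' ≤ 1 / 2) (hζ : 0 ≤ ζ₀)
    (hμζ : μ ≤ p + q * ζ₀) (hxζ : ζ₀ < 1 - x) (hx : x ∈ betaDomain f) :
    |betaFun f x - steadyBeta p q (1 - x)| ≤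
      3 * ε' / μ + ζ₀ / ((1 - x) * (p + q * (1 - x))) := by
  obtain ⟨b, hb, e⟩ := hN.exists_betaFun_eq hc hf hx
  rw [e]
  exact hN.abs_beta_sub_steadyBeta_le hμ hεμ hε' hε2 hζ hμζ hxζ (by linarith [hx.1.1]) hb

end IsNearSteady

section Solution

variable {φ ψ : Polynomial ℝ} (h : IsAdmissible φ ψ) (hφ : φ.natDegree ≤ 2) (hψ : ψ.natDegree ≤ 2)
  {w₀ : ℝ → ℝ} (hw : IsInitialDatum w₀) {w : ℝ → ℝ → ℝ} {κ : ℝ → ℝ}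
  (hs : IsSolution φ ψ w₀ w κ)
include h hφ hψ hw hs

theorem IsSolution.isMassFlow : IsMassFlow (profile w₀) (stretch ψ) |slope φ| (uOf φ ψ κ)
    (fun t => aCoef φ ψ (uOf φ ψ κ t, vOf φ ψ κ t)) (fun t => slope φ - slope ψ * κ t) where
  isProfile := hw.isProfile
  one_le := h.one_le_stretch hψ
  pos := h.abs_slope_phi_pos
  lt_one := h.abs_slope_phi_lt
  u_pos := (hs.isPath h).u_pos
  a_nonneg t ht := h.aCoef_nonneg hψ ((hs.isPath h).mem ht) ((hs.isPath h).v_nonneg ht)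
  u_deriv := (hs.isPath h).u_deriv
  a_deriv t ht := (hs.isPath h).hasDerivWithinAt_aCoef h ht
  rate_pos := (hs.isPath h).rate_pos
  rate_cont := (hs.isPath h).rate_cont
  mass_eq t ht := by
    rw [← hs.exp_mul_G h hψ hφ ht, h.G_eq hψ ((hs.isPath h).mem ht)]
  planar t ht := by
    rw [← hs.planar_ode h hψ hw hφ ht, h.planar_eq hψ hw ((hs.isPath h).mem ht)]

variable {β₀ : ℝ} (hβ₀ : 0 < β₀) (hβ : BetaLimit (profile w₀) β₀)
include hβ₀ hβ

theorem IsSolution.tendsto_kappa :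
    Tendsto κ atTop (𝓝 ((1 / β₀ - slope φ - 1) / |slope ψ|)) := by
  have h1 := (hs.isMassFlow h hφ hψ hw).tendsto_rate hw.absolutelyContinuous_profile hβ hβ₀
  have h2 := h.abs_slope_psi_pos
  have h3 := (h1.add_const |slope φ|).div_const |slope ψ|
  have e : ((1 - β₀) / β₀ + |slope φ|) / |slope ψ| = (1 / β₀ - slope φ - 1) / |slope ψ| := by
    rw [h.abs_slope_phi]
    field_simp
    ring
  rw [e] at h3
  refine h3.congr fun t => ?_
  rw [← h.kappa_mul, mul_div_cancel_right₀ _ h2.ne']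

variable {p q : ℝ} (hp : 0 ≤ p) (hβp : β₀ * p = 1 - β₀)
  (hq : q = (stretch ψ - 1) * p + |slope φ| * stretch ψ)
include hp hβp hq

/-- For late times, the solution is nearly stationary with any prescribed accuracy. -/
theorem IsSolution.eventually_isNearSteady {ε : ℝ} (hε : 0 < ε) :
    ∀ᶠ t in atTop, 0 ≤ t ∧ ∃ s₀, IsNearSteady (profile w₀) β₀ ε s₀ p q (uOf φ ψ κ t)
      (aCoef φ ψ (uOf φ ψ κ t, vOf φ ψ κ t)) := by
  have hF := hs.isMassFlow h hφ hψ hw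
  have hac := hw.absolutelyContinuous_profile
  obtain ⟨s₀, hB⟩ := hβ.exists_betaNear hw.isProfile hac hε
  filter_upwards [hF.eventually_inv_add_lt hB.pos,
    (hF.tendsto_slowVar hac hβ).eventually (Metric.closedBall_mem_nhds _ hε)] with t h1 h2
  have e : β₀ * q = |slope φ| * stretch ψ * β₀ + (stretch ψ - 1) * (1 - β₀) := by
    rw [hq, ← hβp]
    ring
  refine ⟨h1.1.le, s₀, hB, hβ₀, hp, h.quad_coeff_pos hψ hp hq, hβp, hF.u_pos t h1.1.le,
    hF.denom_pos h1.1.le, h1.2, ?_⟩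
  rw [e]
  exact h2

/-- Convergence of the beta functions away from the points where `p + q z` is small: on the set `S`
the cut-off `ζ₀` of the tail costs at most `δ / 2`. -/
theorem IsSolution.betaTendstoUniformlyOn {κ' : ℝ} (hκ : κ' * |slope ψ| = p + |slope φ|)
    {W : ℝ → ℝ} (hW : IsSteadyState φ ψ κ' W) {S : Set ℝ}
    (hS : ∀ δ > 0, ∃ ζ₀, 0 ≤ ζ₀ ∧ 0 < p + q * ζ₀ ∧ ∀ x ∈ S ∩ Ico 0 1, ζ₀ < 1 - x ∧
      ζ₀ / ((1 - x) * (p + q * (1 - x))) ≤ δ) :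
    BetaTendstoUniformlyOn w W S := by
  intro δ hδ
  obtain ⟨ζ₀, hζ, hμ, hS⟩ := hS (δ / 2) (half_pos hδ)
  set μ := p + q * ζ₀ with hμdef
  set ε' := min (1 / 2) (δ * μ / 6) with hε'
  have hε'0 : 0 < ε' := lt_min (by norm_num) (by positivity)
  obtain ⟨ε, hε, hε1, hε2⟩ : ∃ ε > 0, 8 * ε ≤ β₀ * μ ∧ 2 * ε / β₀ + 8 * ε / (β₀ * μ) ≤ ε' := by
    refine ⟨min (β₀ * μ / 8) (ε' / (2 / β₀ + 8 / (β₀ * μ))), lt_min (by positivity) (by positivity),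
      ?_, ?_⟩
    · linarith [min_le_left (β₀ * μ / 8) (ε' / (2 / β₀ + 8 / (β₀ * μ)))]
    · have h1 := min_le_right (β₀ * μ / 8) (ε' / (2 / β₀ + 8 / (β₀ * μ)))
      rw [le_div_iff₀ (by positivity)] at h1
      refine le_trans (le_of_eq ?_) h1
      ring
  filter_upwards [hs.eventually_isNearSteady h hφ hψ hw hβ₀ hβ hp hβp hq hε] with t ht x hx
  obtain ⟨ht, s₀, hN⟩ := ht
  obtain ⟨hx1, hx2⟩ := hS x ⟨hx.1, hx.2.1⟩
  have h1 := hN.abs_betaFun_sub_le (f := fun y => w y t) (Real.exp_pos t) (fun y hy => by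
    rw [hs.eq_flow h hψ hφ hy ht, h.comp_flowMap hψ (w₀ := w₀) ((hs.isPath h).mem ht) hy]) hμ hε1 hε2
    (min_le_left _ _) hζ le_rfl hx1 hx.2
  rw [hW.betaFun_eq h hφ hψ hp hκ hq hx.2.1]
  have h2 : 3 * ε' / μ ≤ δ / 2 := by
    rw [div_le_iff₀ hμ]
    linarith [min_le_right (1 / 2) (δ * μ / 6)]
  linarith

end Solution

end

end LSW

end

theorem theorem1p2 (φ ψ : Polynomial ℝ) (hφ : φ.natDegree ≤ 2) (hψ : ψ.natDegree ≤ 2)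
    (hφψ : LSW.IsAdmissible φ ψ)
    (w₀ : ℝ → ℝ) (hw₀ : LSW.IsInitialDatum w₀)
    (β₀ : ℝ) (hβ₀ : 0 < β₀)
    (hβ : Tendsto (LSW.betaFun w₀) (𝓝[LSW.betaDomain w₀] 1) (𝓝 β₀)) :
    LSW.ReducesToPlanarODE φ ψ w₀ ∧
    (β₀ < 1 →
      (∃ W, LSW.IsSteadyState φ ψ ((1 / β₀ - LSW.slope φ - 1) / |LSW.slope ψ|) W) ∧
      ∀ (w : ℝ → ℝ → ℝ) (κ : ℝ → ℝ), LSW.IsSolution φ ψ w₀ w κ →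
        Tendsto κ atTop (𝓝 ((1 / β₀ - LSW.slope φ - 1) / |LSW.slope ψ|)) ∧
        ∀ W, LSW.IsSteadyState φ ψ ((1 / β₀ - LSW.slope φ - 1) / |LSW.slope ψ|) W →
          LSW.BetaTendstoUniformlyOn w W (Ico 0 1)) ∧
    (β₀ = 1 →
      (∃ W, LSW.IsSteadyState φ ψ (LSW.slope φ / LSW.slope ψ) W) ∧
      ∀ (w : ℝ → ℝ → ℝ) (κ : ℝ → ℝ), LSW.IsSolution φ ψ w₀ w κ →
        Tendsto κ atTop (𝓝 (LSW.slope φ / LSW.slope ψ)) ∧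
        ∀ W, LSW.IsSteadyState φ ψ (LSW.slope φ / LSW.slope ψ) W →
          ∀ ε : ℝ, 0 < ε → ε < 1 → LSW.BetaTendstoUniformlyOn w W (Icc 0 (1 - ε))) := by
  have hlim := LSW.betaLimit_profile hβ
  have hs := hφψ.abs_slope_psi_pos
  refine ⟨LSW.reducesToPlanarODE hφψ hψ hw₀ hφ, fun h1 => ?_, ?_⟩
  · set p := 1 / β₀ - 1 with hp
    have hp0 : 0 < p := sub_pos.2 (one_lt_one_div hβ₀ h1)
    have hβp : β₀ * p = 1 - β₀ := by
      rw [hp, mul_sub, mul_one_div_cancel hβ₀.ne', mul_one]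
    have hκ : (1 / β₀ - LSW.slope φ - 1) / |LSW.slope ψ| * |LSW.slope ψ| = p + |LSW.slope φ| := by
      rw [div_mul_cancel₀ _ hs.ne', hφψ.abs_slope_phi]
      ring
    refine ⟨LSW.exists_isSteadyState hφψ hφ hψ hp0.le hκ rfl, fun w κ hsol =>
      ⟨hsol.tendsto_kappa hφψ hφ hψ hw₀ hβ₀ hlim, fun W hW =>
        hsol.betaTendstoUniformlyOn hφψ hφ hψ hw₀ hβ₀ hlim hp0.le hβp rfl hκ hW fun δ hδ =>
          ⟨0, le_rfl, by linarith, fun x hx => ⟨by linarith [hx.2.2], ?_⟩⟩⟩⟩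
    rw [zero_div]
    exact hδ.le
  · rintro rfl
    have hκ₀ : LSW.slope φ / LSW.slope ψ = (1 / 1 - LSW.slope φ - 1) / |LSW.slope ψ| := by
      rw [hφψ.abs_slope_psi]
      ring
    have hκ : LSW.slope φ / LSW.slope ψ * |LSW.slope ψ| = 0 + |LSW.slope φ| := by
      rw [hκ₀, div_mul_cancel₀ _ hs.ne', hφψ.abs_slope_phi]
      ring
    refine ⟨LSW.exists_isSteadyState hφψ hφ hψ le_rfl hκ rfl, fun w κ hsol => ⟨?_,
      fun W hW ε hε _ => ?_⟩⟩
    · rw [hκ₀]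
      exact hsol.tendsto_kappa hφψ hφ hψ hw₀ hβ₀ hlim
    have hq := hφψ.quad_coeff_pos (p := 0) hψ le_rfl rfl
    refine hsol.betaTendstoUniformlyOn hφψ hφ hψ hw₀ hβ₀ hlim le_rfl (by norm_num) rfl hκ hW
      fun δ hδ => ?_
    set q := (LSW.stretch ψ - 1) * 0 + |LSW.slope φ| * LSW.stretch ψ
    -- here `p = 0`, and the tail is cut off at a height well below `ε ≤ 1 - x`
    refine ⟨min (ε / 2) (δ * (q * ε ^ 2)), by positivity, ?_, fun x hx => ?_⟩
    · rw [zero_add]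
      positivity
    have hz : ε ≤ 1 - x := by linarith [hx.1.2]
    refine ⟨(min_le_left _ _).trans_lt (by linarith), ?_⟩
    have e : (1 - x) * (0 + q * (1 - x)) = q * (1 - x) ^ 2 := by ring
    have hz0 : 0 < 1 - x := hε.trans_le hz
    rw [e, div_le_iff₀ (by positivity)]
    refine (min_le_right _ _).trans ?_
    gcongr
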